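/- **Theorem 4.2.** *Setting.* Let $d\in\{1,2,3\}$, $\Omega=\prod_{i=1}^d(a_i,b_i)\subset\mathbb R^d$, $p\in\mathbb N^+$, $T>0$, $0<\varepsilon\le1$. Consider the oscillatory complex nonlinear Klein–Gordon equation with periodic boundary conditions on $\Omega$, $$\varepsilon^{2p}\partial_{rr}\nu-\frac1{\varepsilon^{2p}}\Delta\nu+\frac1{\varepsilon^{2p}}\nu+|\nu|^{2p}\nu=0,\qquad \nu(\cdot,0)=u_0,\quad \partial_r\nu(\cdot,0)=\varepsilon^{-2p}u_1,\qquad 0\le r\le T,$$ for complex-valued $\nu(x,r)$. For $l\in\mathbb Z^d$ put $\mu_l=\big(2\pi l_i/(b_i-a_i)\big)_{i}$, $\delta_l=\sqrt{1+|\mu_l|^2}$, $\widehat u_l=|\Omega|^{-1}\int_\Omega u(x)e^{-i\mu_l\cdot(x-a)}dx$, $\|u\|_s^2=\sum_l\delta_l^{2s}|\widehat u_l|^2$, $\|\cdot\|=\|\cdot\|_0$. *The TSFP method.* Let $N_1,\dots,N_d$ be even positive integers, $x_j=\big(a_i+j_i(b_i-a_i)/N_i\big)_i$ for $0\le j_i<N_i$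 (values at $j_i=N_i$ being those at $j_i=0$), $h=\max_i(b_i-a_i)/N_i$, $\mathcal T_N=\prod_i\{-N_i/2,\dots,N_i/2-1\}$, $\widetilde U_l=(\prod_iN_i)^{-1}\sum_jU_je^{-i\mu_l\cdot(x_j-a)}$ and $I_NU(x)=\sum_{l\in\mathcal T_N}\widetilde U_le^{i\mu_l\cdot(x-a)}$. For a symbol $g=(g_l)$ let $(gU)_j=\sum_{l\in\mathcal T_N}g_l\widetilde U_le^{i\mu_l\cdot(x_j-a)}$. With time step $\kappa>0$, $r_n=n\kappa$, $\tau=\kappa/\varepsilon^{2p}$ and $f(z)=|z|^{2p}z$, set $\eta^0_{\pm,j}=u_0(x_j)\mp i(\delta^{-1}u_1)_j$ and, for $n\ge0$, $$\eta_\pm^{(1)}=e^{\pm i\tau\delta/2}\eta_\pm^n,\qquad \eta_\pm^{(2)}=\eta_\pm^{(1)}\pm\varepsilon^{2p}\tau\, i\delta^{-1}f\Big(\tfrac12\big(\eta_+^{(1)}+\eta_-^{(1)}\big)\Big),\qquad \eta_\pm^{n+1}=e^{\pm i\tau\delta/2}\eta_\pm^{(2)},$$ $$\nu^n=\tfrac12(\eta_+^n+\eta_-^n),\qquad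 \mu^n=\varepsilon^{-2p}\,\tfrac i2\,\delta(\eta_+^n-\eta_-^n).$$ *Claim 1.* Let $m$ be an integer with $m>d/2$ (so $m\ge1$ if $d=1$, and $m\ge2$ if $d=2,3$), $\alpha>0$ and $M\ge0$. There are $h_0>0$, $\bar\kappa\in(0,1)$ and $C>0$, depending only on $\Omega,p,T,m,\alpha,M$, such that the following holds for all $0<\kappa_0\le\bar\kappa$ and $0<\varepsilon\le1$. If $\nu$ is a solution with $$\|\nu(\cdot,r)\|_{m+1}\le M,\qquad \|\partial_r\nu(\cdot,r)\|_m\le M\varepsilon^{-2p}\qquad(0\le r\le T),$$ and if $h\le h_0$ and $0<\kappa\le\alpha\kappa_0\varepsilon^{2p}$, then for all $0\le n\le T/\kappa$ $$\|\nu(\cdot,r_n)-I_N\nu^n\|_1+\varepsilon^{2p}\|\partial_r\nu(\cdot,r_n)-I_N\mu^n\|\le C\Big(h^m+\frac{\kappa^2}{\varepsilon^{2p}}+\kappa_0^{m+1}\Big).$$ *Claim 2 (smooth solutions).* Let $m\ge0$ be an integer, $(M_s)_{s\ge0}$ a sequence of reals and $\theta>0$. There are $h_0,\kappa_1,C>0$,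 depending only on $\Omega,p,T,m,(M_s)_s,\theta$, such that for all $0<\varepsilon\le1$: if $\nu$ is a solution with $\|\nu(\cdot,r)\|_{s+1}\le M_s$ and $\|\partial_r\nu(\cdot,r)\|_s\le M_s\varepsilon^{-2p}$ for all integers $s\ge0$ and $0\le r\le T$, and if $h\le h_0$ and $0<\kappa\le\kappa_1\varepsilon^{2p+\theta}$, then for all $0\le n\le T/\kappa$ $$\|\nu(\cdot,r_n)-I_N\nu^n\|_1+\varepsilon^{2p}\|\partial_r\nu(\cdot,r_n)-I_N\mu^n\|\le C\Big(h^m+\frac{\kappa^2}{\varepsilon^{2p}}\Big).$$ Here a solution is a pair $\nu(\cdot,r)$, $\partial_r\nu(\cdot,r)$ of continuous periodic functions, $0\le r\le T$, that has the above initial values and satisfies the equation for all $r\in[0,T]$ when tested in space against smooth periodic functions. -/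

import Mathlib

open scoped ContDiff

noncomputable section

namespace KleinGordon

/-- Points of `ℝ^d`. -/
abbrev Pt (d : ℕ) : Type := EuclideanSpace ℝ (Fin d)

/-- The domain `Ω = ∏ (a_i, b_i)`. -/
def box {d : ℕ} (a b : Fin d → ℝ) : Set (Pt d) :=
  {x | ∀ i, x i ∈ Set.Ioo (a i) (b i)}

/-- `u` is periodic with period `b_i - a_i` in the `i`-th variable. -/
def IsPeriodic {d : ℕ} (a b : Fin d → ℝ) (u : Pt d → ℂ) : Prop :=
  ∀ (i : Fin d) (x : Pt d), u (x + EuclideanSpace.single i (b i - a i)) = u x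

/-- The frequency vector `μ_l`, with components `2 π l_i / (b_i - a_i)`. -/
def freq {d : ℕ} (a b : Fin d → ℝ) (l : Fin d → ℤ) (i : Fin d) : ℝ :=
  2 * Real.pi * (l i : ℝ) / (b i - a i)

/-- `1 + |μ_l|²`. -/
def weight {d : ℕ} (a b : Fin d → ℝ) (l : Fin d → ℤ) : ℝ :=
  1 + ∑ i, freq a b l i ^ 2

/-- `δ_l = √(1 + |μ_l|²)`, the symbol of `⟨∇⟩ = √(1 - Δ)`. -/
def delta {d : ℕ} (a b : Fin d → ℝ) (l : Fin d → ℤ) : ℝ :=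
  Real.sqrt (weight a b l)

/-- The plane wave `e^{i μ_l · (x - a)}`. -/
def wave {d : ℕ} (a b : Fin d → ℝ) (l : Fin d → ℤ) (x : Pt d) : ℂ :=
  Complex.exp (Complex.I * ((∑ i, freq a b l i * (x i - a i) : ℝ) : ℂ))

/-- The Fourier coefficient `|Ω|⁻¹ ∫_Ω u(x) e^{-i μ_l · (x - a)} dx`
(the conjugate of a plane wave is the wave with the opposite index). -/
def fourierCoef {d : ℕ} (a b : Fin d → ℝ) (u : Pt d → ℂ) (l : Fin d → ℤ) : ℂ :=
  ((∏ i, (b i - a i) : ℝ) : ℂ)⁻¹ * ∫ x in box a b, u x * wave a b (-l) x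

/-- The periodic Sobolev norm `‖u‖_s = (∑_l (1 + |μ_l|²)^s |û_l|²)^{1/2}`, with value `∞` if the
series diverges. For `s = 0` it is the norm of `L²(Ω)` (normalized by the volume). -/
def sobolevNorm {d : ℕ} (a b : Fin d → ℝ) (s : ℕ) (u : Pt d → ℂ) : ENNReal :=
  (∑' l : Fin d → ℤ, ENNReal.ofReal (weight a b l ^ s * ‖fourierCoef a b u l‖ ^ 2)) ^ (1 / 2 : ℝ)

/-- The power nonlinearity `f(z) = |z|^{2p} z`. -/
def nonlin (p : ℕ) (z : ℂ) : ℂ := ((‖z‖ ^ (2 * p) : ℝ) : ℂ) * z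

/-- `ν` is a solution on `[0, T]`, with time derivative `μ = ∂_r ν`, of the oscillatory complex
nonlinear Klein-Gordon equation
`ε^{2p} ∂_rr ν - ε^{-2p} Δν + ε^{-2p} ν + |ν|^{2p} ν = 0`,
`ν(0) = u₀`, `∂_r ν(0) = ε^{-2p} u₁`, with periodic boundary conditions on `∏ (a_i, b_i)`.
Both `ν(r)` and `μ(r)` are given by their continuous periodic representatives, and the equation is
tested in space against smooth periodic functions. -/
structure IsSolution {d : ℕ} (a b : Fin d → ℝ) (p : ℕ) (ε T : ℝ) (u₀ u₁ : Pt d → ℂ)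
    (ν μ : ℝ → Pt d → ℂ) : Prop where
  continuous_left : ∀ r ∈ Set.Icc 0 T, Continuous (ν r)
  continuous_right : ∀ r ∈ Set.Icc 0 T, Continuous (μ r)
  periodic_left : ∀ r ∈ Set.Icc 0 T, IsPeriodic a b (ν r)
  periodic_right : ∀ r ∈ Set.Icc 0 T, IsPeriodic a b (μ r)
  initial_left : ∀ x, ν 0 x = u₀ x
  initial_right : ∀ x, μ 0 x = ((ε ^ (2 * p) : ℝ) : ℂ)⁻¹ * u₁ x
  deriv_left : ∀ χ : Pt d → ℂ, ContDiff ℝ ∞ χ → IsPeriodic a b χ → ∀ r ∈ Set.Icc 0 T,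
    HasDerivWithinAt (fun s => ∫ x in box a b, ν s x * χ x)
      (∫ x in box a b, μ r x * χ x) (Set.Icc 0 T) r
  deriv_right : ∀ χ : Pt d → ℂ, ContDiff ℝ ∞ χ → IsPeriodic a b χ → ∀ r ∈ Set.Icc 0 T,
    HasDerivWithinAt (fun s => ((ε ^ (2 * p) : ℝ) : ℂ) * ∫ x in box a b, μ s x * χ x)
      (((ε ^ (2 * p) : ℝ) : ℂ)⁻¹ *
          (∫ x in box a b, ν r x * (Laplacian.laplacian χ x - χ x))
        - ∫ x in box a b, nonlin p (ν r x) * χ x)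
      (Set.Icc 0 T) r

/-- Grid vectors `(U_j)`, `0 ≤ j_i < N_i`; the values at `j_i = N_i` are those at `j_i = 0` by
periodicity and are not stored. -/
abbrev GridVec {d : ℕ} (N : Fin d → ℕ) : Type := ((i : Fin d) → Fin (N i)) → ℂ

/-- The grid point `x_j`, with components `a_i + j_i h_i`, `h_i = (b_i - a_i) / N_i`. -/
def gridPt {d : ℕ} (a b : Fin d → ℝ) (N : Fin d → ℕ) (j : (i : Fin d) → Fin (N i)) : Pt d :=
  WithLp.toLp 2 fun i => a i + ((j i : ℕ) : ℝ) * ((b i - a i) / (N i : ℝ))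

/-- The mesh size `h = max_i (b_i - a_i) / N_i`. -/
def meshSize {d : ℕ} (a b : Fin d → ℝ) (N : Fin d → ℕ) : ℝ :=
  ⨆ i, (b i - a i) / (N i : ℝ)

/-- The index set `𝒯_N`: all `l` with `-N_i/2 ≤ l_i ≤ N_i/2 - 1`. -/
def modes {d : ℕ} (N : Fin d → ℕ) : Finset (Fin d → ℤ) :=
  Fintype.piFinset fun i => Finset.Ico (-((N i / 2 : ℕ) : ℤ)) ((N i / 2 : ℕ) : ℤ)

/-- The discrete Fourier coefficient `Ũ_l = (∏ N_i)⁻¹ ∑_j U_j e^{-i μ_l · (x_j - a)}`. -/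
def dft {d : ℕ} (a b : Fin d → ℝ) (N : Fin d → ℕ) (U : GridVec N) (l : Fin d → ℤ) : ℂ :=
  ((∏ i, N i : ℕ) : ℂ)⁻¹ * ∑ j, U j * wave a b (-l) (gridPt a b N j)

/-- The trigonometric interpolant `I_N U = ∑_{l ∈ 𝒯_N} Ũ_l e^{i μ_l · (x - a)}`. -/
def interp {d : ℕ} (a b : Fin d → ℝ) (N : Fin d → ℕ) (U : GridVec N) (x : Pt d) : ℂ :=
  ∑ l ∈ modes N, dft a b N U l * wave a b l x

/-- The discrete Fourier multiplier
`(g U)_j = ∑_{l ∈ 𝒯_N} g_l Ũ_l e^{i μ_l · (x_j - a)}`. -/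
def multiplier {d : ℕ} (a b : Fin d → ℝ) (N : Fin d → ℕ) (g : (Fin d → ℤ) → ℂ)
    (U : GridVec N) : GridVec N :=
  fun j => ∑ l ∈ modes N, g l * dft a b N U l * wave a b l (gridPt a b N j)

/-- The linear half step `e^{i σ (τ/2) ⟨∇⟩}`, for the sign `σ = ±1`. -/
def halfStep {d : ℕ} (a b : Fin d → ℝ) (N : Fin d → ℕ) (σ τ : ℝ) (U : GridVec N) : GridVec N :=
  multiplier a b N (fun l => Complex.exp (Complex.I * ((σ * (τ * delta a b l / 2) : ℝ) : ℂ))) U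

/-- One step, of size `τ`, of the Strang splitting Fourier pseudospectral method for
`i ∂_t η_± ± ⟨∇⟩ η_± ± ε^{2p} ⟨∇⟩⁻¹ f((η_+ + η_-)/2) = 0`; the pair is `(η_+, η_-)`. -/
def tsfpStep {d : ℕ} (a b : Fin d → ℝ) (N : Fin d → ℕ) (p : ℕ) (ε τ : ℝ)
    (η : GridVec N × GridVec N) : GridVec N × GridVec N :=
  let η₁ : GridVec N × GridVec N := (halfStep a b N 1 τ η.1, halfStep a b N (-1) τ η.2)
  let F : GridVec N := multiplier a b N (fun l => Complex.I / (delta a b l : ℂ))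
    (fun j => nonlin p ((η₁.1 j + η₁.2 j) / 2))
  let η₂ : GridVec N × GridVec N :=
    (fun j => η₁.1 j + ((ε ^ (2 * p) * τ : ℝ) : ℂ) * F j,
      fun j => η₁.2 j - ((ε ^ (2 * p) * τ : ℝ) : ℂ) * F j)
  (halfStep a b N 1 τ η₂.1, halfStep a b N (-1) τ η₂.2)

/-- The initial pair: `η_±⁰ = u₀ ∓ i ⟨∇⟩⁻¹ u₁` on the grid. -/
def tsfpInit {d : ℕ} (a b : Fin d → ℝ) (N : Fin d → ℕ) (u₀ u₁ : Pt d → ℂ) :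
    GridVec N × GridVec N :=
  let w : GridVec N := multiplier a b N (fun l => (delta a b l : ℂ)⁻¹)
    (fun j => u₁ (gridPt a b N j))
  (fun j => u₀ (gridPt a b N j) - Complex.I * w j, fun j => u₀ (gridPt a b N j) + Complex.I * w j)

/-- The pair `(η_+ⁿ, η_-ⁿ)` after `n` steps of size `τ`. -/
def tsfp {d : ℕ} (a b : Fin d → ℝ) (N : Fin d → ℕ) (p : ℕ) (ε τ : ℝ) (u₀ u₁ : Pt d → ℂ) (n : ℕ) :
    GridVec N × GridVec N :=
  (tsfpStep a b N p ε τ)^[n] (tsfpInit a b N u₀ u₁)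

/-- The numerical approximation `νⁿ` of `ν(r_n)`, `r_n = n κ`: in the variable `t = r / ε^{2p}` the
step is `τ = κ / ε^{2p}`, and `νⁿ = (η_+ⁿ + η_-ⁿ) / 2`. -/
def tsfpNu {d : ℕ} (a b : Fin d → ℝ) (N : Fin d → ℕ) (p : ℕ) (ε κ : ℝ) (u₀ u₁ : Pt d → ℂ) (n : ℕ) :
    GridVec N :=
  fun j => ((tsfp a b N p ε (κ / ε ^ (2 * p)) u₀ u₁ n).1 j
    + (tsfp a b N p ε (κ / ε ^ (2 * p)) u₀ u₁ n).2 j) / 2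

/-- The numerical approximation `μⁿ` of `∂_r ν(r_n)`: `μⁿ = ε^{-2p} vⁿ` with
`vⁿ = (i/2) ⟨∇⟩ (η_+ⁿ - η_-ⁿ)`. -/
def tsfpMu {d : ℕ} (a b : Fin d → ℝ) (N : Fin d → ℕ) (p : ℕ) (ε κ : ℝ) (u₀ u₁ : Pt d → ℂ) (n : ℕ) :
    GridVec N :=
  fun j => ((ε ^ (2 * p) : ℝ) : ℂ)⁻¹ *
    multiplier a b N (fun l => Complex.I / 2 * (delta a b l : ℂ))
      (fun k => (tsfp a b N p ε (κ / ε ^ (2 * p)) u₀ u₁ n).1 k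
        - (tsfp a b N p ε (κ / ε ^ (2 * p)) u₀ u₁ n).2 k) j

/-- The error `‖ν(r_n) - I_N νⁿ‖_1 + ε^{2p} ‖∂_r ν(r_n) - I_N μⁿ‖`, at `r_n = n κ`. -/
def tsfpError {d : ℕ} (a b : Fin d → ℝ) (N : Fin d → ℕ) (p : ℕ) (ε κ : ℝ) (u₀ u₁ : Pt d → ℂ)
    (ν μ : ℝ → Pt d → ℂ) (n : ℕ) : ENNReal :=
  sobolevNorm a b 1 (fun x => ν (n * κ) x - interp a b N (tsfpNu a b N p ε κ u₀ u₁ n) x)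
    + ENNReal.ofReal (ε ^ (2 * p)) *
      sobolevNorm a b 0 (fun x => μ (n * κ) x - interp a b N (tsfpMu a b N p ε κ u₀ u₁ n) x)

end KleinGordon

end

open scoped ContDiff ENNReal

set_option linter.unusedSectionVars false

noncomputable section

namespace KleinGordon

/-! ### Norms of `ℝ≥0∞`-valued sequences -/

/-- The `ℓ^p` norm of a family of extended nonnegative numbers. -/
def nrm {ι : Type*} (p : ℝ) (x : ι → ℝ≥0∞) : ℝ≥0∞ := (∑' i, x i ^ p) ^ (1 / p)

section nrm

variable {ι κ : Type*} {p : ℝ} {x y : ι → ℝ≥0∞}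

lemma nrm_one (x : ι → ℝ≥0∞) : nrm 1 x = ∑' i, x i := by
  simp [nrm]

lemma nrm_mono (hp : 0 ≤ p) (h : ∀ i, x i ≤ y i) : nrm p x ≤ nrm p y := by
  unfold nrm
  gcongr with i
  exact h i

lemma nrm_const_mul (hp : 0 < p) (c : ℝ≥0∞) (x : ι → ℝ≥0∞) :
    nrm p (fun i => c * x i) = c * nrm p x := by
  unfold nrm
  simp_rw [ENNReal.mul_rpow_of_nonneg _ _ hp.le, ENNReal.tsum_mul_left]
  rw [ENNReal.mul_rpow_of_nonneg _ _ (by positivity), ← ENNReal.rpow_mul,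
    mul_one_div_cancel hp.ne', ENNReal.rpow_one]

lemma nrm_zero (hp : 0 < p) : nrm p (fun _ : ι => (0 : ℝ≥0∞)) = 0 := by
  simp [nrm, ENNReal.zero_rpow_of_pos, hp]

lemma nrm_finset_le (hp : 0 < p) (s : Finset ι) :
    (∑ i ∈ s, x i ^ p) ^ (1 / p) ≤ nrm p x := by
  unfold nrm
  gcongr
  exact ENNReal.sum_le_tsum s

/-- The passage from finite to infinite index sets, used for Minkowski's inequality and the mean
value inequality. In `ℝ≥0∞` it needs no summability. -/
lemma nrm_le_of_finset (hp : 0 < p) {K : ℝ≥0∞}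
    (h : ∀ s : Finset ι, (∑ i ∈ s, x i ^ p) ^ (1 / p) ≤ K) : nrm p x ≤ K := by
  unfold nrm
  rw [one_div, ENNReal.rpow_inv_le_iff hp]
  rw [ENNReal.tsum_eq_iSup_sum]
  refine iSup_le fun s => ?_
  rw [← ENNReal.rpow_inv_le_iff hp, ← one_div]
  exact h s

lemma nrm_add_le (hp : 1 ≤ p) (x y : ι → ℝ≥0∞) :
    nrm p (fun i => x i + y i) ≤ nrm p x + nrm p y := by
  have hp0 : 0 < p := by linarith
  refine nrm_le_of_finset hp0 fun s => ?_
  refine (ENNReal.Lp_add_le s x y hp).trans ?_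
  exact add_le_add (nrm_finset_le hp0 s) (nrm_finset_le hp0 s)

lemma nrm_sum_le (hp : 1 ≤ p) (s : Finset κ) (f : κ → ι → ℝ≥0∞) :
    nrm p (fun i => ∑ k ∈ s, f k i) ≤ ∑ k ∈ s, nrm p (f k) := by
  classical
  induction s using Finset.induction_on with
  | empty => simp [nrm_zero (by linarith : 0 < p)]
  | insert a s ha ih =>
    simp_rw [Finset.sum_insert ha]
    exact (nrm_add_le hp _ _).trans (by gcongr)

/-- Minkowski's inequality for infinite sums. -/
lemma nrm_tsum_le (hp : 1 ≤ p) (f : κ → ι → ℝ≥0∞) :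
    nrm p (fun i => ∑' k, f k i) ≤ ∑' k, nrm p (f k) := by
  have hp0 : 0 < p := by linarith
  refine nrm_le_of_finset hp0 fun s => ?_
  have h1 : Filter.Tendsto (fun t : Finset κ => (∑ i ∈ s, (∑ k ∈ t, f k i) ^ p) ^ (1 / p))
      Filter.atTop (nhds ((∑ i ∈ s, (∑' k, f k i) ^ p) ^ (1 / p))) := by
    refine ((ENNReal.continuous_rpow_const).tendsto _).comp ?_
    refine tendsto_finsetSum _ fun i _ => ?_
    exact ((ENNReal.continuous_rpow_const).tendsto _).comp ENNReal.summable.hasSum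
  refine le_of_tendsto h1 (Filter.Eventually.of_forall fun t => ?_)
  refine (nrm_finset_le hp0 (x := fun i => ∑ k ∈ t, f k i) s).trans ?_
  exact (nrm_sum_le hp t f).trans (ENNReal.sum_le_tsum t)

/-- A change of variables along a map that is injective on the support does not increase the norm. -/
lemma nrm_comp_le (hp : 0 < p) (e : κ → ι) (he : Function.Injective e) (x : ι → ℝ≥0∞) :
    nrm p (fun k => x (e k)) ≤ nrm p x := by
  unfold nrm
  gcongr
  exact ENNReal.tsum_comp_le_tsum_of_injective he (fun i => x i ^ p)

/-- Hölder's inequality for `p = q = 2`. -/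
lemma tsum_mul_le_nrm (x y : ι → ℝ≥0∞) : ∑' i, x i * y i ≤ nrm 2 x * nrm 2 y := by
  rw [ENNReal.tsum_eq_iSup_sum]
  refine iSup_le fun s => ?_
  refine (ENNReal.inner_le_Lp_mul_Lq s x y (p := 2) (q := 2) ?_).trans ?_
  · exact Real.HolderConjugate.two_two
  · exact mul_le_mul' (nrm_finset_le two_pos s) (nrm_finset_le two_pos s)

end nrm

/-! ### Push-forwards -/

open Classical in
/-- The push-forward of the summands `F` along `S`. -/
def push {ι G R : Type*} [AddCommMonoid R] [TopologicalSpace R] (S : ι → G) (F : ι → R) (g : G) :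
    R :=
  ∑' i, if S i = g then F i else 0

section push

variable {ι κ G : Type*} {p : ℝ}

lemma push_mono {S : ι → G} {x y : ι → ℝ≥0∞} (h : ∀ i, x i ≤ y i) (g : G) :
    push S x g ≤ push S y g := by
  unfold push
  gcongr with i
  split_ifs
  · exact h i
  · exact le_rfl

lemma tsum_push (S : ι → G) (x : ι → ℝ≥0∞) : ∑' g, push S x g = ∑' i, x i := by
  unfold push
  rw [ENNReal.tsum_comm]
  refine tsum_congr fun i => ?_
  rw [tsum_eq_single (S i)]
  · simp
  · intro g hg
    simp [hg.symm]

lemma nrm_one_push (S : ι → G) (x : ι → ℝ≥0∞) : nrm 1 (push S x) = nrm 1 x := by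
  simp [nrm_one, tsum_push]

lemma push_sum {κ : Type*} (S : ι → G) (s : Finset κ) (F : κ → ι → ℝ≥0∞) (g : G) :
    push S (fun i => ∑ k ∈ s, F k i) g = ∑ k ∈ s, push S (F k) g := by
  classical
  unfold push
  induction s using Finset.induction_on with
  | empty => simp
  | insert a s ha ih =>
    simp_rw [Finset.sum_insert ha]
    rw [← ih, ← ENNReal.tsum_add]
    refine tsum_congr fun i => ?_
    split_ifs <;> simp

lemma push_const_mul (S : ι → G) (c : ℝ≥0∞) (x : ι → ℝ≥0∞) (g : G) :
    push S (fun i => c * x i) g = c * push S x g := by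
  unfold push
  rw [← ENNReal.tsum_mul_left]
  refine tsum_congr fun i => ?_
  split_ifs <;> simp

lemma enorm_push_le (S : ι → G) (F : ι → ℂ) (g : G) :
    ‖push S F g‖ₑ ≤ push S (fun i => ‖F i‖ₑ) g := by
  unfold push
  refine (enorm_tsum_le_tsum_enorm).trans (le_of_eq ?_)
  refine tsum_congr fun i => ?_
  split_ifs <;> simp

/-- Injectivity on the support makes the push-forward a rearrangement. -/
lemma nrm_push_le_of_injOn (hp : 0 < p) {S : ι → G} {x : ι → ℝ≥0∞}
    (h : ∀ i j, x i ≠ 0 → x j ≠ 0 → S i = S j → i = j) : nrm p (push S x) ≤ nrm p x := by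
  have key : ∀ g, push S x g ^ p ≤ push S (fun i => x i ^ p) g := by
    intro g
    by_cases hg : ∃ i, S i = g ∧ x i ≠ 0
    · obtain ⟨i, hi, hx⟩ := hg
      have e1 : push S x g = x i := by
        unfold push
        rw [tsum_eq_single i]
        · simp [hi]
        · intro j hj
          by_cases hx' : x j = 0
          · simp [hx']
          · have : S j ≠ g := fun h' => hj (h j i hx' hx (h'.trans hi.symm))
            simp [this]
      rw [e1]
      unfold push
      refine le_trans (le_of_eq ?_) (ENNReal.le_tsum i)
      simp [hi]
    · push Not at hg
      have e1 : push S x g = 0 := by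
        unfold push
        rw [ENNReal.tsum_eq_zero]
        intro i
        by_cases hi : S i = g
        · simp [hg i hi]
        · simp [hi]
      simp [e1, ENNReal.zero_rpow_of_pos hp]
  unfold nrm
  gcongr ?_ ^ _
  calc ∑' g, push S x g ^ p ≤ ∑' g, push S (fun i => x i ^ p) g := ENNReal.tsum_le_tsum key
    _ = _ := tsum_push _ _

lemma nrm_push_equiv (e : G ≃ κ) (S : ι → G) (x : ι → ℝ≥0∞) :
    nrm p (push (fun i => e (S i)) x) = nrm p (push S x) := by
  unfold nrm
  congr 1
  rw [← e.tsum_eq]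
  refine tsum_congr fun g => ?_
  congr 1
  refine tsum_congr fun i => ?_
  by_cases h : S i = g <;> simp [h]

end push

/-! ### Young's inequality for multilinear convolutions -/

/-- A product of sums over a tuple index. -/
lemma tsum_pi_prod {ι : Type*} : ∀ (n : ℕ) (x : Fin n → ι → ℝ≥0∞),
    ∑' l : Fin n → ι, ∏ j, x j (l j) = ∏ j, ∑' i, x j i
  | 0, x => by simp
  | n + 1, x => by
    rw [← (Fin.consEquiv (fun _ : Fin (n + 1) => ι)).tsum_eq]
    rw [ENNReal.tsum_prod']
    simp only [Fin.consEquiv_apply, Fin.prod_univ_succ, Fin.cons_zero, Fin.cons_succ]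
    simp_rw [ENNReal.tsum_mul_left, ENNReal.tsum_mul_right]
    rw [tsum_pi_prod n (fun j => x j.succ)]

/-- With all entries of the tuple but the `i`-th one fixed, the push-forward is a translate of `push
(S i) (x i)` times a constant. Minkowski's inequality and translation invariance bound the
superposition, and the constants sum to a product of ℓ¹ norms. Only the distinguished factor is
measured after push-forward, so the maps `S j` need not be injective. -/
lemma young {ι G : Type*} [AddCommGroup G] {p : ℝ} (hp : 1 ≤ p) {n : ℕ} (S : Fin n → ι → G)
    (x : Fin n → ι → ℝ≥0∞) (i : Fin n) :
    nrm p (push (fun l : Fin n → ι => ∑ j, S j (l j)) (fun l => ∏ j, x j (l j))) ≤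
      nrm p (push (S i) (x i)) * ∏ j ∈ Finset.univ.erase i, nrm 1 (x j) := by
  classical
  obtain _ | n := n
  · exact i.elim0
  have e1 : ∀ g, push (fun l : Fin (n + 1) → ι => ∑ j, S j (l j)) (fun l => ∏ j, x j (l j)) g =
      ∑' t : Fin n → ι, (∏ j, x (i.succAbove j) (t j)) *
        push (S i) (x i) (g - ∑ j, S (i.succAbove j) (t j)) := by
    intro g
    unfold push
    rw [← (Fin.insertNthEquiv (fun _ : Fin (n + 1) => ι) i).tsum_eq, ENNReal.tsum_prod',
      ENNReal.tsum_comm]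
    refine tsum_congr fun t => ?_
    rw [← ENNReal.tsum_mul_left]
    refine tsum_congr fun a => ?_
    simp only [Fin.insertNthEquiv_apply, Fin.sum_univ_succAbove _ i, Fin.prod_univ_succAbove _ i,
      Fin.insertNth_apply_same, Fin.insertNth_apply_succAbove, eq_sub_iff_add_eq, mul_ite, mul_zero]
    split_ifs
    · ring
    · rfl
  rw [show push (fun l : Fin (n + 1) → ι => ∑ j, S j (l j)) (fun l => ∏ j, x j (l j)) = _ from
    funext e1]
  refine (nrm_tsum_le hp _).trans ?_
  have e2 : ∀ t : Fin n → ι, nrm p (fun g => (∏ j, x (i.succAbove j) (t j)) *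
      push (S i) (x i) (g - ∑ j, S (i.succAbove j) (t j))) ≤
      (∏ j, x (i.succAbove j) (t j)) * nrm p (push (S i) (x i)) := by
    intro t
    rw [nrm_const_mul (by linarith)]
    gcongr
    exact nrm_comp_le (by linarith) (fun g => g - ∑ j, S (i.succAbove j) (t j))
      (sub_left_injective) _
  refine (ENNReal.tsum_le_tsum e2).trans ?_
  rw [ENNReal.tsum_mul_right, tsum_pi_prod, mul_comm]
  gcongr
  rw [← Finset.compl_singleton, ← Fin.image_succAbove_univ, Finset.prod_image]
  · simp [nrm_one]
  · exact fun a _ b _ h => Fin.succAbove_right_injective h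

/-- Young's inequality with a weight that is dominated by the sum of the weights of the factors. -/
lemma weighted_young {ι G : Type*} [AddCommGroup G] {p : ℝ} (hp : 1 ≤ p) {n : ℕ}
    (S : Fin n → ι → G) (x : Fin n → ι → ℝ≥0∞) (w : ι → ℝ≥0∞) (A : Fin n → ℝ≥0∞)
    (F : (Fin n → ι) → ℝ≥0∞) (K : ℝ≥0∞)
    (hF : ∀ l, F l ≤ K * ((∑ i, w (l i)) * ∏ j, x j (l j)))
    (h1 : ∀ j, nrm 1 (x j) ≤ A j)
    (h2 : ∀ j, nrm p (push (S j) (fun i => w i * x j i)) ≤ A j) :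
    nrm p (push (fun l : Fin n → ι => ∑ j, S j (l j)) F) ≤ K * (n * ∏ j, A j) := by
  classical
  -- In the `i`-th summand the weight is absorbed into the `i`-th factor, which `young` then
  -- measures in `ℓ^p` while the others stay in `ℓ¹`.
  have hF' : ∀ l, F l ≤ K * ∑ i, ∏ j, (Function.update x i (fun a => w a * x i a)) j (l j) := by
    intro l
    refine (hF l).trans (le_of_eq ?_)
    rw [Finset.sum_mul]
    congr 1
    refine Finset.sum_congr rfl fun i _ => ?_
    rw [← Finset.mul_prod_erase _ _ (Finset.mem_univ i), ← Finset.mul_prod_erase _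
      (fun j => Function.update x i (fun a => w a * x i a) j (l j)) (Finset.mem_univ i)]
    simp only [Function.update_self, ← mul_assoc]
    congr 1
    refine Finset.prod_congr rfl fun j hj => ?_
    rw [Function.update_of_ne (Finset.ne_of_mem_erase hj)]
  refine (nrm_mono (by linarith) (fun g => push_mono hF' g)).trans ?_
  simp_rw [push_const_mul, push_sum]
  rw [nrm_const_mul (by linarith)]
  gcongr
  refine (nrm_sum_le hp _ _).trans ?_
  have : ∀ i ∈ (Finset.univ : Finset (Fin n)), nrm p (fun g => push
      (fun l : Fin n → ι => ∑ j, S j (l j))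
      (fun l => ∏ j, (Function.update x i (fun a => w a * x i a)) j (l j)) g) ≤ ∏ j, A j := by
    intro i _
    refine (young hp S _ i).trans ?_
    rw [← Finset.mul_prod_erase _ _ (Finset.mem_univ i), Function.update_self]
    gcongr with j hj
    · exact h2 i
    · rw [Function.update_of_ne (Finset.ne_of_mem_erase hj)]
      exact h1 j
  refine (Finset.sum_le_sum this).trans ?_
  simp

/-! ### Bounds for complex sequences -/

/-- The `ℓ^p` norm of the complex sequence `x` is at most `K`. -/
def Bd {ι : Type*} (p : ℝ) (x : ι → ℂ) (K : ℝ) : Prop :=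
  nrm p (fun i => ‖x i‖ₑ) ≤ ENNReal.ofReal K

section Bd

variable {ι κ : Type*} {p : ℝ} {x y : ι → ℂ} {K L : ℝ}

lemma Bd.mono_const (h : Bd p x K) (hKL : K ≤ L) : Bd p x L :=
  le_trans h (ENNReal.ofReal_le_ofReal hKL)

lemma Bd.mono (hp : 0 ≤ p) (h : Bd p x K) (hxy : ∀ i, ‖y i‖ ≤ ‖x i‖) : Bd p y K :=
  le_trans (nrm_mono hp fun i => by simpa [enorm_le_iff_norm_le] using hxy i) h

lemma Bd.of_le_mul (hp : 0 < p) (h : Bd p x K) {c : ℝ} (hc : 0 ≤ c)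
    (hxy : ∀ i, ‖y i‖ ≤ c * ‖x i‖) : Bd p y (c * K) := by
  unfold Bd
  rw [ENNReal.ofReal_mul hc]
  refine le_trans ?_ (mul_le_mul_right h _)
  rw [← nrm_const_mul hp]
  refine nrm_mono hp.le fun i => ?_
  rw [← ofReal_norm, ← ofReal_norm, ← ENNReal.ofReal_mul hc]
  exact ENNReal.ofReal_le_ofReal (hxy i)

lemma Bd.add (hp : 1 ≤ p) (hx : Bd p x K) (hy : Bd p y L) (hK : 0 ≤ K) (hL : 0 ≤ L) :
    Bd p (fun i => x i + y i) (K + L) := by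
  unfold Bd
  rw [ENNReal.ofReal_add hK hL]
  refine le_trans ?_ (add_le_add hx hy)
  refine le_trans ?_ (nrm_add_le hp _ _)
  exact nrm_mono (by linarith) fun i => enorm_add_le _ _

lemma Bd.neg (hx : Bd p x K) : Bd p (fun i => - x i) K := by
  simpa [Bd] using hx

lemma Bd.sub (hp : 1 ≤ p) (hx : Bd p x K) (hy : Bd p y L) (hK : 0 ≤ K) (hL : 0 ≤ L) :
    Bd p (fun i => x i - y i) (K + L) := by
  simpa [sub_eq_add_neg] using hx.add hp hy.neg hK hL

lemma Bd.sum (hp : 1 ≤ p) (s : Finset κ) {f : κ → ι → ℂ} {k : κ → ℝ}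
    (h : ∀ a ∈ s, Bd p (f a) (k a)) (hk : ∀ a ∈ s, 0 ≤ k a) :
    Bd p (fun i => ∑ a ∈ s, f a i) (∑ a ∈ s, k a) := by
  unfold Bd
  rw [ENNReal.ofReal_sum_of_nonneg hk]
  refine le_trans ?_ (Finset.sum_le_sum h)
  refine le_trans ?_ (nrm_sum_le hp _ _)
  exact nrm_mono (by linarith) fun i => enorm_sum_le _ _

lemma summable_of_tsum_enorm {f : ι → ℂ} (h : ∑' i, ‖f i‖ₑ ≠ ⊤) : Summable fun i => ‖f i‖ := by
  have : Summable fun i => ‖f i‖₊ := by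
    rw [← ENNReal.tsum_coe_ne_top_iff_summable]
    exact h
  exact NNReal.summable_coe.2 this

lemma Bd.summable (h : Bd 1 x K) : Summable fun i => ‖x i‖ := by
  refine summable_of_tsum_enorm ?_
  rw [Bd, nrm_one] at h
  exact (lt_of_le_of_lt h ENNReal.ofReal_lt_top).ne

lemma nrm_two_coe (hp : 1 ≤ p) (s : Finset ι) (x : ι → ℂ) :
    (∑ i ∈ s, ‖x i‖ₑ ^ p) ^ (1 / p) = ENNReal.ofReal ((∑ i ∈ s, ‖x i‖ ^ p) ^ (1 / p)) := by
  have hp0 : 0 < p := by linarith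
  rw [← ENNReal.ofReal_rpow_of_nonneg (Finset.sum_nonneg fun i _ => by positivity) (by positivity),
    ENNReal.ofReal_sum_of_nonneg (fun i _ => by positivity)]
  congr 1
  refine Finset.sum_congr rfl fun i _ => ?_
  rw [← ENNReal.ofReal_rpow_of_nonneg (norm_nonneg _) hp0.le, ofReal_norm]

/-- Mean value inequality for sequences. -/
lemma Bd.mvt (hp : 1 ≤ p) {x x' : ℝ → ι → ℂ} {a b : ℝ} (hab : a ≤ b) (hK : 0 ≤ K)
    (hx : ∀ i, ∀ r ∈ Set.Icc a b, HasDerivWithinAt (fun s => x s i) (x' r i) (Set.Icc a b) r)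
    (hx' : ∀ r ∈ Set.Icc a b, Bd p (x' r) K) :
    Bd p (fun i => x b i - x a i) (K * (b - a)) := by
  have hp0 : 0 < p := by linarith
  refine nrm_le_of_finset hp0 fun s => ?_
  rw [nrm_two_coe hp]
  refine ENNReal.ofReal_le_ofReal ?_
  have hP : Fact (1 ≤ ENNReal.ofReal p) := ⟨by simpa using hp⟩
  have hPr : (ENNReal.ofReal p).toReal = p := ENNReal.toReal_ofReal hp0.le
  -- On finitely many indices the curve lies in a finite-dimensional `PiLp`, where coordinatewise
  -- derivatives suffice; differentiability in the full sequence space is never needed.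
  let f : ℝ → PiLp (ENNReal.ofReal p) (fun _ : s => ℂ) := fun r => WithLp.toLp _ fun i => x r i
  let f' : ℝ → PiLp (ENNReal.ofReal p) (fun _ : s => ℂ) := fun r => WithLp.toLp _ fun i => x' r i
  have hf : ∀ r ∈ Set.Icc a b, HasDerivWithinAt f (f' r) (Set.Icc a b) r := by
    intro r hr
    have h1 : HasDerivWithinAt (fun r => fun i : s => x r i) (fun i : s => x' r i)
        (Set.Icc a b) r := hasDerivWithinAt_pi.2 fun i => hx i r hr
    exact ((PiLp.continuousLinearEquiv (ENNReal.ofReal p) ℝ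
      (fun _ : s => ℂ)).symm.hasFDerivAt.comp_hasDerivWithinAt r h1)
  have hb : ∀ r ∈ Set.Ico a b, ‖f' r‖ ≤ K := by
    intro r hr
    have h1 := (nrm_finset_le hp0 s).trans (hx' r (Set.Ico_subset_Icc_self hr))
    rw [nrm_two_coe hp, ENNReal.ofReal_le_ofReal_iff hK] at h1
    rw [PiLp.norm_eq_sum (by rw [hPr]; exact hp0), hPr]
    refine le_trans (le_of_eq ?_) h1
    congr 1
    exact Finset.sum_coe_sort s (fun i => ‖x' r i‖ ^ p)
  have := norm_image_sub_le_of_norm_deriv_le_segment' hf hb b (Set.right_mem_Icc.2 hab)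
  rw [PiLp.norm_eq_sum (by rw [hPr]; exact hp0), hPr] at this
  refine le_trans (le_of_eq ?_) this
  congr 1
  exact (Finset.sum_coe_sort s (fun i => ‖x b i - x a i‖ ^ p)).symm

end Bd

/-! ### The nonlinearity on the Fourier side -/

section tuples

variable {J G : Type*} [AddCommGroup J] [AddCommGroup G] (p : ℕ)

/-- The sign with which the `j`-th frequency enters the total frequency. -/
def slotSign (j : Fin (2 * p + 1)) : ℤ := if (j : ℕ) ≤ p then 1 else -1

/-- The `j`-th factor of `z^{p+1} (conj z)^p`. -/
def slot (j : Fin (2 * p + 1)) (z : ℂ) : ℂ := if (j : ℕ) ≤ p then z else starRingEnd ℂ z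

/-- The total frequency of a tuple. -/
def tot (l : Fin (2 * p + 1) → J) : J := ∑ j, slotSign p j • l j

/-- The coefficient of a tuple in the expansion of `|u|^{2p} u`. -/
def mono (z : J → ℂ) (l : Fin (2 * p + 1) → J) : ℂ := ∏ j, slot p j (z (l j))

/-- The coefficients of `|u|^{2p} u`, read modulo the kernel of `π`. -/
def nl (π : J →+ G) (z : J → ℂ) : G → ℂ := push (fun l => π (tot p l)) (mono p z)

@[simp] lemma norm_slot (j : Fin (2 * p + 1)) (z : ℂ) : ‖slot p j z‖ = ‖z‖ := by
  unfold slot; split_ifs <;> simp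

@[simp] lemma enorm_slot (j : Fin (2 * p + 1)) (z : ℂ) : ‖slot p j z‖ₑ = ‖z‖ₑ := by
  rw [← ofReal_norm, norm_slot, ofReal_norm]

lemma slot_sub (j : Fin (2 * p + 1)) (z w : ℂ) : slot p j (z - w) = slot p j z - slot p j w := by
  unfold slot; split_ifs <;> simp

lemma slot_mul (j : Fin (2 * p + 1)) (z w : ℂ) : slot p j (z * w) = slot p j z * slot p j w := by
  unfold slot; split_ifs <;> simp

lemma slot_sum {κ : Type*} (j : Fin (2 * p + 1)) (s : Finset κ) (f : κ → ℂ) :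
    slot p j (∑ k ∈ s, f k) = ∑ k ∈ s, slot p j (f k) := by
  unfold slot; split_ifs <;> simp

lemma map_tot (π : J →+ G) (l : Fin (2 * p + 1) → J) :
    π (tot p l) = ∑ j, slotSign p j • π (l j) := by
  simp [tot]

lemma nrm_push_slotSign (r : ℝ) (π : J → G) (x : J → ℝ≥0∞) (j : Fin (2 * p + 1)) :
    nrm r (push (fun a => slotSign p j • π a) x) = nrm r (push π x) := by
  unfold slotSign
  split_ifs
  · simp
  · simpa using nrm_push_equiv (Equiv.neg G) π x

lemma enorm_prod' {ι : Type*} (s : Finset ι) (a : ι → ℂ) : ‖∏ i ∈ s, a i‖ₑ = ∏ i ∈ s, ‖a i‖ₑ := by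
  classical
  induction s using Finset.induction_on with
  | empty => simp
  | insert k s hk ih => rw [Finset.prod_insert hk, Finset.prod_insert hk, enorm_mul, ih]

/-- Telescoping, one factor replaced at a time. The majorant `‖a j‖ + ‖b j‖` serves replaced and
unreplaced factors alike, so the bound does not depend on an ordering. -/
lemma norm_prod_sub_prod_le {ι : Type*} [DecidableEq ι] (s : Finset ι) (a b : ι → ℂ) :
    ‖∏ i ∈ s, a i - ∏ i ∈ s, b i‖ ≤
      ∑ i ∈ s, ‖a i - b i‖ * ∏ j ∈ s.erase i, (‖a j‖ + ‖b j‖) := by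
  induction s using Finset.induction_on with
  | empty => simp
  | insert k s hk ih =>
    rw [Finset.prod_insert hk, Finset.prod_insert hk, Finset.sum_insert hk,
      Finset.erase_insert hk]
    have e : a k * ∏ i ∈ s, a i - b k * ∏ i ∈ s, b i =
      (a k - b k) * ∏ i ∈ s, a i + b k * (∏ i ∈ s, a i - ∏ i ∈ s, b i) := by ring
    rw [e]
    refine (norm_add_le _ _).trans ?_
    rw [norm_mul, norm_mul]
    gcongr
    · rw [norm_prod]
      gcongr
      exact le_add_of_nonneg_right (norm_nonneg _)
    · calc ‖b k‖ * ‖∏ i ∈ s, a i - ∏ i ∈ s, b i‖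
        ≤ (‖a k‖ + ‖b k‖) *
          ∑ i ∈ s, ‖a i - b i‖ * ∏ j ∈ s.erase i, (‖a j‖ + ‖b j‖) := by
            gcongr
            exact le_add_of_nonneg_left (norm_nonneg _)
        _ = _ := by
          rw [Finset.mul_sum]
          refine Finset.sum_congr rfl fun i hi => ?_
          have hik : k ≠ i := fun h => hk (h ▸ hi)
          rw [Finset.erase_insert_of_ne hik, Finset.prod_insert (by simp [hk])]
          ring

lemma enorm_prod_sub_prod_le {ι : Type*} [DecidableEq ι] (s : Finset ι) (a b : ι → ℂ) :
    ‖∏ i ∈ s, a i - ∏ i ∈ s, b i‖ₑ ≤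
      ∑ i ∈ s, ‖a i - b i‖ₑ * ∏ j ∈ s.erase i, (‖a j‖ₑ + ‖b j‖ₑ) := by
  rw [← ofReal_norm]
  refine (ENNReal.ofReal_le_ofReal (norm_prod_sub_prod_le s a b)).trans (le_of_eq ?_)
  rw [ENNReal.ofReal_sum_of_nonneg fun i _ => by positivity]
  refine Finset.sum_congr rfl fun i _ => ?_
  rw [ENNReal.ofReal_mul (norm_nonneg _), ENNReal.ofReal_prod_of_nonneg fun j _ => by positivity,
    ofReal_norm]
  congr 1
  refine Finset.prod_congr rfl fun j _ => ?_
  rw [ENNReal.ofReal_add (norm_nonneg _) (norm_nonneg _), ofReal_norm, ofReal_norm]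

variable {p}

lemma summable_prod_tuple {ι : Type*} {n : ℕ} {x : Fin n → ι → ℂ}
    (h : ∀ j, Summable fun i => ‖x j i‖) :
    Summable fun l : Fin n → ι => ‖∏ j, x j (l j)‖ := by
  refine summable_of_tsum_enorm ?_
  simp_rw [enorm_prod']
  rw [tsum_pi_prod n (fun j i => ‖x j i‖ₑ)]
  refine ENNReal.prod_ne_top fun j _ => ?_
  have := (ENNReal.tsum_coe_ne_top_iff_summable (f := fun i => ‖x j i‖₊)).2
    (NNReal.summable_coe.1 (h j))
  exact this

lemma prod_tsum_tuple {ι : Type*} : ∀ {n : ℕ} {x : Fin n → ι → ℂ},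
    (∀ j, Summable fun i => ‖x j i‖) →
    ∏ j, ∑' i, x j i = ∑' l : Fin n → ι, ∏ j, x j (l j)
  | 0, x, _ => by simp
  | n + 1, x, h => by
    rw [← (Fin.consEquiv (fun _ : Fin (n + 1) => ι)).tsum_eq]
    simp only [Fin.consEquiv_apply, Fin.prod_univ_succ, Fin.cons_zero, Fin.cons_succ]
    rw [prod_tsum_tuple (fun j => h j.succ),
      tsum_mul_tsum_of_summable_norm (h 0) (summable_prod_tuple fun j => h j.succ)]

lemma summable_mono {z : J → ℂ} (h : Summable fun i => ‖z i‖) : Summable fun l => ‖mono p z l‖ := by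
  unfold mono
  exact summable_prod_tuple (x := fun j i => slot p j (z i)) (by simpa using h)

lemma summable_ite {ι : Type*} {F : ι → ℂ} (h : Summable fun i => ‖F i‖) (P : ι → Prop)
    [DecidablePred P] : Summable fun i => if P i then F i else 0 := by
  refine Summable.of_norm_bounded h fun i => ?_
  split_ifs <;> simp

lemma push_sub {ι : Type*} {S : ι → G} {F F' : ι → ℂ} (h : Summable fun i => ‖F i‖)
    (h' : Summable fun i => ‖F' i‖) (g : G) :
    push S F g - push S F' g = push S (fun i => F i - F' i) g := by
  classical
  unfold push
  rw [← (summable_ite h _).tsum_sub (summable_ite h' _)]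
  refine tsum_congr fun i => ?_
  split_ifs <;> simp

lemma push_finset_sum {ι κ : Type*} {S : ι → G} {s : Finset κ} {F : κ → ι → ℂ}
    (h : ∀ k ∈ s, Summable fun i => ‖F k i‖) (g : G) :
    ∑ k ∈ s, push S (F k) g = push S (fun i => ∑ k ∈ s, F k i) g := by
  classical
  unfold push
  rw [← Summable.tsum_finsetSum (fun k hk => summable_ite (h k hk) _)]
  refine tsum_congr fun i => ?_
  split_ifs <;> simp

lemma push_congr {ι R : Type*} [AddCommMonoid R] [TopologicalSpace R] {S : ι → G} {F F' : ι → R}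
    {g : G} (h : ∀ i, S i = g → F i = F' i) : push S F g = push S F' g := by
  classical
  unfold push
  refine tsum_congr fun i => ?_
  split_ifs with hi
  · exact h i hi
  · rfl

lemma push_mul_left {ι : Type*} (S : ι → G) (c : ℂ) (F : ι → ℂ) (g : G) :
    c * push S F g = push S (fun i => c * F i) g := by
  classical
  unfold push
  rw [← tsum_mul_left]
  refine tsum_congr fun i => ?_
  split_ifs <;> simp

/-- The nonlinearity is Lipschitz continuous on bounded sets of `ℓ¹`. -/
lemma nl_lipschitz {r : ℝ} (hr : 1 ≤ r) (π : J →+ G) {z z' : J → ℂ} {A B : ℝ} (hA : 0 ≤ A)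
    (hz : Bd 1 z A) (hz' : Bd 1 z' A)
    (h : nrm r (push π (fun i => ‖z i - z' i‖ₑ)) ≤ ENNReal.ofReal B) :
    Bd r (fun g => nl p π z g - nl p π z' g) ((2 * p + 1) * (2 * A) ^ (2 * p) * B) := by
  classical
  have hr0 : 0 < r := by linarith
  unfold Bd
  -- Telescoping gives one term per slot `i`: the difference occupies slot `i` and is measured after
  -- reduction by `π`, while `‖z‖ + ‖z'‖`, of ℓ¹ norm at most 2A, fills the other 2p slots.
  have h1 : ∀ g, ‖nl p π z g - nl p π z' g‖ₑ ≤
      ∑ i, push (fun l : Fin (2 * p + 1) → J => ∑ j, slotSign p j • π (l j))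
        (fun l => ∏ j, (Function.update (fun _ a => ‖z a‖ₑ + ‖z' a‖ₑ) i
          (fun a => ‖z a - z' a‖ₑ) : Fin (2 * p + 1) → J → ℝ≥0∞) j (l j)) g := by
    intro g
    unfold nl
    rw [push_sub (summable_mono hz.summable) (summable_mono hz'.summable)]
    refine (enorm_push_le _ _ _).trans ?_
    rw [← push_sum]
    simp_rw [map_tot]
    refine push_mono (fun l => ?_) g
    refine (enorm_prod_sub_prod_le _ _ _).trans (le_of_eq ?_)
    refine Finset.sum_congr rfl fun i _ => ?_
    rw [← Finset.mul_prod_erase _ _ (Finset.mem_univ i), Function.update_self, ← slot_sub,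
      enorm_slot]
    congr 1
    refine Finset.prod_congr rfl fun j hj => ?_
    rw [Function.update_of_ne (Finset.ne_of_mem_erase hj), enorm_slot, enorm_slot]
  refine (nrm_mono hr0.le h1).trans ((nrm_sum_le hr _ _).trans ?_)
  have hzz : nrm 1 (fun a => ‖z a‖ₑ + ‖z' a‖ₑ) ≤ ENNReal.ofReal (2 * A) := by
    refine (nrm_add_le le_rfl _ _).trans ?_
    rw [two_mul, ENNReal.ofReal_add hA hA]
    exact add_le_add hz hz'
  have h2 : ∀ i ∈ (Finset.univ : Finset (Fin (2 * p + 1))), nrm r (fun g =>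
      push (fun l : Fin (2 * p + 1) → J => ∑ j, slotSign p j • π (l j))
        (fun l => ∏ j, (Function.update (fun _ a => ‖z a‖ₑ + ‖z' a‖ₑ) i
          (fun a => ‖z a - z' a‖ₑ) : Fin (2 * p + 1) → J → ℝ≥0∞) j (l j)) g) ≤
      ENNReal.ofReal ((2 * A) ^ (2 * p) * B) := by
    intro i _
    refine (young hr (fun j a => slotSign p j • π a) _ i).trans ?_
    rw [Function.update_self, nrm_push_slotSign, mul_comm, ENNReal.ofReal_mul (by positivity),
      ENNReal.ofReal_pow (by positivity)]
    gcongr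
    refine (Finset.prod_le_pow_card _ _ (ENNReal.ofReal (2 * A)) fun j hj => ?_).trans ?_
    · rw [Function.update_of_ne (Finset.ne_of_mem_erase hj)]
      exact hzz
    · simp
  refine (Finset.sum_le_sum h2).trans ?_
  rw [Finset.sum_const, Finset.card_univ, Fintype.card_fin, nsmul_eq_mul, mul_assoc,
    ENNReal.ofReal_mul (by positivity : (0 : ℝ) ≤ 2 * p + 1)]
  gcongr
  rw [← ENNReal.ofReal_natCast]
  push_cast
  exact le_rfl

lemma push_id {R : Type*} [AddCommMonoid R] [TopologicalSpace R] (x : J → R) :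
    push (AddMonoidHom.id J) x = x := by
  classical
  funext g
  simp [push]

/-- The `ℓ^r` norm of the sums of `f` over the tuples of given total frequency is at most `K`. -/
def TupleBd (r : ℝ) (f : (Fin (2 * p + 1) → J) → ℝ) (K : ℝ) : Prop :=
  nrm r (push (tot p) fun l => ENNReal.ofReal (f l)) ≤ ENNReal.ofReal K

lemma TupleBd.mono {r : ℝ} (hr : 0 ≤ r) {f g : (Fin (2 * p + 1) → J) → ℝ} {K L : ℝ}
    (h : TupleBd r g K) (hfg : ∀ l, f l ≤ g l) (hKL : K ≤ L) : TupleBd r f L :=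
  ((nrm_mono hr fun x => push_mono (fun l => ENNReal.ofReal_le_ofReal (hfg l)) x).trans h).trans
    (ENNReal.ofReal_le_ofReal hKL)

lemma TupleBd.sum {r : ℝ} (hr : 1 ≤ r) {κ : Type*} (s : Finset κ)
    {f : κ → (Fin (2 * p + 1) → J) → ℝ} {k : κ → ℝ} (hf : ∀ c ∈ s, ∀ l, 0 ≤ f c l)
    (h : ∀ c ∈ s, TupleBd r (f c) (k c)) (hk : ∀ c ∈ s, 0 ≤ k c) :
    TupleBd r (fun l => ∑ c ∈ s, f c l) (∑ c ∈ s, k c) := by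
  unfold TupleBd
  rw [ENNReal.ofReal_sum_of_nonneg hk]
  refine le_trans ?_ (Finset.sum_le_sum h)
  refine le_trans (le_of_eq ?_) (nrm_sum_le hr _ _)
  congr 1
  funext g
  rw [← push_sum]
  congr 1
  funext l
  rw [ENNReal.ofReal_sum_of_nonneg fun c hc => hf c hc l]

lemma TupleBd.add {r : ℝ} (hr : 1 ≤ r) {f g : (Fin (2 * p + 1) → J) → ℝ} {K L : ℝ}
    (hf0 : ∀ l, 0 ≤ f l) (hg0 : ∀ l, 0 ≤ g l)
    (hf : TupleBd r f K) (hg : TupleBd r g L) (hK : 0 ≤ K) (hL : 0 ≤ L) :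
    TupleBd r (fun l => f l + g l) (K + L) := by
  have := TupleBd.sum (f := fun c : Bool => if c then f else g)
    (k := fun c : Bool => if c then K else L) hr Finset.univ
    (by rintro (_ | _) - <;> simp [hf0, hg0])
    (by rintro (_ | _) - <;> simp [hf, hg]) (by rintro (_ | _) - <;> simp [hK, hL])
  simpa using this

lemma TupleBd.bd {r : ℝ} (hr : 0 ≤ r) {f : (Fin (2 * p + 1) → J) → ℝ} {K : ℝ}
    (h : TupleBd r f K) {F : (Fin (2 * p + 1) → J) → ℂ} (hF : ∀ l, ‖F l‖ ≤ f l) :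
    Bd r (push (tot p) F) K := by
  refine (nrm_mono hr fun g => enorm_push_le _ _ g).trans (le_trans ?_ h)
  refine nrm_mono hr fun g => push_mono (fun l => ?_) g
  rw [← ofReal_norm]
  exact ENNReal.ofReal_le_ofReal (hF l)

/-- Bounds for weighted sums over tuples, in terms of bounds of the factors. -/
lemma tupleBd_prod {r : ℝ} (hr : 1 ≤ r) (x : Fin (2 * p + 1) → J → ℂ) (w : J → ℝ)
    (A : Fin (2 * p + 1) → ℝ) (f : (Fin (2 * p + 1) → J) → ℝ) {K : ℝ} (hK : 0 ≤ K)
    (hw : ∀ a, 0 ≤ w a) (hA : ∀ j, 0 ≤ A j)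
    (hF : ∀ l, f l ≤ K * ((∑ i, w (l i)) * ∏ j, ‖x j (l j)‖))
    (h1 : ∀ j, Bd 1 (x j) (A j)) (h2 : ∀ j, Bd r (fun a => (w a : ℂ) * x j a) (A j)) :
    TupleBd r f (K * ((2 * p + 1) * ∏ j, A j)) := by
  have key := weighted_young hr (fun j a => slotSign p j • a) (fun j a => ‖x j a‖ₑ)
    (fun a => ENNReal.ofReal (w a)) (fun j => ENNReal.ofReal (A j)) (fun l => ENNReal.ofReal (f l))
    (ENNReal.ofReal K) ?_ h1 ?_
  · refine le_trans key (le_of_eq ?_)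
    rw [ENNReal.ofReal_mul hK, ENNReal.ofReal_mul (by positivity),
      ENNReal.ofReal_prod_of_nonneg (fun i _ => hA i), ← ENNReal.ofReal_natCast]
    push_cast
    rfl
  · intro l
    refine (ENNReal.ofReal_le_ofReal (hF l)).trans (le_of_eq ?_)
    rw [ENNReal.ofReal_mul hK, ENNReal.ofReal_mul (Finset.sum_nonneg fun i _ => hw _),
      ENNReal.ofReal_prod_of_nonneg (fun i _ => norm_nonneg _),
      ENNReal.ofReal_sum_of_nonneg (fun i _ => hw _)]
    simp_rw [ofReal_norm]
  · intro j
    have := nrm_push_slotSign p r (AddMonoidHom.id J)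
      (fun a => ENNReal.ofReal (w a) * ‖x j a‖ₑ) j
    simp only [AddMonoidHom.id_apply] at this
    rw [this]
    rw [push_id]
    refine le_trans (le_of_eq ?_) (h2 j)
    congr 1
    funext a
    rw [enorm_mul, ← ofReal_norm, ← ofReal_norm, Complex.norm_real,
      Real.norm_of_nonneg (hw a)]

lemma norm_mono_eq (z : J → ℂ) (l : Fin (2 * p + 1) → J) : ‖mono p z l‖ = ∏ j, ‖z (l j)‖ := by
  simp [mono, norm_prod]

lemma nl_id (z : J → ℂ) : nl p (AddMonoidHom.id J) z = push (tot p) (mono p z) := rfl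

/-- A weight at the total frequency that is dominated by the sum of the weights at the factors can
be carried by a single factor. This makes the weighted `ℓ^r` sequences that lie in `ℓ¹` an algebra;
powers of `delta` are the weights in use. -/
lemma tupleBd_mono {r : ℝ} (hr : 1 ≤ r) {z : J → ℂ} {w : J → ℝ} {A K : ℝ} (hK : 0 ≤ K)
    (hw : ∀ a, 0 ≤ w a) (hA : 0 ≤ A)
    (hwK : ∀ l : Fin (2 * p + 1) → J, w (tot p l) ≤ K * ∑ i, w (l i))
    (h1 : Bd 1 z A) (h2 : Bd r (fun a => (w a : ℂ) * z a) A) :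
    TupleBd r (fun l => w (tot p l) * ‖mono p z l‖) (K * ((2 * p + 1) * A ^ (2 * p + 1))) := by
  have := tupleBd_prod hr (fun _ => z) w (fun _ => A)
    (fun l => w (tot p l) * ‖mono p z l‖) hK hw (fun _ => hA) (fun l => ?_)
    (fun _ => h1) (fun _ => h2)
  · simpa using this
  · rw [norm_mono_eq, ← mul_assoc]
    gcongr
    exact hwK l

/-- The nonlinearity is bounded on bounded sets. -/
lemma nl_bound {r : ℝ} (hr : 1 ≤ r) {z : J → ℂ} {A : ℝ} (hA : 0 ≤ A)
    (h1 : Bd 1 z A) (h2 : Bd r z A) :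
    Bd r (nl p (AddMonoidHom.id J) z) ((2 * p + 1) * A ^ (2 * p + 1)) := by
  have := tupleBd_mono (p := p) (w := fun _ => 1) (K := 1) hr zero_le_one (fun _ => zero_le_one) hA
    (fun l => by simp) h1 (by simpa using h2)
  rw [one_mul] at this
  exact this.bd (by linarith) fun l => by simp

end tuples

/-! ### The frequency lattice -/

/-- The integer vectors are embedded into the lattice spanned by the standard basis, where inverse
powers beyond the rank are summable. -/
lemma summable_int_norm_pow_inv (d n : ℕ) (h : d < n) :
    Summable fun k : Fin d → ℤ => (‖k‖ ^ n)⁻¹ := by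
  let B := Pi.basisFun ℝ (Fin d)
  let L : Submodule ℤ (Fin d → ℝ) := Submodule.span ℤ (Set.range B)
  have hr : Module.finrank ℤ L = d := by
    rw [ZLattice.rank ℝ L]; simp
  have hs := ZLattice.summable_norm_pow_inv L n (by rw [hr]; exact h)
  have hm : ∀ k : Fin d → ℤ, (fun i => (k i : ℝ)) ∈ L := by
    intro k
    have : (fun i => (k i : ℝ)) = ∑ i, k i • B i := by
      funext j
      simp [B, Finset.sum_apply, Pi.single_apply]
    rw [this]
    exact Submodule.sum_mem _ fun i _ => Submodule.smul_mem _ _ (Submodule.subset_span ⟨i, rfl⟩)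
  let e : (Fin d → ℤ) → L := fun k => ⟨fun i => (k i : ℝ), hm k⟩
  have he : Function.Injective e := by
    intro k k' hk
    funext i
    have := congrFun (congrArg Subtype.val hk) i
    simpa [e] using this
  have := hs.comp_injective he
  refine this.congr fun k => ?_
  have : ‖e k‖ = ‖k‖ := by
    change ‖(fun i => (k i : ℝ))‖ = ‖k‖
    simp only [Pi.norm_def]
    congr 2
  rw [Function.comp_apply, this, inv_pow]

section lattice

variable {d : ℕ} (a b : Fin d → ℝ)

lemma weight_pos (l : Fin d → ℤ) : 0 < weight a b l := by
  unfold weight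
  have : 0 ≤ ∑ i, freq a b l i ^ 2 := Finset.sum_nonneg fun i _ => sq_nonneg _
  linarith

lemma one_le_delta (l : Fin d → ℤ) : 1 ≤ delta a b l := by
  unfold delta weight
  rw [Real.one_le_sqrt]
  have : 0 ≤ ∑ i, freq a b l i ^ 2 := Finset.sum_nonneg fun i _ => sq_nonneg _
  linarith

lemma delta_pos (l : Fin d → ℤ) : 0 < delta a b l := lt_of_lt_of_le one_pos (one_le_delta a b l)

lemma delta_sq (l : Fin d → ℤ) : delta a b l ^ 2 = weight a b l :=
  Real.sq_sqrt (weight_pos a b l).le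

lemma freq_neg (l : Fin d → ℤ) (i : Fin d) : freq a b (-l) i = - freq a b l i := by
  simp [freq]; ring

lemma freq_add (l k : Fin d → ℤ) (i : Fin d) : freq a b (l + k) i = freq a b l i + freq a b k i := by
  simp [freq]; ring

lemma delta_neg (l : Fin d → ℤ) : delta a b (-l) = delta a b l := by
  simp [delta, weight, freq_neg]

lemma abs_freq_le_delta (l : Fin d → ℤ) (i : Fin d) : |freq a b l i| ≤ delta a b l := by
  unfold delta weight
  refine Real.abs_le_sqrt ?_
  have := Finset.single_le_sum (f := fun i => freq a b l i ^ 2) (fun i _ => sq_nonneg _)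
    (Finset.mem_univ i)
  linarith

/-- After squaring, the triangle inequality for the frequency vectors leaves the cross term
|μ_l||μ_k|, which is at most δ_l δ_k. -/
lemma delta_add_le (l k : Fin d → ℤ) : delta a b (l + k) ≤ delta a b l + delta a b k := by
  let v : (Fin d → ℤ) → EuclideanSpace ℝ (Fin d) := fun l => WithLp.toLp 2 (freq a b l)
  have hv : ∀ l, weight a b l = 1 + ‖v l‖ ^ 2 := by
    intro l
    simp [weight, v, EuclideanSpace.norm_sq_eq]
  have hadd : v (l + k) = v l + v k := by
    ext i
    simp [v, freq_add]
  have h1 := norm_add_le (v l) (v k)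
  rw [← hadd] at h1
  have hl := delta_sq a b l
  have hk := delta_sq a b k
  rw [hv] at hl hk
  refine Real.sqrt_le_iff.2 ⟨add_nonneg (delta_pos a b l).le (delta_pos a b k).le, ?_⟩
  rw [hv]
  have h2 : ‖v (l + k)‖ ^ 2 ≤ (‖v l‖ + ‖v k‖) ^ 2 := by gcongr
  have h3 : ‖v l‖ ≤ delta a b l := by
    refine abs_le_of_sq_le_sq' ?_ (delta_pos a b l).le |>.2
    linarith
  have h4 : ‖v k‖ ≤ delta a b k := by
    refine abs_le_of_sq_le_sq' ?_ (delta_pos a b k).le |>.2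
    linarith
  have h5 : ‖v l‖ * ‖v k‖ ≤ delta a b l * delta a b k :=
    mul_le_mul h3 h4 (norm_nonneg _) (delta_pos a b l).le
  nlinarith

lemma delta_tot_le (p : ℕ) (l : Fin (2 * p + 1) → Fin d → ℤ) :
    delta a b (tot p l) ≤ ∑ j, delta a b (l j) := by
  refine (Finset.le_sum_nonempty_of_subadditive (delta a b) (delta_add_le a b)
    Finset.univ_nonempty (fun j => slotSign p j • l j)).trans (le_of_eq ?_)
  refine Finset.sum_congr rfl fun j _ => ?_
  unfold slotSign
  split_ifs <;> simp [delta_neg]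

lemma sum_pow_le {n : ℕ} (x : Fin (n + 1) → ℝ) (hx : ∀ i, 0 ≤ x i) (s : ℕ) :
    (∑ i, x i) ^ s ≤ (n + 1 : ℝ) ^ s * ∑ i, x i ^ s := by
  obtain ⟨i, -, hi⟩ := Finset.exists_max_image Finset.univ x Finset.univ_nonempty
  have h1 : ∑ j, x j ≤ (n + 1) * x i := by
    refine (Finset.sum_le_card_nsmul _ _ (x i) hi).trans (le_of_eq ?_)
    simp
  calc (∑ i, x i) ^ s ≤ ((n + 1) * x i) ^ s := by
        gcongr
        exact Finset.sum_nonneg fun i _ => hx i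
    _ = (n + 1 : ℝ) ^ s * x i ^ s := mul_pow _ _ _
    _ ≤ _ := by
        gcongr
        exact Finset.single_le_sum (f := fun i => x i ^ s) (fun i _ => pow_nonneg (hx i) s)
          (Finset.mem_univ i)

lemma delta_tot_pow_le (p : ℕ) (l : Fin (2 * p + 1) → Fin d → ℤ) (s : ℕ) :
    delta a b (tot p l) ^ s ≤ (2 * p + 1 : ℝ) ^ s * ∑ j, delta a b (l j) ^ s := by
  refine (pow_le_pow_left₀ (delta_pos a b _).le (delta_tot_le a b p l) s).trans ?_
  simpa using sum_pow_le (fun j => delta a b (l j)) (fun j => (delta_pos a b _).le) s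

variable {a b} (hab : ∀ i, a i < b i) {N : Fin d → ℕ} (hN : ∀ i, 0 < N i ∧ Even (N i))

lemma div_le_meshSize (i : Fin d) : (b i - a i) / (N i : ℝ) ≤ meshSize a b N :=
  le_ciSup (f := fun i => (b i - a i) / (N i : ℝ)) (Set.finite_range _).bddAbove i

include hab hN in
lemma meshSize_pos (hd : 1 ≤ d) : 0 < meshSize a b N := by
  refine lt_of_lt_of_le ?_ (div_le_meshSize (⟨0, hd⟩ : Fin d))
  exact div_pos (sub_pos.2 (hab _)) (by exact_mod_cast (hN _).1)

-- One component of a frequency, scaled by its own grid spacing, is π · 2|l_i|/N_i in modulus; the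
-- surplus factor π is simply discarded.
include hab hN in
lemma le_mesh_mul_freq {l : Fin d → ℤ} {i : Fin d} {c : ℝ} (hc : c * N i ≤ 2 * |(l i : ℝ)|) :
    c ≤ meshSize a b N * |freq a b l i| := by
  have hb : 0 < b i - a i := sub_pos.2 (hab i)
  have hNi : (0 : ℝ) < N i := by exact_mod_cast (hN i).1
  have h1 : (b i - a i) / (N i : ℝ) * |freq a b l i| ≤ meshSize a b N * |freq a b l i| := by
    gcongr
    exact div_le_meshSize i
  refine le_trans ?_ h1
  rw [freq, abs_div, abs_mul, abs_mul, abs_of_pos hb, abs_of_pos Real.pi_pos, abs_two]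
  have h2 : (b i - a i) / (N i : ℝ) * (2 * Real.pi * |(l i : ℝ)| / (b i - a i)) =
      Real.pi * (2 * |(l i : ℝ)| / N i) := by
    field_simp
  rw [h2]
  have h3 : c ≤ 2 * |(l i : ℝ)| / N i := by
    rw [le_div_iff₀ hNi]; exact hc
  have h4 : 0 ≤ 2 * |(l i : ℝ)| / N i := by positivity
  have h5 := Real.pi_gt_three
  nlinarith

include hab hN in
/-- Frequencies outside of `𝒯_N` are at least of the size of the inverse mesh size. -/
lemma one_le_mesh_mul_delta {l : Fin d → ℤ} (hl : l ∉ modes N) :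
    1 ≤ meshSize a b N * delta a b l := by
  have h1 : ∃ i, l i ∉ Finset.Ico (-((N i / 2 : ℕ) : ℤ)) ((N i / 2 : ℕ) : ℤ) := by
    by_contra h
    push Not at h
    exact hl (Fintype.mem_piFinset.2 h)
  obtain ⟨i, hi⟩ := h1
  obtain ⟨k, hk⟩ := (hN i).2
  have hk2 : N i / 2 = k := by omega
  rw [hk2, Finset.mem_Ico] at hi
  have h2 : (k : ℤ) ≤ |l i| := by
    rcases le_or_gt (0 : ℤ) (l i) with h | h
    · rw [abs_of_nonneg h]; omega
    · rw [abs_of_neg h]; omega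
  have h3 : (k : ℝ) ≤ |(l i : ℝ)| := by exact_mod_cast h2
  have hm : 0 ≤ meshSize a b N :=
    (div_nonneg (sub_nonneg.2 (hab i).le) (Nat.cast_nonneg _)).trans (div_le_meshSize i)
  refine (le_mesh_mul_freq (l := l) (i := i) hab hN (c := 1) ?_).trans
    (mul_le_mul_of_nonneg_left (abs_freq_le_delta a b l i) hm)
  rw [hk]; push_cast; linarith

/-! ### Aliasing -/

/-- Reduction of frequencies modulo the grid. -/
def red (N : Fin d → ℕ) : (Fin d → ℤ) →+ ((i : Fin d) → ZMod (N i)) where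
  toFun l i := (l i : ZMod (N i))
  map_zero' := by ext; simp
  map_add' _ _ := by ext; simp

lemma red_eq_iff {l k : Fin d → ℤ} : red N l = red N k ↔ ∀ i, (N i : ℤ) ∣ l i - k i := by
  simp only [red, AddMonoidHom.coe_mk, ZeroHom.coe_mk, funext_iff]
  refine forall_congr' fun i => ?_
  rw [eq_comm, ZMod.intCast_eq_intCast_iff_dvd_sub]

lemma mem_modes_iff {l : Fin d → ℤ} :
    l ∈ modes N ↔ ∀ i, -((N i / 2 : ℕ) : ℤ) ≤ l i ∧ l i < ((N i / 2 : ℕ) : ℤ) := by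
  simp [modes, Fintype.mem_piFinset]

include hN in
lemma red_injOn {l k : Fin d → ℤ} (hl : l ∈ modes N) (hk : k ∈ modes N) (h : red N l = red N k) :
    l = k := by
  rw [red_eq_iff] at h
  rw [mem_modes_iff] at hl hk
  funext i
  obtain ⟨e, he⟩ := (hN i).2
  have h1 := hl i
  have h2 := hk i
  have h3 := Int.eq_zero_of_abs_lt_dvd (h i) (by rw [abs_lt]; omega)
  omega

include hN in
lemma exists_mode (g : (i : Fin d) → ZMod (N i)) : ∃ l ∈ modes N, red N l = g := by
  have h1 : ∀ i, ∃ k : ℤ, (k : ZMod (N i)) = g i := fun i => ZMod.intCast_surjective (g i)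
  choose k hk using h1
  refine ⟨fun i => (k i + (N i / 2 : ℕ)) % (N i) - (N i / 2 : ℕ), ?_, ?_⟩
  · rw [mem_modes_iff]
    intro i
    have hNi : (0 : ℤ) < N i := by exact_mod_cast (hN i).1
    obtain ⟨e, he⟩ := (hN i).2
    have h2 := Int.emod_nonneg (k i + (N i / 2 : ℕ)) hNi.ne'
    have h3 := Int.emod_lt_of_pos (k i + (N i / 2 : ℕ)) hNi
    constructor
    · linarith
    · have : ((N i / 2 : ℕ) : ℤ) + (N i / 2 : ℕ) = N i := by omega
      linarith
  · have : red N (fun i => (k i + (N i / 2 : ℕ)) % (N i) - (N i / 2 : ℕ)) = red N k := by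
      rw [red_eq_iff]
      intro i
      have := Int.emod_add_mul_ediv (k i + (N i / 2 : ℕ)) (N i)
      exact ⟨-((k i + (N i / 2 : ℕ)) / (N i)), by linarith⟩
    rw [this]
    funext i
    exact hk i

-- A mode satisfies |l_i| ≤ N_i/2, so a shift by a nonzero multiple N_i k_i leaves at least N_i|k_i|
-- − N_i/2 ≥ N_i|k_i|/2.
include hN in
lemma half_abs_le {l k : Fin d → ℤ} (hl : l ∈ modes N) (i : Fin d) (hk : k i ≠ 0) :
    (N i : ℤ) * |k i| ≤ 2 * |l i + N i * k i| := by
  rw [mem_modes_iff] at hl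
  obtain ⟨e, he⟩ := (hN i).2
  have h1 := hl i
  have hNi : (0 : ℤ) < N i := by exact_mod_cast (hN i).1
  have h2 : 2 * |l i| ≤ N i := by
    have : |l i| ≤ ((N i / 2 : ℕ) : ℤ) := abs_le.2 ⟨h1.1, h1.2.le⟩
    omega
  have h3 : 1 ≤ |k i| := Int.one_le_abs hk
  have h4 : |N i * k i| ≤ |l i + N i * k i| + |l i| := by
    have := abs_sub (l i + N i * k i) (l i)
    simpa using this
  rw [abs_mul, abs_of_pos hNi] at h4
  nlinarith

include hab hN in
/-- Modes have the smallest weight among all frequencies with the same values on the grid. -/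
lemma delta_le_of_red_eq {l k : Fin d → ℤ} (hl : l ∈ modes N) (h : red N k = red N l) :
    delta a b l ≤ delta a b k := by
  rw [red_eq_iff] at h
  have h0 := mem_modes_iff.1 hl
  unfold delta weight
  refine Real.sqrt_le_sqrt ?_
  gcongr 1 + ∑ i, ?_ with i
  rw [← sq_abs, ← sq_abs (freq a b k i)]
  have hb : 0 < b i - a i := sub_pos.2 (hab i)
  have h3 : |(l i : ℝ)| ≤ |(k i : ℝ)| := by
    obtain ⟨c, hc⟩ := h i
    obtain ⟨e, he⟩ := (hN i).2
    have h1 := h0 i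
    have h2 : 2 * |l i| ≤ N i := by
      have : |l i| ≤ ((N i / 2 : ℕ) : ℤ) := abs_le.2 ⟨h1.1, h1.2.le⟩
      omega
    have : |l i| ≤ |k i| := by
      by_cases hc0 : c = 0
      · have : k i = l i := by rw [hc0] at hc; linarith
        rw [this]
      · have h4 := half_abs_le hN (k := fun _ => c) hl i hc0
        have h5 : l i + N i * c = k i := by linarith
        simp only [h5] at h4
        have h6 : 1 ≤ |c| := Int.one_le_abs hc0
        have hNi : (0 : ℤ) < N i := by exact_mod_cast (hN i).1
        nlinarith
    exact_mod_cast this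
  unfold freq
  rw [abs_div, abs_div, abs_mul, abs_mul (2 * Real.pi)]
  gcongr

/-- The `ℓ^r` norm of aliasing from outside of `𝒯_N` is controlled by `ϱ` times the `H^m` norm. -/
def AliasBd (a b : Fin d → ℝ) (N : Fin d → ℕ) (m : ℕ) (r ϱ : ℝ) : Prop :=
  ∀ x : (Fin d → ℤ) → ℝ≥0∞, (∀ l ∈ modes N, x l = 0) →
    nrm r (push (red N) x) ≤ ENNReal.ofReal ϱ * nrm 2 fun l => ENNReal.ofReal (delta a b l ^ m) * x l

lemma nrm_two_rpow {ι : Type*} (x : ι → ℝ≥0∞) : nrm 2 x ^ (2 : ℝ) = ∑' i, x i ^ (2 : ℝ) := by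
  unfold nrm
  rw [← ENNReal.rpow_mul]; norm_num

lemma ofReal_delta_mul_inv (l : Fin d → ℤ) (m : ℕ) (x : ℝ≥0∞) :
    ENNReal.ofReal ((delta a b l ^ m)⁻¹) * (ENNReal.ofReal (delta a b l ^ m) * x) = x := by
  have h : 0 < delta a b l ^ m := pow_pos (delta_pos a b l) m
  rw [← mul_assoc, ← ENNReal.ofReal_mul (by positivity), inv_mul_cancel₀ h.ne']
  simp

lemma ofReal_inv_pow_rpow_two (l : Fin d → ℤ) (m : ℕ) :
    ENNReal.ofReal ((delta a b l ^ m)⁻¹) ^ (2 : ℝ) =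
      ENNReal.ofReal ((delta a b l ^ (2 * m))⁻¹) := by
  have h : 0 < delta a b l ^ m := pow_pos (delta_pos a b l) m
  rw [ENNReal.ofReal_rpow_of_nonneg (by positivity) (by norm_num)]
  congr 1
  rw [show (2 : ℝ) = ((2 : ℕ) : ℝ) by norm_num, Real.rpow_natCast, inv_pow, ← pow_mul, mul_comm m]

-- A fibre of the reduction is a coset l₀ + Nk with l₀ a mode. The term k = 0 is excluded from the
-- sum, and for k ≠ 0 the weight δ is at least ‖k‖/h by `half_abs_le`. The fibre sum is thus at most
-- h^{2m} times a lattice sum that converges for 2m > d.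
open Classical in
include hab hN in
lemma push_alias_le (m : ℕ) (hm : d < 2 * m) (g : (i : Fin d) → ZMod (N i)) :
    push (red N) (fun l => if l ∈ modes N then 0 else
      ENNReal.ofReal ((delta a b l ^ (2 * m))⁻¹)) g ≤
      ENNReal.ofReal (meshSize a b N ^ (2 * m) * ∑' k : Fin d → ℤ, (‖k‖ ^ (2 * m))⁻¹) := by
  obtain ⟨l₀, hl₀, rfl⟩ := exists_mode hN g
  let e : (Fin d → ℤ) → (Fin d → ℤ) := fun k i => l₀ i + N i * k i
  have he : Function.Injective e := by
    intro k k' hkk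
    funext i
    have h1 := congrFun hkk i
    simp only [e] at h1
    have hNi : (N i : ℤ) ≠ 0 := by exact_mod_cast (hN i).1.ne'
    exact mul_left_cancel₀ hNi (add_left_cancel h1)
  unfold push
  rw [← he.tsum_eq]
  · rw [← tsum_mul_left, ENNReal.ofReal_tsum_of_nonneg (fun k => by
      have : 0 ≤ meshSize a b N ^ (2 * m) := (even_two_mul m).pow_nonneg _
      positivity) ((summable_int_norm_pow_inv d (2 * m) hm).mul_left _)]
    refine ENNReal.tsum_le_tsum fun k => ?_
    by_cases h1 : red N (e k) = red N l₀
    swap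
    · rw [if_neg h1]; exact bot_le
    by_cases h2 : e k ∈ modes N
    · simp only [if_pos h1, if_pos h2]; exact bot_le
    · simp only [if_pos h1, if_neg h2]
      refine ENNReal.ofReal_le_ofReal ?_
      have hk : k ≠ 0 := by
        rintro rfl
        refine h2 ?_
        simpa [e] using hl₀
      have hk0 : 0 < ‖k‖ := norm_pos_iff.2 hk
      have key : ‖k‖ ≤ meshSize a b N * delta a b (e k) := by
        have hm0 : ∀ i : Fin d, 0 ≤ meshSize a b N := fun i =>
          (div_nonneg (sub_nonneg.2 (hab i).le) (Nat.cast_nonneg _)).trans (div_le_meshSize i)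
        obtain ⟨i₀, hi₀⟩ : ∃ i, k i ≠ 0 := by
          by_contra hc
          push Not at hc
          exact hk (funext hc)
        refine (pi_norm_le_iff_of_nonneg (mul_nonneg (hm0 i₀) (delta_pos a b _).le)).2 fun i => ?_
        rw [Int.norm_eq_abs]
        by_cases hki : k i = 0
        · rw [hki]
          simpa using mul_nonneg (hm0 i₀) (delta_pos a b (e k)).le
        · refine (le_mesh_mul_freq (l := e k) (i := i) hab hN ?_).trans
            (mul_le_mul_of_nonneg_left (abs_freq_le_delta a b _ i) (hm0 i))
          have := half_abs_le hN hl₀ i hki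
          rw [mul_comm]
          exact_mod_cast this
      have h3 : ‖k‖ ^ (2 * m) ≤ meshSize a b N ^ (2 * m) * delta a b (e k) ^ (2 * m) := by
        rw [← mul_pow]
        gcongr
      rw [← div_eq_mul_inv, inv_eq_one_div, div_le_div_iff₀ (pow_pos (delta_pos a b _) _)
        (by positivity)]
      linarith
  · intro l hl
    have h1 : red N l = red N l₀ := by
      by_contra hc
      simp [hc] at hl
    rw [red_eq_iff] at h1
    choose k hk using h1
    exact ⟨k, funext fun i => by simp only [e]; have := hk i; linarith⟩

-- Cauchy–Schwarz on each fibre of the reduction against δ^{-m}, with the fibre sums of δ^{-2m}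
-- bounded uniformly by `push_alias_le`; summing over the fibres restores the H^m norm.
include hab hN in
lemma aliasBd_two (hd : 1 ≤ d) (m : ℕ) (hm : d < 2 * m) :
    AliasBd a b N m 2
      (Real.sqrt (∑' k : Fin d → ℤ, (‖k‖ ^ (2 * m))⁻¹) * meshSize a b N ^ m) := by
  classical
  intro x hx
  set Z := ∑' k : Fin d → ℤ, (‖k‖ ^ (2 * m))⁻¹
  have hZ : 0 ≤ Z := tsum_nonneg fun k => by positivity
  have hh := meshSize_pos hab hN hd
  have h1 : ∀ g, push (red N) x g ^ (2 : ℝ) ≤ ENNReal.ofReal (meshSize a b N ^ (2 * m) * Z) *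
      push (red N) (fun l => (ENNReal.ofReal (delta a b l ^ m) * x l) ^ (2 : ℝ)) g := by
    intro g
    have e1 : push (red N) x g = ∑' l, (if red N l = g then (if l ∈ modes N then 0 else
        ENNReal.ofReal ((delta a b l ^ m)⁻¹)) else 0) *
        (if red N l = g then ENNReal.ofReal (delta a b l ^ m) * x l else 0) := by
      unfold push
      refine tsum_congr fun l => ?_
      by_cases h1 : red N l = g
      · by_cases h2 : l ∈ modes N
        · simp [h2, hx l h2]
        · simp only [h1, h2, if_true, if_false, ofReal_delta_mul_inv]
      · simp [h1]
    rw [e1]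
    refine (ENNReal.rpow_le_rpow (tsum_mul_le_nrm _ _) (by norm_num)).trans ?_
    rw [ENNReal.mul_rpow_of_nonneg _ _ (by norm_num), nrm_two_rpow, nrm_two_rpow]
    have e2 : ∑' l, (if red N l = g then (if l ∈ modes N then 0 else
        ENNReal.ofReal ((delta a b l ^ m)⁻¹)) else 0) ^ (2 : ℝ) =
        push (red N) (fun l => if l ∈ modes N then 0 else
          ENNReal.ofReal ((delta a b l ^ (2 * m))⁻¹)) g := by
      unfold push
      refine tsum_congr fun l => ?_
      by_cases h1 : red N l = g
      · by_cases h2 : l ∈ modes N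
        · simp [h2]
        · simp only [h1, h2, if_true, if_false, ofReal_inv_pow_rpow_two]
      · simp [h1]
    have e3 : ∑' l, (if red N l = g then ENNReal.ofReal (delta a b l ^ m) * x l else 0) ^ (2 : ℝ) =
        push (red N) (fun l => (ENNReal.ofReal (delta a b l ^ m) * x l) ^ (2 : ℝ)) g := by
      unfold push
      refine tsum_congr fun l => ?_
      by_cases h1 : red N l = g <;> simp [h1]
    rw [e2, e3]
    gcongr
    convert push_alias_le hab hN m hm g
  have h2 : nrm 2 (push (red N) x) ^ (2 : ℝ) ≤
      (ENNReal.ofReal (Real.sqrt Z * meshSize a b N ^ m) *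
        nrm 2 fun l => ENNReal.ofReal (delta a b l ^ m) * x l) ^ (2 : ℝ) := by
    rw [nrm_two_rpow, ENNReal.mul_rpow_of_nonneg _ _ (by norm_num), nrm_two_rpow]
    refine (ENNReal.tsum_le_tsum h1).trans (le_of_eq ?_)
    rw [ENNReal.tsum_mul_left, tsum_push]
    congr 1
    rw [ENNReal.ofReal_rpow_of_nonneg (by positivity) (by norm_num)]
    congr 1
    rw [show (2 : ℝ) = ((2 : ℕ) : ℝ) by norm_num, Real.rpow_natCast, mul_pow, Real.sq_sqrt hZ,
      ← pow_mul, mul_comm m, mul_comm]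
  exact (ENNReal.rpow_le_rpow_iff (by norm_num)).1 h2

include hab in
lemma exists_norm_le_delta : ∃ c : ℝ, 0 < c ∧ ∀ l : Fin d → ℤ, c * ‖l‖ ≤ delta a b l := by
  obtain ⟨c, hc, h⟩ : ∃ c : ℝ, 0 < c ∧ ∀ i, c * (b i - a i) ≤ 2 * Real.pi := by
    refine ⟨(1 + ∑ i, (b i - a i))⁻¹, ?_, fun i => ?_⟩
    · have : 0 ≤ ∑ i, (b i - a i) := Finset.sum_nonneg fun i _ => (sub_pos.2 (hab i)).le
      positivity
    · have h0 : 0 ≤ ∑ i, (b i - a i) := Finset.sum_nonneg fun i _ => (sub_pos.2 (hab i)).le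
      have h1 := Finset.single_le_sum (f := fun i => b i - a i)
        (fun i _ => (sub_pos.2 (hab i)).le) (Finset.mem_univ i)
      have h2 : (1 + ∑ i, (b i - a i))⁻¹ * (b i - a i) ≤ 1 := by
        rw [inv_mul_le_iff₀ (by positivity)]
        linarith
      have := Real.pi_gt_three
      linarith
  refine ⟨c, hc, fun l => ?_⟩
  have h0 : ‖l‖ ≤ delta a b l / c := by
    refine (pi_norm_le_iff_of_nonneg (div_nonneg (delta_pos a b l).le hc.le)).2 fun i => ?_
    rw [Int.norm_eq_abs, le_div_iff₀ hc]
    refine le_trans ?_ (abs_freq_le_delta a b l i)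
    have hb : 0 < b i - a i := sub_pos.2 (hab i)
    rw [freq, abs_div, abs_mul, abs_mul, abs_of_pos hb, abs_of_pos Real.pi_pos, abs_two,
      le_div_iff₀ hb]
    have := mul_le_mul_of_nonneg_right (h i) (abs_nonneg (l i : ℝ))
    linarith
  rw [le_div_iff₀ hc] at h0
  linarith

include hab in
lemma summable_delta (m : ℕ) (hm : d < 2 * m) :
    Summable fun l : Fin d → ℤ => (delta a b l ^ (2 * m))⁻¹ := by
  obtain ⟨c, hc, h⟩ := exists_norm_le_delta hab
  have hs := ((summable_int_norm_pow_inv d (2 * m) hm).mul_left ((c ^ (2 * m))⁻¹)).add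
    (summable_of_ne_finset_zero (f := fun l : Fin d → ℤ => if l = 0 then (1 : ℝ) else 0)
      (s := {0}) (by intro l hl; simpa using hl))
  refine Summable.of_nonneg_of_le (fun l => ?_) (fun l => ?_) hs
  · have := delta_pos a b l; positivity
  · have hd := delta_pos a b l
    by_cases hl : l = 0
    · have h1 : (delta a b l ^ (2 * m))⁻¹ ≤ 1 := inv_le_one_of_one_le₀
        (one_le_pow₀ (one_le_delta a b l))
      rw [if_pos hl]
      have : 0 ≤ (c ^ (2 * m))⁻¹ * (‖l‖ ^ (2 * m))⁻¹ := by positivity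
      linarith
    · have hl0 : 0 < ‖l‖ := norm_pos_iff.2 hl
      rw [if_neg hl, add_zero, ← mul_inv, ← mul_pow]
      gcongr
      exact h l

lemma tsum_delta_ne_top (hab : ∀ i, a i < b i) (m : ℕ) (hm : d < 2 * m) :
    ∑' l : Fin d → ℤ, ENNReal.ofReal ((delta a b l ^ (2 * m))⁻¹) ≠ ⊤ := by
  rw [← ENNReal.ofReal_tsum_of_nonneg _ (summable_delta hab m hm)]
  · exact ENNReal.ofReal_ne_top
  · intro l
    have := delta_pos a b l
    positivity

/-- `H^m` embeds into `ℓ¹` on the Fourier side. -/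
lemma exists_nrm_one_le (hab : ∀ i, a i < b i) (m : ℕ) (hm : d < 2 * m) :
    ∃ c : ℝ, 1 ≤ c ∧ ∀ (x : (Fin d → ℤ) → ℂ) (K : ℝ),
      Bd 2 (fun l => ((delta a b l ^ m : ℝ) : ℂ) * x l) K → Bd 1 x (c * K) := by
  set c0 := ((∑' l : Fin d → ℤ, ENNReal.ofReal ((delta a b l ^ (2 * m))⁻¹)) ^ (1 / 2 : ℝ))
    with hc0
  have hfin : c0 ≠ ⊤ := ENNReal.rpow_ne_top_of_nonneg (by norm_num) (tsum_delta_ne_top hab m hm)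
  refine ⟨max 1 c0.toReal, le_max_left _ _, fun x K h => ?_⟩
  unfold Bd at *
  rw [nrm_one]
  have e1 : ∑' l, ‖x l‖ₑ = ∑' l, ENNReal.ofReal ((delta a b l ^ m)⁻¹) *
      ‖((delta a b l ^ m : ℝ) : ℂ) * x l‖ₑ := by
    refine tsum_congr fun l => ?_
    rw [enorm_mul, ← ofReal_norm ((delta a b l ^ m : ℝ) : ℂ), Complex.norm_real,
      Real.norm_of_nonneg (pow_nonneg (delta_pos a b l).le m), ofReal_delta_mul_inv]
  rw [e1]
  refine (tsum_mul_le_nrm _ _).trans ?_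
  have e2 : nrm 2 (fun l : Fin d → ℤ => ENNReal.ofReal ((delta a b l ^ m)⁻¹)) = c0 := by
    unfold nrm
    simp_rw [ofReal_inv_pow_rpow_two]
    rfl
  rw [e2, ENNReal.ofReal_mul (by positivity)]
  gcongr
  exact (ENNReal.ofReal_toReal hfin).ge.trans (ENNReal.ofReal_le_ofReal (le_max_right _ _))

/-- The `ℓ¹` tails of `H^m` functions are uniformly small. -/
lemma exists_aliasBd_one (hab : ∀ i, a i < b i) (m : ℕ) (hm : d < 2 * m) {ϱ : ℝ} (hϱ : 0 < ϱ) :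
    ∃ h₀ : ℝ, 0 < h₀ ∧ ∀ N : Fin d → ℕ, (∀ i, 0 < N i ∧ Even (N i)) → meshSize a b N ≤ h₀ →
      AliasBd a b N m 1 ϱ := by
  classical
  -- A finite set `F` outside of which the sum of δ^{-2m} is at most ϱ². No rate in the mesh size is
  -- extracted, since this bound only serves to keep the numerical solution bounded.
  have h1 := ENNReal.tendsto_tsum_compl_atTop_zero (tsum_delta_ne_top hab m hm)
  have h2 := (h1.eventually_le_const (ENNReal.ofReal_pos.2 (pow_pos hϱ 2))).exists
  obtain ⟨F, hF⟩ := h2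
  have hD : 0 ≤ ∑ l ∈ F, delta a b l := Finset.sum_nonneg fun l _ => (delta_pos a b l).le
  -- For meshes this fine every element of `F` is a mode: a frequency that is not a mode has δ ≥
  -- 1/h, which exceeds every δ on `F`.
  refine ⟨(1 + ∑ l ∈ F, delta a b l)⁻¹, by positivity, fun N hN hmesh x hx => ?_⟩
  rw [nrm_one_push, nrm_one]
  have hmode : ∀ l, l ∉ modes N → l ∉ F := by
    intro l hl hlF
    have h3 := one_le_mesh_mul_delta hab hN hl
    have h4 := Finset.single_le_sum (f := fun l => delta a b l)
      (fun l _ => (delta_pos a b l).le) hlF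
    have h5 : meshSize a b N * delta a b l ≤ (1 + ∑ l ∈ F, delta a b l)⁻¹ * delta a b l := by
      gcongr
      exact (delta_pos a b l).le
    have h6 : (1 + ∑ l ∈ F, delta a b l)⁻¹ * delta a b l < 1 := by
      rw [inv_mul_lt_iff₀ (by positivity)]
      linarith
    linarith
  have e1 : ∑' l, x l = ∑' l, (if l ∈ F then 0 else ENNReal.ofReal ((delta a b l ^ m)⁻¹)) *
      (ENNReal.ofReal (delta a b l ^ m) * x l) := by
    refine tsum_congr fun l => ?_
    by_cases hl : l ∈ modes N
    · simp [hx l hl]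
    · rw [if_neg (hmode l hl), ofReal_delta_mul_inv]
  rw [e1]
  refine (tsum_mul_le_nrm _ _).trans ?_
  gcongr
  unfold nrm
  rw [one_div, ENNReal.rpow_inv_le_iff (by norm_num),
    ENNReal.ofReal_rpow_of_nonneg hϱ.le (by norm_num)]
  refine le_trans (le_of_eq ?_) (hF.trans (le_of_eq ?_))
  · refine Eq.trans ?_ (tsum_subtype {l | l ∉ F} (fun l =>
      ENNReal.ofReal ((delta a b l ^ (2 * m))⁻¹))).symm
    refine tsum_congr fun l => ?_
    by_cases hl : l ∈ F
    · simp [hl]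
    · simp only [if_neg hl, ofReal_inv_pow_rpow_two]
      rw [Set.indicator_of_mem (by exact hl)]
  · congr 1
    rw [show (2 : ℝ) = ((2 : ℕ) : ℝ) by norm_num, Real.rpow_natCast]

end lattice

/-! ### Cancellation of phases in the midpoint rule -/

/-- The plane wave `e^{i x}`. -/
def cis (x : ℝ) : ℂ := Complex.exp (Complex.I * (x : ℂ))

@[simp] lemma norm_cis (x : ℝ) : ‖cis x‖ = 1 := by
  rw [cis, mul_comm, Complex.norm_exp_ofReal_mul_I]

lemma cis_add (x y : ℝ) : cis (x + y) = cis x * cis y := by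
  simp [cis, mul_add, Complex.exp_add]

@[simp] lemma cis_zero : cis 0 = 1 := by simp [cis]

lemma cis_nat_mul (n : ℕ) (x : ℝ) : cis (n * x) = cis x ^ n := by
  rw [cis, cis, ← Complex.exp_nat_mul]
  congr 1; push_cast; ring

lemma conj_cis (x : ℝ) : starRingEnd ℂ (cis x) = cis (-x) := by
  simp [cis, ← Complex.exp_conj]

lemma cis_mul_cis_neg (x : ℝ) : cis x * cis (-x) = 1 := by
  rw [← cis_add]; simp

lemma hasDerivAt_cis_mul (c x : ℝ) :
    HasDerivAt (fun x : ℝ => cis (x * c)) (Complex.I * c * cis (x * c)) x := by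
  have h1 : HasDerivAt (fun x : ℝ => Complex.I * ((x * c : ℝ) : ℂ)) (Complex.I * c) x := by
    have := ((hasDerivAt_id x).mul_const c).ofReal_comp.const_mul Complex.I
    simpa using this
  have := h1.cexp
  simpa [cis, mul_comm] using this

lemma continuous_cis : Continuous cis := by
  unfold cis; fun_prop

/-- `∫_0^κ e^{i w ϕ} dw`. -/
def cisInt (ϕ κ : ℝ) : ℂ := ∫ w in (0 : ℝ)..κ, cis (w * ϕ)

lemma hasDerivAt_cisInt (ϕ κ : ℝ) : HasDerivAt (cisInt ϕ) (cis (κ * ϕ)) κ := by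
  have hc : Continuous fun w => cis (w * ϕ) := continuous_cis.comp (by fun_prop)
  exact intervalIntegral.integral_hasDerivAt_right (hc.intervalIntegrable _ _)
    (hc.stronglyMeasurableAtFilter _ _) hc.continuousAt

lemma norm_cisInt_le (ϕ : ℝ) {κ : ℝ} (hκ : 0 ≤ κ) : ‖cisInt ϕ κ‖ ≤ κ := by
  have := intervalIntegral.norm_integral_le_of_norm_le_const (a := 0) (b := κ) (C := 1)
    (f := fun w => cis (w * ϕ)) (by simp)
  simpa [cisInt, abs_of_nonneg hκ] using this

/-- The error of the midpoint rule for `w ↦ e^{i w ϕ}` on `[0, κ]`. -/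
def midErr (ϕ κ : ℝ) : ℂ := cisInt ϕ κ - κ * cis (κ * (ϕ / 2))

lemma norm_midErr_le (ϕ : ℝ) {κ : ℝ} (hκ : 0 ≤ κ) : ‖midErr ϕ κ‖ ≤ 2 * κ := by
  refine (norm_sub_le _ _).trans ?_
  rw [norm_mul, norm_cis, Complex.norm_real, Real.norm_of_nonneg hκ]
  have := norm_cisInt_le ϕ hκ
  linarith

lemma norm_cis_sub_one_sub_le {x : ℝ} (hx : |x| ≤ 1) : ‖cis x - 1 - Complex.I * x‖ ≤ x ^ 2 := by
  have := Complex.norm_exp_sub_one_sub_id_le (x := Complex.I * x) (by simpa using hx)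
  simpa [cis] using this

/-- With x = uϕ/2, the derivative of the midpoint error in the step length u is e^{ix}(e^{ix} − 1 −
ix), hence quadratic in x; integration gives the bound. -/
lemma norm_midErr_le_sq {ϕ κ : ℝ} (hκ : 0 ≤ κ) (h : |κ * ϕ| ≤ 1 / 2) :
    ‖midErr ϕ κ‖ ≤ κ * (κ * ϕ) ^ 2 := by
  have hd : ∀ u ∈ Set.Icc 0 κ, HasDerivWithinAt (midErr ϕ)
      (cis (u * (ϕ / 2)) * (cis (u * (ϕ / 2)) - 1 - Complex.I * ((u * (ϕ / 2) : ℝ) : ℂ)))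
      (Set.Icc 0 κ) u := by
    intro u _
    have h1 := (hasDerivAt_cisInt ϕ u).sub
      (((hasDerivAt_id u).ofReal_comp).mul (hasDerivAt_cis_mul (ϕ / 2) u))
    refine (h1.congr_deriv ?_).hasDerivWithinAt
    have : cis (u * ϕ) = cis (u * (ϕ / 2)) * cis (u * (ϕ / 2)) := by
      rw [← cis_add]; congr 1; ring
    rw [this]
    simp only [id, Complex.ofReal_one]
    push_cast
    ring
  have hb : ∀ u ∈ Set.Ico 0 κ, ‖cis (u * (ϕ / 2)) * (cis (u * (ϕ / 2)) - 1 -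
      Complex.I * ((u * (ϕ / 2) : ℝ) : ℂ))‖ ≤ (κ * ϕ) ^ 2 := by
    intro u hu
    have h2 : |u * ϕ| ≤ |κ * ϕ| := by
      rw [abs_mul, abs_mul, abs_of_nonneg hu.1, abs_of_nonneg hκ]
      gcongr
      exact hu.2.le
    have h3 : |u * (ϕ / 2)| = |u * ϕ| / 2 := by
      rw [← mul_div_assoc, abs_div, abs_two]
    rw [norm_mul, norm_cis, one_mul]
    refine (norm_cis_sub_one_sub_le (by rw [h3]; linarith [abs_nonneg (u * ϕ)])).trans ?_
    rw [sq_le_sq, h3]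
    linarith [abs_nonneg (u * ϕ)]
  have := norm_image_sub_le_of_norm_deriv_le_segment' hd hb κ (Set.right_mem_Icc.2 hκ)
  have h0 : midErr ϕ 0 = 0 := by simp [midErr, cisInt]
  rw [h0, sub_zero, sub_zero] at this
  linarith

/-- The boundary value is `X n`, one past the last summand, so that exactly the increments with `k <
n` occur. -/
lemma abel_summation (z : ℂ) (X : ℕ → ℂ) (n : ℕ) :
    ∑ k ∈ Finset.range n, z ^ k * X k = (∑ k ∈ Finset.range n, z ^ k) * X n -
      ∑ k ∈ Finset.range n, (∑ j ∈ Finset.range (k + 1), z ^ j) * (X (k + 1) - X k) := by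
  induction n with
  | zero => simp
  | succ n ih =>
    rw [Finset.sum_range_succ, ih, Finset.sum_range_succ (fun k =>
      (∑ j ∈ Finset.range (k + 1), z ^ j) * (X (k + 1) - X k)), Finset.sum_range_succ _ n]
    ring

/-- The geometric sum times |e^{iϑ} − 1| is at most 2, and |e^{iϑ} − 1| ≥ |ϑ|/2 for small ϑ. Keeping
|ϑ| on the left avoids a separate case ϑ = 0. -/
lemma norm_geom_cis_le {ϑ : ℝ} (h : |ϑ| ≤ 1 / 2) (n : ℕ) :
    |ϑ| * ‖∑ k ∈ Finset.range n, cis ϑ ^ k‖ ≤ 4 := by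
  have h1 : ‖(∑ k ∈ Finset.range n, cis ϑ ^ k) * (cis ϑ - 1)‖ ≤ 2 := by
    rw [geom_sum_mul]
    refine (norm_sub_le _ _).trans ?_
    simp; norm_num
  have h2 : |ϑ| / 2 ≤ ‖cis ϑ - 1‖ := by
    have h3 := norm_cis_sub_one_sub_le (x := ϑ) (by linarith)
    have h4 : ‖Complex.I * (ϑ : ℂ)‖ ≤ ‖cis ϑ - 1‖ + ‖cis ϑ - 1 - Complex.I * ϑ‖ := by
      have := norm_sub_le (cis ϑ - 1) (cis ϑ - 1 - Complex.I * ϑ)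
      simpa using this
    rw [norm_mul, Complex.norm_I, one_mul, Complex.norm_real, Real.norm_eq_abs] at h4
    rw [← sq_abs] at h3
    nlinarith [abs_nonneg ϑ]
  rw [norm_mul] at h1
  have := mul_le_mul_of_nonneg_left h2 (norm_nonneg (∑ k ∈ Finset.range n, cis ϑ ^ k))
  linarith

/-- Summation by parts for small phases, and the trivial bound for large ones. -/
lemma norm_sum_midErr_le (ϕ : ℝ) {κ : ℝ} (hκ : 0 ≤ κ) (X : ℕ → ℂ) (s n : ℕ) :
    ‖∑ k ∈ Finset.range n, cis (k * κ * ϕ) * midErr ϕ κ * X k‖ ≤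
      4 * κ * |κ * ϕ| * (‖X n‖ + ∑ k ∈ Finset.range n, ‖X (k + 1) - X k‖) +
      2 * κ * (2 * |κ * ϕ|) ^ (s + 1) * ∑ k ∈ Finset.range n, ‖X k‖ := by
  have hX : 0 ≤ ∑ k ∈ Finset.range n, ‖X k‖ := Finset.sum_nonneg fun _ _ => norm_nonneg _
  have hD : 0 ≤ ∑ k ∈ Finset.range n, ‖X (k + 1) - X k‖ :=
    Finset.sum_nonneg fun _ _ => norm_nonneg _
  rcases le_or_gt |κ * ϕ| (1 / 2) with h | h
  · have e1 : ∑ k ∈ Finset.range n, cis (k * κ * ϕ) * midErr ϕ κ * X k =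
        midErr ϕ κ * ∑ k ∈ Finset.range n, cis (κ * ϕ) ^ k * X k := by
      rw [Finset.mul_sum]
      refine Finset.sum_congr rfl fun k _ => ?_
      rw [mul_assoc (k : ℝ), cis_nat_mul]; ring
    -- The midpoint error contains |κϕ|² and the geometric sum loses only 1/|κϕ|, so one power of
    -- the phase survives.
    have key : ∀ j, ‖midErr ϕ κ * ∑ k ∈ Finset.range j, cis (κ * ϕ) ^ k‖ ≤ 4 * κ * |κ * ϕ| := by
      intro j
      rw [norm_mul]
      have h1 := norm_midErr_le_sq hκ h
      have h2 := norm_geom_cis_le h j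
      rw [← sq_abs] at h1
      calc _ ≤ κ * |κ * ϕ| ^ 2 * ‖∑ k ∈ Finset.range j, cis (κ * ϕ) ^ k‖ := by gcongr
        _ = κ * |κ * ϕ| * (|κ * ϕ| * ‖∑ k ∈ Finset.range j, cis (κ * ϕ) ^ k‖) := by ring
        _ ≤ κ * |κ * ϕ| * 4 := by gcongr
        _ = _ := by ring
    have h3 : ‖∑ k ∈ Finset.range n, cis (k * κ * ϕ) * midErr ϕ κ * X k‖ ≤
        4 * κ * |κ * ϕ| * (‖X n‖ + ∑ k ∈ Finset.range n, ‖X (k + 1) - X k‖) := by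
      rw [e1, abel_summation, mul_sub, Finset.mul_sum]
      refine (norm_sub_le _ _).trans ?_
      rw [mul_add, Finset.mul_sum]
      refine add_le_add ?_ ((norm_sum_le _ _).trans (Finset.sum_le_sum fun k _ => ?_))
      · rw [← mul_assoc, norm_mul]
        exact mul_le_mul_of_nonneg_right (key n) (norm_nonneg _)
      · rw [← mul_assoc, norm_mul]
        exact mul_le_mul_of_nonneg_right (key (k + 1)) (norm_nonneg _)
    have : 0 ≤ 2 * κ * (2 * |κ * ϕ|) ^ (s + 1) * ∑ k ∈ Finset.range n, ‖X k‖ := by positivity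
    linarith
  · have h3 : ‖∑ k ∈ Finset.range n, cis (k * κ * ϕ) * midErr ϕ κ * X k‖ ≤
        2 * κ * ∑ k ∈ Finset.range n, ‖X k‖ := by
      rw [Finset.mul_sum]
      refine (norm_sum_le _ _).trans (Finset.sum_le_sum fun k _ => ?_)
      rw [norm_mul, norm_mul, norm_cis, one_mul]
      exact mul_le_mul_of_nonneg_right (norm_midErr_le ϕ hκ) (norm_nonneg _)
    -- Large phases yield no cancellation, but they exceed 1/2; inserting this power trades
    -- smallness for regularity of the amplitudes.
    have h4 : 1 ≤ (2 * |κ * ϕ|) ^ (s + 1) := one_le_pow₀ (by linarith)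
    have h5 : 2 * κ * (∑ k ∈ Finset.range n, ‖X k‖) * 1 ≤
        2 * κ * (∑ k ∈ Finset.range n, ‖X k‖) * (2 * |κ * ϕ|) ^ (s + 1) := by
      gcongr
    have : 0 ≤ 4 * κ * |κ * ϕ| * (‖X n‖ + ∑ k ∈ Finset.range n, ‖X (k + 1) - X k‖) := by
      positivity
    linarith

/-! ### The twisted variables -/

/-- The sign `±1` of the two components. -/
def sg (s : Bool) : ℝ := if s then 1 else -1

@[simp] lemma abs_sg (s : Bool) : |sg s| = 1 := by cases s <;> simp [sg]

@[simp] lemma norm_sg (s : Bool) : ‖((sg s : ℝ) : ℂ)‖ = 1 := by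
  rw [Complex.norm_real, Real.norm_eq_abs, abs_sg]

lemma sg_mul_self (s : Bool) : ((sg s : ℝ) : ℂ) * (sg s : ℝ) = 1 := by cases s <;> simp [sg]

lemma cis_sum {ι : Type*} (s : Finset ι) (f : ι → ℝ) : cis (∑ i ∈ s, f i) = ∏ i ∈ s, cis (f i) := by
  simp [cis, Finset.mul_sum, Complex.exp_sum]

lemma Bd.weight_mono {ι : Type*} {P : ℝ} (hP : 0 ≤ P) {w w' : ι → ℝ} {x : ι → ℂ} {K : ℝ}
    (h : Bd P (fun l => (w' l : ℂ) * x l) K) (hw : ∀ l, 0 ≤ w l) (hww : ∀ l, w l ≤ w' l) :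
    Bd P (fun l => (w l : ℂ) * x l) K := by
  refine h.mono hP fun l => ?_
  rw [norm_mul, norm_mul, Complex.norm_real, Complex.norm_real, Real.norm_of_nonneg (hw l),
    Real.norm_of_nonneg ((hw l).trans (hww l))]
  exact mul_le_mul_of_nonneg_right (hww l) (norm_nonneg _)

/-- Termwise differentiation needs convergence at a single point, which `h0` provides trivially at
zero. -/
lemma hasDerivAt_push {ι G : Type*} (S : ι → G) (g : G) {u : ι → ℝ} (hu : Summable u)
    {F F' : ι → ℝ → ℂ} (hF : ∀ i y, HasDerivAt (F i) (F' i y) y) (hF' : ∀ i y, ‖F' i y‖ ≤ u i)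
    (h0 : ∀ i, F i 0 = 0) (y : ℝ) :
    HasDerivAt (fun y => push S (fun i => F i y) g) (push S (fun i => F' i y) g) y := by
  classical
  unfold push
  refine hasDerivAt_tsum hu (g := fun i y => if S i = g then F i y else 0)
    (g' := fun i y => if S i = g then F' i y else 0) (fun i y => ?_) (fun i y => ?_) (y₀ := 0) ?_ y
  · split_ifs
    · exact hF i y
    · exact hasDerivAt_const _ _
  · split_ifs
    · exact hF' i y
    · simpa using (norm_nonneg _).trans (hF' i y)
  · simp [h0, summable_zero]

section twisted

variable {d : ℕ} (a b : Fin d → ℝ) (p : ℕ) (e : ℝ)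

/-- The linear evolution `e^{i σ r ⟨∇⟩ / e}`. -/
def rot (s : Bool) (r : ℝ) (l : Fin d → ℤ) : ℂ := cis (r * (sg s * delta a b l / e))

/-- The coefficients of `½ ∑_σ e^{i σ r ⟨∇⟩ / e} ξ_σ`. -/
def comb (r : ℝ) (ξ : Bool → (Fin d → ℤ) → ℂ) (l : Fin d → ℤ) : ℂ :=
  ∑ s, rot a b e s r l * (ξ s l / 2)

variable {a b e}

@[simp] lemma norm_rot (s : Bool) (r : ℝ) (l : Fin d → ℤ) : ‖rot a b e s r l‖ = 1 := norm_cis _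

lemma rot_mul_rot_neg (s : Bool) (r : ℝ) (l : Fin d → ℤ) :
    rot a b e s r l * rot a b e s (-r) l = 1 := by
  rw [rot, rot, neg_mul, cis_mul_cis_neg]

lemma rot_add (s : Bool) (r t : ℝ) (l : Fin d → ℤ) :
    rot a b e s (r + t) l = rot a b e s r l * rot a b e s t l := by
  rw [rot, add_mul, cis_add]; rfl

lemma hasDerivAt_rot (s : Bool) (r : ℝ) (l : Fin d → ℤ) :
    HasDerivAt (fun r => rot a b e s r l)
      (Complex.I * ((sg s * delta a b l / e : ℝ) : ℂ) * rot a b e s r l) r :=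
  hasDerivAt_cis_mul _ _

lemma comb_sub (r : ℝ) (ξ ξ' : Bool → (Fin d → ℤ) → ℂ) (l : Fin d → ℤ) :
    comb a b e r ξ l - comb a b e r ξ' l = comb a b e r (fun s l => ξ s l - ξ' s l) l := by
  simp only [comb, ← Finset.sum_sub_distrib]
  refine Finset.sum_congr rfl fun s _ => ?_
  ring

lemma comb_bd {P : ℝ} (hP : 1 ≤ P) {w : (Fin d → ℤ) → ℝ} {r : ℝ} {ξ : Bool → (Fin d → ℤ) → ℂ}
    {A : ℝ} (hA : 0 ≤ A) (h : ∀ s, Bd P (fun l => (w l : ℂ) * ξ s l) A) :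
    Bd P (fun l => (w l : ℂ) * comb a b e r ξ l) A := by
  have h1 : ∀ s ∈ (Finset.univ : Finset Bool),
      Bd P (fun l => (w l : ℂ) * (rot a b e s r l * (ξ s l / 2))) (1 / 2 * A) := by
    intro s _
    refine (h s).of_le_mul (by linarith) (by norm_num) fun l => ?_
    simp only [norm_mul, norm_rot, norm_div, Complex.norm_two]
    apply le_of_eq
    ring
  have h2 := Bd.sum hP Finset.univ h1 (fun s _ => by positivity)
  simp only [Fintype.sum_bool] at h2
  refine (h2.mono_const (by linarith)).mono (by linarith) fun l => ?_
  apply le_of_eq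
  congr 1
  simp only [comb, Fintype.sum_bool]
  ring

lemma comb_bd_one {P : ℝ} (hP : 1 ≤ P) {r : ℝ} {ξ : Bool → (Fin d → ℤ) → ℂ}
    {A : ℝ} (hA : 0 ≤ A) (h : ∀ s, Bd P (ξ s) A) : Bd P (comb a b e r ξ) A := by
  have := comb_bd (a := a) (b := b) (e := e) (r := r) (ξ := ξ) (w := fun _ => 1) hP hA
    (by simpa using h)
  simpa using this

/-- Dominating constant for the nonlinearity on the ball of radius `2 A`. -/
def nlConst (p : ℕ) (A : ℝ) : ℝ := (2 * p + 1) * (2 * A) ^ (2 * p + 1)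

variable {p}

lemma one_le_nlConst {A : ℝ} (hA : 1 ≤ A) : 1 ≤ nlConst p A := by
  unfold nlConst
  have h1 : (1 : ℝ) ≤ (2 * A) ^ (2 * p + 1) := one_le_pow₀ (by linarith)
  have h2 : (0 : ℝ) ≤ p := Nat.cast_nonneg p
  nlinarith

lemma bound_le_nlConst {A : ℝ} (hA : 1 ≤ A) : (2 * p + 1) * A ^ (2 * p + 1) ≤ nlConst p A := by
  unfold nlConst
  gcongr
  linarith

lemma lipschitz_le_nlConst {A : ℝ} (hA : 1 ≤ A) :
    (2 * p + 1) * (2 * A) ^ (2 * p) ≤ nlConst p A := by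
  unfold nlConst
  gcongr
  · linarith
  · omega

variable (a b p e)

/-- The equation for the twisted variables `ξ_σ(r) = e^{-i σ r ⟨∇⟩ / e} η_σ(r)`. -/
def IsTwisted (T : ℝ) (ξ : ℝ → Bool → (Fin d → ℤ) → ℂ) : Prop :=
  ∀ s l, ∀ r ∈ Set.Icc 0 T, HasDerivWithinAt (fun r => ξ r s l)
    (Complex.I * sg s / delta a b l *
      (rot a b e s (-r) l * nl p (AddMonoidHom.id _) (comb a b e r (ξ r)) l)) (Set.Icc 0 T) r

/-- The frequency of the phase of a tuple, relative to the total frequency. -/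
def phase (s : Bool) (sv : Fin (2 * p + 1) → Bool) (l : Fin (2 * p + 1) → Fin d → ℤ) : ℝ :=
  (∑ j, slotSign p j * sg (sv j) * delta a b (l j) - sg s * delta a b (tot p l)) / e

/-- The amplitude of a tuple. -/
def tup (sv : Fin (2 * p + 1) → Bool) (ξ : Bool → (Fin d → ℤ) → ℂ)
    (l : Fin (2 * p + 1) → Fin d → ℤ) : ℂ :=
  ∏ j, slot p j (ξ (sv j) (l j) / 2)

/-- The time integral over `[t, t + κ]` of the nonlinearity along the free flow. -/
def freeInt (s : Bool) (t κ : ℝ) (ξ : Bool → (Fin d → ℤ) → ℂ) (l : Fin d → ℤ) : ℂ :=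
  ∑ sv, push (tot p) (fun k => cis (t * phase a b p e s sv k) * cisInt (phase a b p e s sv k) κ *
    tup p sv ξ k) l

variable {a b p e}

lemma norm_tup (sv : Fin (2 * p + 1) → Bool) (ξ : Bool → (Fin d → ℤ) → ℂ)
    (l : Fin (2 * p + 1) → Fin d → ℤ) : ‖tup p sv ξ l‖ = ∏ j, ‖ξ (sv j) (l j) / 2‖ := by
  simp [tup, norm_prod]

lemma norm_tup_le (sv : Fin (2 * p + 1) → Bool) (ξ : Bool → (Fin d → ℤ) → ℂ)
    (l : Fin (2 * p + 1) → Fin d → ℤ) : ‖tup p sv ξ l‖ ≤ ∏ j, ‖ξ (sv j) (l j)‖ := by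
  rw [norm_tup]
  gcongr with j
  rw [norm_div, Complex.norm_two]
  linarith [norm_nonneg (ξ (sv j) (l j))]

lemma summable_tup {ξ : Bool → (Fin d → ℤ) → ℂ} (h : ∀ s, Summable fun l => ‖ξ s l‖)
    (sv : Fin (2 * p + 1) → Bool) : Summable fun l => ‖tup p sv ξ l‖ := by
  unfold tup
  refine summable_prod_tuple (x := fun j l => slot p j (ξ (sv j) l / 2)) fun j => ?_
  simpa using (h (sv j)).div_const 2

lemma summable_cis_tup {ξ : Bool → (Fin d → ℤ) → ℂ} (h : ∀ s, Summable fun l => ‖ξ s l‖)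
    (sv : Fin (2 * p + 1) → Bool) (c : (Fin (2 * p + 1) → Fin d → ℤ) → ℝ) :
    Summable fun l => ‖cis (c l) * tup p sv ξ l‖ := by
  simpa using summable_tup h sv

lemma slot_rot (j : Fin (2 * p + 1)) (s : Bool) (r : ℝ) (l : Fin d → ℤ) :
    slot p j (rot a b e s r l) = cis (r * (slotSign p j * sg s * delta a b l / e)) := by
  unfold slot slotSign rot
  split_ifs
  · simp
  · rw [conj_cis]
    congr 1
    push_cast
    ring

/-- Expansion of the nonlinearity along the free flow into plane waves in time. -/
lemma rot_mul_nl_comb {ξ : Bool → (Fin d → ℤ) → ℂ} (h : ∀ s, Summable fun l => ‖ξ s l‖) (s : Bool)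
    (r : ℝ) (l : Fin d → ℤ) :
    rot a b e s (-r) l * nl p (AddMonoidHom.id _) (comb a b e r ξ) l =
      ∑ sv, push (tot p) (fun k => cis (r * phase a b p e s sv k) * tup p sv ξ k) l := by
  rw [nl_id, push_mul_left, push_finset_sum fun sv _ => summable_cis_tup h sv _]
  refine push_congr fun k hk => ?_
  unfold mono comb
  -- Each slot is a sum over the two signs. The product expands over sign vectors `sv`, and the
  -- rotations in it combine into one plane wave in time, of frequency `phase`.
  simp_rw [slot_sum, slot_mul, slot_rot, Finset.prod_univ_sum, Fintype.piFinset_univ,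
    Finset.prod_mul_distrib, Finset.mul_sum]
  refine Finset.sum_congr rfl fun sv _ => ?_
  rw [← cis_sum, ← mul_assoc]
  congr 1
  rw [rot, ← cis_add, ← hk]
  congr 1
  rw [phase, ← Finset.mul_sum, ← Finset.sum_div]
  ring

lemma abs_phase_le (he : 0 < e) (s : Bool) (sv : Fin (2 * p + 1) → Bool)
    (l : Fin (2 * p + 1) → Fin d → ℤ) :
    |phase a b p e s sv l| ≤ 2 / e * ∑ j, delta a b (l j) := by
  rw [phase, abs_div, abs_of_pos he, div_mul_eq_mul_div]
  gcongr
  refine (abs_sub _ _).trans ?_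
  have h1 : |∑ j, (slotSign p j : ℝ) * sg (sv j) * delta a b (l j)| ≤ ∑ j, delta a b (l j) := by
    refine (Finset.abs_sum_le_sum_abs _ _).trans (Finset.sum_le_sum fun j _ => ?_)
    rw [abs_mul, abs_mul, abs_sg, abs_of_pos (delta_pos a b _)]
    unfold slotSign
    split_ifs <;> simp
  have h2 : |sg s * delta a b (tot p l)| ≤ ∑ j, delta a b (l j) := by
    rw [abs_mul, abs_sg, one_mul, abs_of_pos (delta_pos a b _)]
    exact delta_tot_le a b p l
  linarith

/-- The integral along the free flow is an antiderivative of the frozen nonlinearity. Termwise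
differentiation is legitimate because each differentiated term has the modulus of its amplitude, and
the amplitudes are summable for ℓ¹ data. -/
lemma hasDerivAt_freeInt {ξ : Bool → (Fin d → ℤ) → ℂ} (h : ∀ s, Summable fun l => ‖ξ s l‖)
    (s : Bool) (t κ : ℝ) (l : Fin d → ℤ) :
    HasDerivAt (fun κ => freeInt a b p e s t κ ξ l)
      (rot a b e s (-(t + κ)) l * nl p (AddMonoidHom.id _) (comb a b e (t + κ) ξ) l) κ := by
  rw [rot_mul_nl_comb h]
  unfold freeInt
  refine HasDerivAt.fun_sum fun sv _ => ?_
  refine hasDerivAt_push (F := fun k κ => cis (t * phase a b p e s sv k) *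
    cisInt (phase a b p e s sv k) κ * tup p sv ξ k) _ _ (summable_tup h sv)
    (F' := fun k κ => cis ((t + κ) * phase a b p e s sv k) * tup p sv ξ k)
    (fun k y => ?_) (fun k y => by simp) (fun k => by simp [cisInt]) κ
  have := ((hasDerivAt_cisInt (phase a b p e s sv k) y).const_mul
    (cis (t * phase a b p e s sv k))).mul_const (tup p sv ξ k)
  rw [add_mul, cis_add]
  exact this

lemma freeInt_zero (s : Bool) (t : ℝ) (ξ : Bool → (Fin d → ℤ) → ℂ) (l : Fin d → ℤ) :
    freeInt a b p e s t 0 ξ l = 0 := by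
  simp [freeInt, cisInt, push]

/-- Uniform bounds for a twisted solution. -/
structure TwistedBounds (a b : Fin d → ℝ) (p : ℕ) (e T A P : ℝ) (m : ℕ)
    (ξ : ℝ → Bool → (Fin d → ℤ) → ℂ) : Prop where
  twisted : IsTwisted a b p e T ξ
  one_le : 1 ≤ A
  pos : 0 < e
  exponent : 1 ≤ P
  bd_one : ∀ r ∈ Set.Icc 0 T, ∀ s, Bd 1 (fun l => (delta a b l : ℂ) * ξ r s l) A
  bd_pow : ∀ r ∈ Set.Icc 0 T, ∀ s, Bd P (fun l => ((delta a b l ^ (m + 1) : ℝ) : ℂ) * ξ r s l) A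

/-! ### Slow variation of the twisted variables and the freezing error. -/

namespace TwistedBounds

variable {T A P : ℝ} {m : ℕ} {ξ : ℝ → Bool → (Fin d → ℤ) → ℂ}

section

variable (H : TwistedBounds a b p e T A P m ξ)
include H

lemma zero_le : 0 ≤ A := zero_le_one.trans H.one_le

lemma bd_delta {r : ℝ} (hr : r ∈ Set.Icc 0 T) (s : Bool) :
    Bd P (fun l => (delta a b l : ℂ) * ξ r s l) A :=
  (H.bd_pow r hr s).weight_mono (by linarith [H.exponent]) (fun l => (delta_pos a b l).le)
    (fun l => le_self_pow₀ (one_le_delta a b l) (by omega))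

lemma bd_of_delta {Q : ℝ} (hQ : 0 ≤ Q) {x : (Fin d → ℤ) → ℂ} {K : ℝ}
    (h : Bd Q (fun l => (delta a b l : ℂ) * x l) K) : Bd Q x K := by
  simpa using h.weight_mono hQ (w := fun _ => 1) (fun _ => zero_le_one) (one_le_delta a b)

lemma bd {r : ℝ} (hr : r ∈ Set.Icc 0 T) (s : Bool) : Bd P (ξ r s) A :=
  H.bd_of_delta (by linarith [H.exponent]) (H.bd_delta hr s)

lemma bd' {r : ℝ} (hr : r ∈ Set.Icc 0 T) (s : Bool) : Bd 1 (ξ r s) A :=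
  H.bd_of_delta (by norm_num) (H.bd_one r hr s)

lemma summable {r : ℝ} (hr : r ∈ Set.Icc 0 T) (s : Bool) : Summable fun l => ‖ξ r s l‖ :=
  (H.bd' hr s).summable

lemma nl_comb_bd {r t : ℝ} (hr : r ∈ Set.Icc 0 T) :
    Bd P (nl p (AddMonoidHom.id _) (comb a b e t (ξ r))) (nlConst p A) :=
  (nl_bound H.exponent H.zero_le (comb_bd_one le_rfl H.zero_le (H.bd' hr))
    (comb_bd_one H.exponent H.zero_le (H.bd hr))).mono_const (bound_le_nlConst H.one_le)

/-- The twisted variables vary slowly. -/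
lemma delta_sub_bd {t t' : ℝ} (ht : 0 ≤ t) (htt : t ≤ t') (ht' : t' ≤ T) (s : Bool) :
    Bd P (fun l => (delta a b l : ℂ) * (ξ t' s l - ξ t s l)) (nlConst p A * (t' - t)) := by
  have hsub : Set.Icc t t' ⊆ Set.Icc 0 T := Set.Icc_subset_Icc ht ht'
  have hc := zero_le_one.trans (one_le_nlConst (p := p) H.one_le)
  -- In modulus, δ times the derivative of ξ is just the nonlinearity: the factor 1/e is confined to
  -- the phases.
  have := Bd.mvt H.exponent (x := fun r l => (delta a b l : ℂ) * ξ r s l)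
    (x' := fun r l => (delta a b l : ℂ) * (Complex.I * sg s / delta a b l *
      (rot a b e s (-r) l * nl p (AddMonoidHom.id _) (comb a b e r (ξ r)) l)))
    htt hc (fun l r hr => ((H.twisted s l r (hsub hr)).mono hsub).const_mul _) ?_
  · simpa [mul_sub] using this
  · intro r hr
    refine (H.nl_comb_bd (hsub hr) (t := r)).mono (by linarith [H.exponent]) fun l => ?_
    have hd := delta_pos a b l
    rw [norm_mul, norm_mul, norm_mul, norm_div, norm_mul, norm_rot, norm_sg, Complex.norm_I,
      Complex.norm_real, Real.norm_of_nonneg hd.le]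
    apply le_of_eq
    field_simp

/-- The cancellation of the first order terms in `½ (η_+ + η_-)`. -/
lemma comb_sub_bd {t t' : ℝ} (ht : 0 ≤ t) (htt : t ≤ t') (ht' : t' ≤ T) :
    Bd P (fun l => comb a b e t' (ξ t') l - comb a b e t' (ξ t) l)
      (nlConst p A * (t' - t) ^ 2 / e) := by
  have hsub : Set.Icc t t' ⊆ Set.Icc 0 T := Set.Icc_subset_Icc ht ht'
  have hc := zero_le_one.trans (one_le_nlConst (p := p) H.one_le)
  have hK : 0 ≤ nlConst p A * (t' - t) / e := by
    have := H.pos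
    have := sub_nonneg.2 htt
    positivity
  have := Bd.mvt H.exponent
    (x := fun r l => ∑ s, rot a b e s r l * ((ξ r s l - ξ t s l) / 2))
    (x' := fun r l => ∑ s, Complex.I * ((sg s * delta a b l / e : ℝ) : ℂ) * rot a b e s r l *
      ((ξ r s l - ξ t s l) / 2))
    htt hK (fun l r hr => ?_) ?_
  · have h2 := this.mono_const (L := nlConst p A * (t' - t) ^ 2 / e) (by apply le_of_eq; ring)
    refine h2.mono (by linarith [H.exponent]) fun l => ?_
    rw [comb_sub]
    simp [comb]
  · have h1 : ∀ s, HasDerivWithinAt (fun r => rot a b e s r l * ((ξ r s l - ξ t s l) / 2))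
        (Complex.I * ((sg s * delta a b l / e : ℝ) : ℂ) * rot a b e s r l *
          ((ξ r s l - ξ t s l) / 2) + Complex.I * sg s / delta a b l *
          nl p (AddMonoidHom.id _) (comb a b e r (ξ r)) l / 2) (Set.Icc t t') r := by
      intro s
      have h2 := ((hasDerivAt_rot (a := a) (b := b) (e := e) s r l).hasDerivWithinAt).mul
        ((((H.twisted s l r (hsub hr)).mono hsub).sub_const (ξ t s l)).div_const 2)
      refine h2.congr_deriv ?_
      congr 1
      have h3 := rot_mul_rot_neg (a := a) (b := b) (e := e) s r l
      calc _ = (rot a b e s r l * rot a b e s (-r) l) * (Complex.I * sg s / delta a b l *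
          nl p (AddMonoidHom.id _) (comb a b e r (ξ r)) l / 2) := by ring
        _ = _ := by rw [h3, one_mul]
    have h4 := HasDerivWithinAt.fun_sum (u := Finset.univ) fun s _ => h1 s
    refine h4.congr_deriv ?_
    rw [Finset.sum_add_distrib]
    -- The key cancellation: both components are driven by the same nonlinearity with opposite
    -- signs, so the derivative of ξ drops out of the half-sum.
    have : ∑ s, Complex.I * sg s / delta a b l *
          nl p (AddMonoidHom.id _) (comb a b e r (ξ r)) l / 2 = 0 := by
      simp only [Fintype.sum_bool, sg]
      push_cast
      simp
      ring
    rw [this, add_zero]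
  · intro r hr
    -- Only the derivative of the rotation remains. It costs δ/e and acts on an increment of ξ,
    -- which is O(t' − t) even with the weight δ.
    have h1 : ∀ s ∈ (Finset.univ : Finset Bool), Bd P (fun l =>
        Complex.I * ((sg s * delta a b l / e : ℝ) : ℂ) * rot a b e s r l *
          ((ξ r s l - ξ t s l) / 2)) (1 / (2 * e) * (nlConst p A * (t' - t))) := by
      intro s _
      refine ((H.delta_sub_bd ht hr.1 (hr.2.trans ht') s).mono_const
        (L := nlConst p A * (t' - t)) ?_).of_le_mul (by linarith [H.exponent])
        (by have := H.pos; positivity) fun l => ?_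
      · have := hr.2
        gcongr
      · have hd := delta_pos a b l
        have he := H.pos
        rw [norm_mul, norm_mul, norm_mul, norm_rot, Complex.norm_I, Complex.norm_real,
          Real.norm_eq_abs, abs_div, abs_mul, abs_sg, abs_of_pos hd, abs_of_pos he, norm_div,
          Complex.norm_two, norm_mul, Complex.norm_real, Real.norm_of_nonneg hd.le]
        apply le_of_eq
        field_simp
    refine (Bd.sum H.exponent Finset.univ h1 fun s _ => ?_).mono_const ?_
    · have := H.pos
      have := sub_nonneg.2 htt
      positivity
    · simp only [Fintype.sum_bool]
      have := H.pos.ne'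
      apply le_of_eq
      field_simp
      ring

/-- The remainder after freezing the twisted variables in the nonlinearity. -/
lemma remainder_bd {t t' : ℝ} (ht : 0 ≤ t) (htt : t ≤ t') (ht' : t' ≤ T) (s : Bool) :
    Bd P (fun l => (delta a b l : ℂ) * (ξ t' s l - ξ t s l) -
      Complex.I * sg s * freeInt a b p e s t (t' - t) (ξ t) l)
      (nlConst p A ^ 2 * (t' - t) ^ 3 / e) := by
  have hsub : Set.Icc t t' ⊆ Set.Icc 0 T := Set.Icc_subset_Icc ht ht'
  have hc := zero_le_one.trans (one_le_nlConst (p := p) H.one_le)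
  have he := H.pos
  have h0 := sub_nonneg.2 htt
  have hP0 : 0 ≤ P := by linarith [H.exponent]
  have htm : t ∈ Set.Icc 0 T := hsub (Set.left_mem_Icc.2 htt)
  have := Bd.mvt H.exponent (K := nlConst p A ^ 2 * (t' - t) ^ 2 / e)
    (x := fun r l => (delta a b l : ℂ) * ξ r s l -
      Complex.I * sg s * freeInt a b p e s t (r - t) (ξ t) l)
    (x' := fun r l => Complex.I * sg s * rot a b e s (-r) l *
      (nl p (AddMonoidHom.id _) (comb a b e r (ξ r)) l -
        nl p (AddMonoidHom.id _) (comb a b e r (ξ t)) l))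
    htt (by positivity) (fun l r hr => ?_) ?_
  · have h2 := this.mono_const (L := nlConst p A ^ 2 * (t' - t) ^ 3 / e) (by apply le_of_eq; ring)
    refine h2.mono hP0 fun l => ?_
    simp only [sub_self, freeInt_zero]
    apply le_of_eq
    congr 1
    ring
  · have h1 := ((H.twisted s l r (hsub hr)).mono hsub).const_mul (delta a b l : ℂ)
    have h2 := (hasDerivAt_freeInt (a := a) (b := b) (e := e) (p := p) (H.summable htm) s t
      (r - t) l).comp_sub_const r t
    have h3 := h1.sub (h2.hasDerivWithinAt.const_mul (Complex.I * sg s))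
    refine h3.congr_deriv ?_
    have hd : (delta a b l : ℂ) ≠ 0 := by exact_mod_cast (delta_pos a b l).ne'
    rw [add_sub_cancel]
    field_simp
  · intro r hr
    have hrm := hsub hr
    -- Both nonlinearities are evaluated at the same rotation time and differ only in ξ, so their
    -- arguments differ by the second order quantity of `comb_sub_bd`.
    have h1 := nl_lipschitz (p := p) H.exponent (AddMonoidHom.id _) (B := nlConst p A * (t' - t) ^ 2 / e)
      H.zero_le (comb_bd_one (a := a) (b := b) (e := e) (r := r) le_rfl H.zero_le (H.bd' hrm))
      (comb_bd_one (a := a) (b := b) (e := e) (r := r) le_rfl H.zero_le (H.bd' htm)) ?_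
    · refine (h1.mono hP0 fun l => ?_).mono_const ?_
      · rw [norm_mul, norm_mul, norm_mul, norm_rot, norm_sg, Complex.norm_I]
        simp
      · calc _ ≤ nlConst p A * (nlConst p A * (t' - t) ^ 2 / e) := by
              gcongr
              exact lipschitz_le_nlConst H.one_le
          _ = _ := by ring
    · rw [push_id]
      refine (H.comb_sub_bd ht hr.1 (hr.2.trans ht')).mono_const ?_
      have := sub_nonneg.2 hr.1
      have := hr.2
      gcongr

end

end TwistedBounds

end twisted

/-! ### Accumulated errors of the midpoint rule. -/

section midpoint

variable {d : ℕ} {a b : Fin d → ℝ} {p : ℕ} {e : ℝ}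

/-- The constant in the bound for the accumulated midpoint errors. -/
def midConst (p : ℕ) (T A : ℝ) (m : ℕ) : ℝ :=
  2 ^ (2 * p + 1) * (8 * nlConst p A + 8 * (2 * p + 1) * T * nlConst p A ^ 2 +
    2 * T * (4 * (2 * p + 1)) ^ (m + 1) * nlConst p A)

lemma midConst_nonneg {T A : ℝ} (hT : 0 ≤ T) (hA : 1 ≤ A) (m : ℕ) : 0 ≤ midConst p T A m := by
  have := zero_le_one.trans (one_le_nlConst (p := p) hA)
  unfold midConst
  positivity

namespace TwistedBounds

variable {T A P : ℝ} {m : ℕ} {ξ : ℝ → Bool → (Fin d → ℤ) → ℂ}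
variable (H : TwistedBounds a b p e T A P m ξ)
include H

/-- The same solution seen with exponent 1 and no extra regularity. It supplies ℓ¹ bounds for
increments and the setting for the boundedness argument. -/
lemma exponent_one : TwistedBounds a b p e T A 1 0 ξ where
  twisted := H.twisted
  one_le := H.one_le
  pos := H.pos
  exponent := le_rfl
  bd_one := H.bd_one
  bd_pow := by simpa using H.bd_one

/-- The boundary term of the summation by parts, with the phase replaced by its bound; the single
factor δ lands on one amplitude. -/
lemma tupleBd_boundary {r κ : ℝ} (hr : r ∈ Set.Icc 0 T) (hκ : 0 ≤ κ)
    (sv : Fin (2 * p + 1) → Bool) :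
    TupleBd P (fun l => 4 * κ * (2 * κ / e * ∑ j, delta a b (l j)) * ‖tup p sv (ξ r) l‖)
      (8 * κ ^ 2 / e * nlConst p A) := by
  have he := H.pos
  have := tupleBd_prod H.exponent (fun j => ξ r (sv j)) (delta a b) (fun _ => A)
    (fun l => 4 * κ * (2 * κ / e * ∑ j, delta a b (l j)) * ‖tup p sv (ξ r) l‖)
    (K := 8 * κ ^ 2 / e) (by positivity) (fun l => (delta_pos a b l).le) (fun _ => H.zero_le)
    (fun l => ?_) (fun j => H.bd' hr _) (fun j => H.bd_delta hr _)
  · refine this.mono (by linarith [H.exponent]) (fun _ => le_rfl) ?_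
    gcongr
    simpa using bound_le_nlConst H.one_le
  · have h1 := norm_tup_le (p := p) sv (ξ r) l
    have h2 : 0 ≤ ∑ j, delta a b (l j) := Finset.sum_nonneg fun j _ => (delta_pos a b _).le
    calc _ ≤ 4 * κ * (2 * κ / e * ∑ j, delta a b (l j)) * ∏ j, ‖ξ r (sv j) (l j)‖ := by gcongr
      _ = _ := by ring

/-- Increments of the amplitudes over one time step carry an additional factor κ, because ξ varies
slowly both in `ℓ¹` and, weighted by δ, in `ℓ^P`. Summed over at most T/κ steps they are of the
order of the boundary term. -/
lemma tupleBd_diff {t t' κ : ℝ} (ht : 0 ≤ t) (htt : t' = t + κ) (ht' : t' ≤ T) (hκ : 0 ≤ κ)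
    (sv : Fin (2 * p + 1) → Bool) :
    TupleBd P (fun l => 4 * κ * (2 * κ / e * ∑ j, delta a b (l j)) *
      ‖tup p sv (ξ t') l - tup p sv (ξ t) l‖)
      ((2 * p + 1) * (8 * κ ^ 2 / e * (nlConst p A ^ 2 * κ))) := by
  classical
  have he := H.pos
  have hP := H.exponent
  have hA := H.zero_le
  have hle : t ≤ t' := by linarith
  have htm : t ∈ Set.Icc 0 T := ⟨ht, by linarith⟩
  have htm' : t' ∈ Set.Icc 0 T := ⟨by linarith, ht'⟩
  have hc := zero_le_one.trans (one_le_nlConst (p := p) H.one_le)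
  -- In the `i`-th telescoping term, slot `i` holds the increment and the other slots hold the sums
  -- of moduli; `B i` lists the corresponding bounds.
  let x : Fin (2 * p + 1) → Fin (2 * p + 1) → (Fin d → ℤ) → ℂ := fun i =>
    Function.update (fun j l => ((‖ξ t' (sv j) l‖ + ‖ξ t (sv j) l‖ : ℝ) : ℂ)) i
      (fun l => ξ t' (sv i) l - ξ t (sv i) l)
  let B : Fin (2 * p + 1) → Fin (2 * p + 1) → ℝ := fun i =>
    Function.update (fun _ => 2 * A) i (nlConst p A * κ)
  have hx : ∀ i : Fin (2 * p + 1), TupleBd P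
      (fun l => 8 * κ ^ 2 / e * ((∑ j, delta a b (l j)) * ∏ j, ‖x i j (l j)‖))
      (8 * κ ^ 2 / e * (nlConst p A ^ 2 * κ)) := by
    intro i
    have hsum : ∀ (Q : ℝ), 1 ≤ Q → ∀ w : (Fin d → ℤ) → ℝ, (∀ l, 0 ≤ w l) →
        (∀ s, Bd Q (fun l => (w l : ℂ) * ξ t' s l) A) →
        (∀ s, Bd Q (fun l => (w l : ℂ) * ξ t s l) A) → ∀ s,
        Bd Q (fun l => (w l : ℂ) * ((‖ξ t' s l‖ + ‖ξ t s l‖ : ℝ) : ℂ)) (2 * A) := by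
      intro Q hQ w hw h1 h2 s
      have h3 : Bd Q (fun l => ((w l * ‖ξ t' s l‖ : ℝ) : ℂ)) A :=
        (h1 s).mono (by linarith) fun l => by
          rw [Complex.norm_real, norm_mul, norm_mul, Complex.norm_real, norm_norm]
      have h4 : Bd Q (fun l => ((w l * ‖ξ t s l‖ : ℝ) : ℂ)) A :=
        (h2 s).mono (by linarith) fun l => by
          rw [Complex.norm_real, norm_mul, norm_mul, Complex.norm_real, norm_norm]
      have := (h3.add hQ h4 hA hA).mono_const (L := 2 * A) (by linarith)
      convert this using 2 with l
      push_cast; ring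
    have := tupleBd_prod H.exponent (x i) (delta a b) (B i)
      (fun l => 8 * κ ^ 2 / e * ((∑ j, delta a b (l j)) * ∏ j, ‖x i j (l j)‖))
      (K := 8 * κ ^ 2 / e) (by positivity) (fun l => (delta_pos a b l).le) (fun j => ?_)
      (fun l => le_rfl) (fun j => ?_) (fun j => ?_)
    · refine this.mono (by linarith) (fun _ => le_rfl) ?_
      have hB : ∏ j, B i j = nlConst p A * κ * (2 * A) ^ (2 * p) := by
        rw [← Finset.mul_prod_erase _ _ (Finset.mem_univ i)]
        simp only [B, Function.update_self]
        congr 1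
        rw [Finset.prod_congr rfl (g := fun _ => 2 * A) fun j hj => by
          rw [Function.update_of_ne (Finset.ne_of_mem_erase hj)]]
        simp
      rw [hB]
      refine mul_le_mul_of_nonneg_left ?_ (by positivity)
      calc _ = ((2 * p + 1) * (2 * A) ^ (2 * p)) * (nlConst p A * κ) := by ring
        _ ≤ nlConst p A * (nlConst p A * κ) := by
          gcongr
          exact lipschitz_le_nlConst H.one_le
        _ = _ := by ring
    · simp only [B, Function.update_apply]
      split_ifs <;> positivity
    · simp only [x, B]
      by_cases hj : j = i
      · subst hj
        simp only [Function.update_self]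
        have h1 := H.exponent_one.delta_sub_bd ht hle ht' (sv j)
        refine (H.bd_of_delta (by norm_num) h1).mono_const (by rw [htt]; simp)
      · rw [Function.update_of_ne hj, Function.update_of_ne hj]
        have h1 := hsum 1 le_rfl (fun _ => 1) (fun _ => zero_le_one)
          (by simpa using H.bd' htm') (by simpa using H.bd' htm) (sv j)
        simpa using h1
    · simp only [x, B]
      by_cases hj : j = i
      · subst hj
        simp only [Function.update_self]
        exact (H.delta_sub_bd ht hle ht' (sv j)).mono_const (by rw [htt]; simp)
      · rw [Function.update_of_ne hj, Function.update_of_ne hj]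
        exact hsum P hP (delta a b) (fun l => (delta_pos a b l).le) (H.bd_delta htm')
          (H.bd_delta htm) (sv j)
  have hδ : ∀ l : Fin (2 * p + 1) → Fin d → ℤ, 0 ≤ ∑ j, delta a b (l j) := fun l =>
    Finset.sum_nonneg fun j _ => (delta_pos a b _).le
  have hsum := TupleBd.sum hP Finset.univ (fun i _ l => by have := hδ l; positivity)
    (fun i _ => hx i) (fun i _ => by positivity)
  refine hsum.mono (by linarith) (fun l => ?_) (le_of_eq ?_)
  · have h1 := norm_prod_sub_prod_le Finset.univ
      (fun j => slot p j (ξ t' (sv j) (l j) / 2)) (fun j => slot p j (ξ t (sv j) (l j) / 2))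
    have h2 : ‖tup p sv (ξ t') l - tup p sv (ξ t) l‖ ≤ ∑ i, ∏ j, ‖x i j (l j)‖ := by
      refine h1.trans (Finset.sum_le_sum fun i _ => ?_)
      rw [← Finset.mul_prod_erase _ _ (Finset.mem_univ i)]
      simp only [x, Function.update_self, ← slot_sub, norm_slot]
      gcongr with j hj
      · rw [← sub_div, norm_div, Complex.norm_two]
        linarith [norm_nonneg (ξ t' (sv i) (l i) - ξ t (sv i) (l i))]
      · rw [Function.update_of_ne (Finset.ne_of_mem_erase hj), Complex.norm_real,
          Real.norm_of_nonneg (by positivity), norm_div, norm_div, Complex.norm_two]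
        linarith [norm_nonneg (ξ t' (sv j) (l j)), norm_nonneg (ξ t (sv j) (l j))]
    have := hδ l
    calc _ ≤ 4 * κ * (2 * κ / e * ∑ j, delta a b (l j)) * ∑ i, ∏ j, ‖x i j (l j)‖ := by gcongr
      _ = _ := by
        rw [Finset.mul_sum]
        refine Finset.sum_congr rfl fun i _ => ?_
        ring
  · simp

/-- The large phases. This is the only place where the full weight δ^{m+1} of the amplitudes is
spent, and it produces the term (κ/e)^{m+1}. -/
lemma tupleBd_high {r κ : ℝ} (hr : r ∈ Set.Icc 0 T) (hκ : 0 ≤ κ)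
    (sv : Fin (2 * p + 1) → Bool) :
    TupleBd P (fun l => 2 * κ * (2 * (2 * κ / e * ∑ j, delta a b (l j))) ^ (m + 1) *
      ‖tup p sv (ξ r) l‖)
      (2 * κ * (4 * (2 * p + 1)) ^ (m + 1) * (κ / e) ^ (m + 1) * nlConst p A) := by
  have he := H.pos
  have := tupleBd_prod H.exponent (fun j => ξ r (sv j)) (fun l => delta a b l ^ (m + 1))
    (fun _ => A)
    (fun l => 2 * κ * (2 * (2 * κ / e * ∑ j, delta a b (l j))) ^ (m + 1) * ‖tup p sv (ξ r) l‖)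
    (K := 2 * κ * (4 * (2 * p + 1)) ^ (m + 1) * (κ / e) ^ (m + 1)) (by positivity)
    (fun l => (pow_pos (delta_pos a b l) _).le) (fun _ => H.zero_le)
    (fun l => ?_) (fun j => H.bd' hr _) (fun j => H.bd_pow r hr _)
  · refine this.mono (by linarith [H.exponent]) (fun _ => le_rfl) ?_
    gcongr
    simpa using bound_le_nlConst H.one_le
  · have h1 := norm_tup_le (p := p) sv (ξ r) l
    have h2 : 0 ≤ ∑ j, delta a b (l j) := Finset.sum_nonneg fun j _ => (delta_pos a b _).le
    have h3 := sum_pow_le (fun j => delta a b (l j)) (fun j => (delta_pos a b _).le) (m + 1)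
    have h4 : 0 ≤ ∏ j, ‖ξ r (sv j) (l j)‖ := Finset.prod_nonneg fun j _ => norm_nonneg _
    calc _ ≤ 2 * κ * (2 * (2 * κ / e * ∑ j, delta a b (l j))) ^ (m + 1) *
          ∏ j, ‖ξ r (sv j) (l j)‖ := by gcongr
      _ = 2 * κ * (4 * (κ / e)) ^ (m + 1) * ((∑ j, delta a b (l j)) ^ (m + 1) *
          ∏ j, ‖ξ r (sv j) (l j)‖) := by ring
      _ ≤ 2 * κ * (4 * (κ / e)) ^ (m + 1) * ((((2 * p : ℕ) + 1 : ℝ) ^ (m + 1) *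
          ∑ j, delta a b (l j) ^ (m + 1)) * ∏ j, ‖ξ r (sv j) (l j)‖) := by
          gcongr
      _ = _ := by push_cast; rw [mul_pow, mul_pow]; ring

/-- The accumulated quadrature errors of the midpoint rule. -/
lemma sum_midpoint_bd {κ : ℝ} (hκ : 0 ≤ κ) (n : ℕ) (hn : n * κ ≤ T) (s : Bool) :
    Bd P (fun l => ∑ k ∈ Finset.range n, (freeInt a b p e s (k * κ) κ (ξ (k * κ)) l -
      κ * (rot a b e s (-(k * κ + κ / 2)) l *
        nl p (AddMonoidHom.id _) (comb a b e (k * κ + κ / 2) (ξ (k * κ))) l)))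
      (midConst p T A m * (κ ^ 2 / e + (κ / e) ^ (m + 1))) := by
  have he := H.pos
  have hP := H.exponent
  have hc := zero_le_one.trans (one_le_nlConst (p := p) H.one_le)
  have hkT : ∀ k : ℕ, k ≤ n → (k : ℝ) * κ ∈ Set.Icc 0 T := fun k hk =>
    ⟨by positivity, le_trans (by gcongr) hn⟩
  have hkn : ∀ k ∈ Finset.range n, (k : ℝ) * κ ∈ Set.Icc 0 T := fun k hk =>
    hkT k (Finset.mem_range.1 hk).le
  have hT : 0 ≤ T := le_trans (by positivity) hn
  -- The sum over time steps is moved inside the sum over tuples: cancellation between steps is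
  -- visible only for a fixed tuple and sign vector, that is, for a fixed phase.
  have e1 : ∀ l, ∑ k ∈ Finset.range n, (freeInt a b p e s (k * κ) κ (ξ (k * κ)) l -
      κ * (rot a b e s (-(k * κ + κ / 2)) l *
        nl p (AddMonoidHom.id _) (comb a b e (k * κ + κ / 2) (ξ (k * κ))) l)) =
      ∑ sv, push (tot p) (fun v => ∑ k ∈ Finset.range n, cis (k * κ * phase a b p e s sv v) *
        midErr (phase a b p e s sv v) κ * tup p sv (ξ (k * κ)) v) l := by
    intro l
    have h1 : ∀ k ∈ Finset.range n, freeInt a b p e s (k * κ) κ (ξ (k * κ)) l -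
        κ * (rot a b e s (-(k * κ + κ / 2)) l *
        nl p (AddMonoidHom.id _) (comb a b e (k * κ + κ / 2) (ξ (k * κ))) l) =
        ∑ sv, push (tot p) (fun v => cis (k * κ * phase a b p e s sv v) *
        midErr (phase a b p e s sv v) κ * tup p sv (ξ (k * κ)) v) l := by
      intro k hk
      have hs := H.summable (hkn k hk)
      rw [rot_mul_nl_comb hs, freeInt, Finset.mul_sum, ← Finset.sum_sub_distrib]
      refine Finset.sum_congr rfl fun sv _ => ?_
      rw [push_mul_left, push_sub]
      · congr 1
        funext v
        rw [midErr, add_mul, cis_add]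
        rw [show κ / 2 * phase a b p e s sv v = κ * (phase a b p e s sv v / 2) by ring]
        ring
      · refine Summable.of_nonneg_of_le (fun _ => norm_nonneg _) (fun v => ?_)
          ((summable_tup hs sv).mul_left κ)
        rw [norm_mul, norm_mul, norm_cis, one_mul]
        gcongr
        exact norm_cisInt_le _ hκ
      · simpa using (summable_tup hs sv).mul_left |κ|
    rw [Finset.sum_congr rfl h1, Finset.sum_comm]
    refine Finset.sum_congr rfl fun sv _ => ?_
    refine push_finset_sum (fun k hk => ?_) l
    refine Summable.of_nonneg_of_le (fun _ => norm_nonneg _) (fun v => ?_)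
      ((summable_tup (H.summable (hkn k hk)) sv).mul_left (2 * κ))
    rw [norm_mul, norm_mul, norm_cis, one_mul]
    gcongr
    exact norm_midErr_le _ hκ
  simp_rw [e1]
  have h2 : ∀ sv ∈ (Finset.univ : Finset (Fin (2 * p + 1) → Bool)), Bd P (push (tot p) (fun v =>
      ∑ k ∈ Finset.range n, cis (k * κ * phase a b p e s sv v) *
        midErr (phase a b p e s sv v) κ * tup p sv (ξ (k * κ)) v))
      ((8 * nlConst p A + 8 * (2 * p + 1) * T * nlConst p A ^ 2 +
    2 * T * (4 * (2 * p + 1)) ^ (m + 1) * nlConst p A) * (κ ^ 2 / e + (κ / e) ^ (m + 1))) := by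
    intro sv _
    have hδ : ∀ l : Fin (2 * p + 1) → Fin d → ℤ, 0 ≤ ∑ j, delta a b (l j) := fun l =>
      Finset.sum_nonneg fun j _ => (delta_pos a b _).le
    -- The three contributions of `norm_sum_midErr_le`: boundary term, increments, large phases.
    have t1 := H.tupleBd_boundary (hkT n le_rfl) hκ sv
    have t2 := TupleBd.sum hP (Finset.range n) (fun k _ l => by have := hδ l; positivity)
      (fun k hk => H.tupleBd_diff (t := k * κ) (t' := (k + 1 : ℕ) * κ) (hkn k hk).1
        (by push_cast; ring) (hkT (k + 1) (Finset.mem_range.1 hk)).2 hκ sv)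
      (fun k _ => by positivity)
    have t3 := TupleBd.sum hP (Finset.range n) (fun k _ l => by have := hδ l; positivity)
      (fun k hk => H.tupleBd_high (hkn k hk) hκ sv)
      (fun k _ => by positivity)
    have t12 := TupleBd.add hP (fun l => by have := hδ l; positivity)
      (fun l => Finset.sum_nonneg fun k _ => by have := hδ l; positivity) t1 t2
      (by positivity) (Finset.sum_nonneg fun k _ => by positivity)
    have t123 := TupleBd.add hP (fun l => add_nonneg (by have := hδ l; positivity)
      (Finset.sum_nonneg fun k _ => by have := hδ l; positivity))
      (fun l => Finset.sum_nonneg fun k _ => by have := hδ l; positivity) t12 t3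
      (add_nonneg (by positivity) (Finset.sum_nonneg fun k _ => by positivity))
      (Finset.sum_nonneg fun k _ => by positivity)
    refine (t123.bd (by linarith) fun v => ?_).mono_const ?_
    · refine (norm_sum_midErr_le (phase a b p e s sv v) hκ (fun k => tup p sv (ξ (k * κ)) v)
        m n).trans ?_
      have h3 : |κ * phase a b p e s sv v| ≤ 2 * κ / e * ∑ j, delta a b (v j) := by
        rw [abs_mul, abs_of_nonneg hκ]
        calc _ ≤ κ * (2 / e * ∑ j, delta a b (v j)) := by
              gcongr
              exact abs_phase_le he s sv v
          _ = _ := by ring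
      rw [mul_add, Finset.mul_sum, Finset.mul_sum]
      gcongr
    · simp only [Finset.sum_const, Finset.card_range, nsmul_eq_mul]
      have hX : 0 ≤ κ ^ 2 / e := by positivity
      have hY : 0 ≤ (κ / e) ^ (m + 1) := by positivity
      have h4 : (n : ℝ) * ((2 * p + 1) * (8 * κ ^ 2 / e * (nlConst p A ^ 2 * κ))) ≤
          8 * (2 * p + 1) * T * nlConst p A ^ 2 * (κ ^ 2 / e) := by
        calc _ = (n * κ) * (8 * (2 * p + 1) * nlConst p A ^ 2 * (κ ^ 2 / e)) := by ring
          _ ≤ T * (8 * (2 * p + 1) * nlConst p A ^ 2 * (κ ^ 2 / e)) := by gcongr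
          _ = _ := by ring
      have h5 : (n : ℝ) * (2 * κ * (4 * (2 * p + 1)) ^ (m + 1) * (κ / e) ^ (m + 1) * nlConst p A) ≤
          2 * T * (4 * (2 * p + 1)) ^ (m + 1) * nlConst p A * (κ / e) ^ (m + 1) := by
        calc _ = (n * κ) * (2 * (4 * (2 * p + 1)) ^ (m + 1) * (κ / e) ^ (m + 1) * nlConst p A) := by
              ring
          _ ≤ T * (2 * (4 * (2 * p + 1)) ^ (m + 1) * (κ / e) ^ (m + 1) * nlConst p A) := by gcongr
          _ = _ := by ring
      have h6 : 0 ≤ 8 * nlConst p A * (κ / e) ^ (m + 1) := by positivity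
      have h7 : 0 ≤ 8 * (2 * p + 1) * T * nlConst p A ^ 2 * (κ / e) ^ (m + 1) := by positivity
      have h8 : 0 ≤ 2 * T * (4 * (2 * p + 1)) ^ (m + 1) * nlConst p A * (κ ^ 2 / e) := by positivity
      have h9 : 8 * κ ^ 2 / e * nlConst p A = 8 * nlConst p A * (κ ^ 2 / e) := by ring
      rw [h9]
      linarith
  -- There are 2^{2p+1} sign vectors, which is the leading factor of `midConst`.
  refine (Bd.sum hP Finset.univ h2 fun sv _ => by positivity).mono_const (le_of_eq ?_)
  rw [Finset.sum_const, Finset.card_univ, Fintype.card_fun, Fintype.card_bool, Fintype.card_fin,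
    midConst, nsmul_eq_mul]
  push_cast
  ring

end TwistedBounds

end midpoint

-- When the fibre of `S'` lies in the fibre of `S`, the difference collects exactly the aliased
-- terms: those seen by `S` but not by `S'`.
open Classical in
lemma push_sub_push {ι G H : Type*} {S : ι → G} {S' : ι → H} {F : ι → ℂ}
    (hs : Summable fun i => ‖F i‖) {g : G} {h : H} (hS : ∀ i, S' i = h → S i = g) :
    push S F g - push S' F h = push S (fun i => if S' i = h then 0 else F i) g := by
  unfold push
  rw [← (summable_ite hs _).tsum_sub (summable_ite hs _)]
  refine tsum_congr fun i => ?_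
  by_cases hi : S' i = h
  · simp [hi, hS i hi]
  · simp [hi]

/-! ### Spatial errors, stability and discrete Gronwall on the Fourier side. -/

section numeric

variable {d : ℕ} {a b : Fin d → ℝ} {p : ℕ} {e : ℝ} {N : Fin d → ℕ}

/-- Restriction to the modes of the grid. -/
def cut (N : Fin d → ℕ) (x : (Fin d → ℤ) → ℂ) (l : Fin d → ℤ) : ℂ := if l ∈ modes N then x l else 0

lemma norm_cut_le (x : (Fin d → ℤ) → ℂ) (l : Fin d → ℤ) : ‖cut N x l‖ ≤ ‖x l‖ := by
  unfold cut; split_ifs <;> simp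

lemma Bd.cut {P : ℝ} (hP : 0 ≤ P) {x : (Fin d → ℤ) → ℂ} {K : ℝ} (h : Bd P x K) :
    Bd P (KleinGordon.cut N x) K := h.mono hP (norm_cut_le x)

lemma cut_comb (r : ℝ) (ξ : Bool → (Fin d → ℤ) → ℂ) :
    cut N (comb a b e r ξ) = comb a b e r (fun s => cut N (ξ s)) := by
  funext l
  by_cases hl : l ∈ modes N <;> simp [cut, comb, hl]

lemma nrm_modes_le (hN : ∀ i, 0 < N i ∧ Even (N i)) {P : ℝ} (hP : 0 < P)
    (Y : ((i : Fin d) → ZMod (N i)) → ℝ≥0∞) :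
    nrm P (fun l => if l ∈ modes N then Y (red N l) else 0) ≤ nrm P Y := by
  unfold nrm
  gcongr ?_ ^ _
  have h1 : ∑' l, (if l ∈ modes N then Y (red N l) else 0) ^ P =
      ∑' l : {l // l ∈ modes N}, Y (red N l) ^ P := by
    refine Eq.trans ?_ (tsum_subtype {l | l ∈ modes N} (fun l => Y (red N l) ^ P)).symm
    refine tsum_congr fun l => ?_
    by_cases hl : l ∈ modes N
    · rw [if_pos hl, Set.indicator_of_mem (by exact_mod_cast hl)]
    · rw [if_neg hl, Set.indicator_of_notMem (by exact_mod_cast hl), ENNReal.zero_rpow_of_pos hP]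
  rw [h1]
  refine ENNReal.tsum_comp_le_tsum_of_injective (f := fun l : {l // l ∈ modes N} => red N l.1)
    (fun l k h => ?_) (fun g => Y g ^ P)
  exact Subtype.ext (red_injOn hN l.2 k.2 h)

lemma Bd.comp_red (hN : ∀ i, 0 < N i ∧ Even (N i)) {P : ℝ} (hP : 0 < P)
    {Y : ((i : Fin d) → ZMod (N i)) → ℂ} {K : ℝ} (h : Bd P Y K) :
    Bd P (KleinGordon.cut N fun l => Y (red N l)) K := by
  refine le_trans (le_of_eq ?_) ((nrm_modes_le hN hP fun g => ‖Y g‖ₑ).trans h)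
  congr 1
  funext l
  unfold KleinGordon.cut
  split_ifs <;> simp

lemma enorm_weight_mul {w : ℝ} (hw : 0 ≤ w) (z : ℂ) : ‖(w : ℂ) * z‖ₑ = ENNReal.ofReal w * ‖z‖ₑ := by
  rw [enorm_mul, ← ofReal_norm (w : ℂ), Complex.norm_real, Real.norm_of_nonneg hw]

/-- The aliasing error of the nonlinearity. -/
lemma nl_alias_bd (hN : ∀ i, 0 < N i ∧ Even (N i)) {P : ℝ} (hP : 1 ≤ P) {M : ℕ} {ϱ A : ℝ}
    (hϱ : 0 ≤ ϱ) (hA : 1 ≤ A) (hal : AliasBd a b N M P ϱ) {z : (Fin d → ℤ) → ℂ} (h1 : Bd 1 z A)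
    (h2 : Bd 2 (fun l => ((delta a b l ^ M : ℝ) : ℂ) * z l) A) :
    Bd P (cut N fun l => nl p (AddMonoidHom.id _) z l - nl p (red N) z (red N l))
      (ϱ * ((2 * p + 1) ^ M * nlConst p A)) := by
  classical
  have hP0 : 0 < P := by linarith
  have hA0 : 0 ≤ A := by linarith
  let Z : (Fin d → ℤ) → ℝ≥0∞ := push (tot p) fun v => ‖mono p z v‖ₑ
  let y : (Fin d → ℤ) → ℝ≥0∞ := fun l => if l ∈ modes N then 0 else Z l
  -- A tuple that contributes to the error at the mode `l` has a total frequency congruent to `l`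
  -- but different from it. By injectivity of the reduction on modes it lies outside the modes, so
  -- `y`, the part of `Z` off the modes, dominates.
  have hpt : ∀ l, ‖cut N (fun l => nl p (AddMonoidHom.id _) z l - nl p (red N) z (red N l)) l‖ₑ ≤
      if l ∈ modes N then push (red N) y (red N l) else 0 := by
    intro l
    unfold cut
    by_cases hl : l ∈ modes N
    swap
    · simp [hl]
    rw [if_pos hl, if_pos hl, nl_id, nl, ← enorm_neg, neg_sub]
    have hs := summable_mono (p := p) h1.summable
    rw [push_sub_push (S := fun v => red N (tot p v)) (S' := tot p) hs (fun v hv => by rw [hv])]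
    refine (enorm_push_le _ _ _).trans ?_
    have e2 : push (red N) y (red N l) = ∑' v, ∑' k, if red N k = red N l then
        (if k ∈ modes N then 0 else (if tot p v = k then ‖mono p z v‖ₑ else 0)) else 0 := by
      rw [ENNReal.tsum_comm]
      unfold push
      refine tsum_congr fun k => ?_
      by_cases h3 : red N k = red N l
      · by_cases h4 : k ∈ modes N
        · simp [y, h4]
        · simp only [y, h3, h4, Z, push, if_true, if_false]
          exact tsum_congr fun v => by by_cases h : tot p v = k <;> simp [h]
      · simp [h3]
    rw [e2]
    unfold push
    refine ENNReal.tsum_le_tsum fun v => ?_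
    refine le_trans ?_ (ENNReal.le_tsum (tot p v))
    by_cases h3 : red N (tot p v) = red N l
    · by_cases h4 : tot p v = l
      · simp [h4]
      · have h5 : tot p v ∉ modes N := fun h5 => h4 (red_injOn hN h5 hl h3)
        simp [h3, h4, h5]
    · simp [h3]
  refine (nrm_mono hP0.le hpt).trans ((nrm_modes_le hN hP0 _).trans ?_)
  refine (hal y fun l hl => by simp [y, hl]).trans ?_
  rw [ENNReal.ofReal_mul hϱ]
  gcongr
  have h3 : ∀ l, ENNReal.ofReal (delta a b l ^ M) * y l ≤
      push (tot p) (fun v => ENNReal.ofReal (delta a b (tot p v) ^ M * ‖mono p z v‖)) l := by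
    intro l
    have h4 : y l ≤ Z l := by simp only [y]; split_ifs <;> simp
    refine (mul_le_mul_right h4 _).trans (le_of_eq ?_)
    rw [← push_const_mul]
    refine push_congr fun v hv => ?_
    rw [hv, ENNReal.ofReal_mul (pow_nonneg (delta_pos a b l).le _), ofReal_norm]
  refine (nrm_mono (by norm_num) h3).trans ?_
  -- The algebra property keeps the majorant of the nonlinearity in H^M, as the aliasing bound
  -- requires.
  have h5 := tupleBd_mono (p := p) (r := 2) (w := fun l => delta a b l ^ M) (K := (2 * p + 1) ^ M)
    (by norm_num) (by positivity) (fun l => (pow_pos (delta_pos a b l) _).le) hA0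
    (fun l => delta_tot_pow_le a b p l M) h1 h2
  refine le_trans h5 (ENNReal.ofReal_le_ofReal ?_)
  gcongr
  exact bound_le_nlConst hA

/-- The constant in the bound of the spatial discretization error of the nonlinearity. -/
def aliasConst (p : ℕ) (A : ℝ) (M : ℕ) : ℝ := (2 * p + 1) ^ M * nlConst p A + nlConst p A * A

lemma aliasConst_nonneg {A : ℝ} (hA : 1 ≤ A) (M : ℕ) : 0 ≤ aliasConst p A M := by
  have := zero_le_one.trans (one_le_nlConst (p := p) hA)
  unfold aliasConst
  positivity

/-- The spatial discretization error of the nonlinearity. -/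
lemma nl_cut_bd (hN : ∀ i, 0 < N i ∧ Even (N i)) {P : ℝ} (hP : 1 ≤ P) {M : ℕ} {ϱ A : ℝ}
    (hϱ : 0 ≤ ϱ) (hA : 1 ≤ A) (hal : AliasBd a b N M P ϱ) {z : (Fin d → ℤ) → ℂ} (h1 : Bd 1 z A)
    (h2 : Bd 2 (fun l => ((delta a b l ^ M : ℝ) : ℂ) * z l) A) :
    Bd P (cut N fun l => nl p (AddMonoidHom.id _) z l - nl p (red N) (cut N z) (red N l))
      (ϱ * aliasConst p A M) := by
  have hP0 : 0 < P := by linarith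
  have hA0 : 0 ≤ A := by linarith
  have hc := zero_le_one.trans (one_le_nlConst (p := p) hA)
  have h3 := nl_alias_bd (p := p) hN hP hϱ hA hal h1 h2
  -- The second error comes from truncating the argument. What is cut off lives outside the modes,
  -- so its reduction is again controlled by the aliasing bound; for this reason `nl_lipschitz`
  -- measures differences after reduction.
  have h4 := nl_lipschitz (p := p) hP (red N) (z := z) (z' := cut N z) (B := ϱ * A) hA0 h1
    (h1.cut (by norm_num)) ?_
  · have h5 := (h4.comp_red hN hP0).mono_const (L := ϱ * (nlConst p A * A)) (by
      calc _ ≤ nlConst p A * (ϱ * A) := by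
            gcongr
            exact lipschitz_le_nlConst hA
        _ = _ := by ring)
    refine ((h3.add hP h5 (by positivity) (by positivity)).mono_const
      (le_of_eq (by unfold aliasConst; ring))).mono hP0.le fun l => ?_
    apply le_of_eq
    unfold cut
    split_ifs
    · congr 1; ring
    · simp
  · refine (hal _ fun l hl => by simp [cut, hl]).trans ?_
    rw [ENNReal.ofReal_mul hϱ]
    gcongr
    refine (nrm_mono (by norm_num) fun l => ?_).trans h2
    rw [enorm_weight_mul (pow_nonneg (delta_pos a b l).le _)]
    gcongr
    rw [← ofReal_norm, ← ofReal_norm]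
    refine ENNReal.ofReal_le_ofReal ?_
    unfold cut
    split_ifs <;> simp

/-- The Lipschitz constant of the numerical nonlinearity. -/
def lipConst (p : ℕ) (A : ℝ) : ℝ := (2 * p + 1) * (2 * (2 * A)) ^ (2 * p)

/-- Stability of the numerical nonlinearity. -/
lemma nl_red_sub_bd (hN : ∀ i, 0 < N i ∧ Even (N i)) {P : ℝ} (hP : 1 ≤ P) {A B : ℝ} (hA : 0 ≤ A)
    {z z' : (Fin d → ℤ) → ℂ} (hz : Bd 1 z (2 * A)) (hz' : Bd 1 z' (2 * A))
    (hs : ∀ l ∉ modes N, z l = 0) (hs' : ∀ l ∉ modes N, z' l = 0)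
    (h : Bd P (fun l => z l - z' l) B) :
    Bd P (cut N fun l => nl p (red N) z (red N l) - nl p (red N) z' (red N l))
      (lipConst p A * B) := by
  have hP0 : 0 < P := by linarith
  refine (nl_lipschitz (p := p) hP (red N) (B := B) (by positivity) hz hz' ?_).comp_red hN hP0
  -- Both arguments are supported on the modes, where the reduction is injective, so reducing the
  -- difference does not increase its norm.
  refine (nrm_push_le_of_injOn hP0 fun l k hl hk hlk => ?_).trans h
  have hmem : ∀ l, ‖z l - z' l‖ₑ ≠ 0 → l ∈ modes N := by
    intro l hl
    by_contra hc
    simp [hs l hc, hs' l hc] at hl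
  exact red_injOn hN (hmem l hl) (hmem k hk) hlk

variable (a b p e N)

/-- The pseudospectral scheme for the discrete Fourier coefficients of the twisted variables. -/
structure IsNumeric (κ : ℝ) (ζ : ℕ → Bool → (Fin d → ℤ) → ℂ) : Prop where
  supp : ∀ n s, ∀ l ∉ modes N, ζ n s l = 0
  step : ∀ n s, ∀ l ∈ modes N, ζ (n + 1) s l = ζ n s l + Complex.I * sg s * κ / delta a b l *
    (rot a b e s (-(n * κ + κ / 2)) l *
      nl p (red N) (comb a b e (n * κ + κ / 2) (ζ n)) (red N l))

variable {a b p e N}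

/-- The constant of the error bounds. -/
def errConst (p : ℕ) (T A : ℝ) (m M : ℕ) : ℝ :=
  (2 * A + T * nlConst p A ^ 2 + midConst p T A m + T * aliasConst p A M) *
    Real.exp (lipConst p A * T)

/-- The sequence K(1 + L)^k solves the summed Gronwall recursion with equality, which closes the
induction in `err_bd`. -/
lemma geom_gronwall (K L : ℝ) (n : ℕ) :
    K + L * ∑ k ∈ Finset.range n, K * (1 + L) ^ k = K * (1 + L) ^ n := by
  rw [← Finset.mul_sum]
  have := geom_sum_mul (1 + L) n
  have h2 : L * ∑ k ∈ Finset.range n, (1 + L) ^ k = (1 + L) ^ n - 1 := by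
    rw [← this]; ring
  calc _ = K + K * (L * ∑ k ∈ Finset.range n, (1 + L) ^ k) := by ring
    _ = _ := by rw [h2]; ring

namespace TwistedBounds

variable {T A P : ℝ} {m : ℕ} {ξ : ℝ → Bool → (Fin d → ℤ) → ℂ}

/-- The error recursion. -/
lemma err_step (H : TwistedBounds a b p e T A P m ξ) (hN : ∀ i, 0 < N i ∧ Even (N i)) {M : ℕ}
    (hS : ∀ r ∈ Set.Icc 0 T, ∀ s, Bd 2 (fun l => ((delta a b l ^ M : ℝ) : ℂ) * ξ r s l) A)
    {ϱ : ℝ} (hϱ : 0 ≤ ϱ) (hal : AliasBd a b N M P ϱ) {κ : ℝ} (hκ : 0 ≤ κ)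
    {ζ : ℕ → Bool → (Fin d → ℤ) → ℂ} (hζ : IsNumeric a b p e N κ ζ)
    (h0 : ∀ s, Bd P (fun l => (delta a b l : ℂ) * cut N (fun l => ξ 0 s l - ζ 0 s l) l)
      (2 * A * ϱ)) {n : ℕ} (hn : n * κ ≤ T)
    (hb : ∀ k < n, ∀ s, Bd 1 (ζ k s) (2 * A)) {B : ℕ → ℝ} (hB0 : ∀ k < n, 0 ≤ B k)
    (hB : ∀ k < n, ∀ s, Bd P (fun l => (delta a b l : ℂ) *
      cut N (fun l => ξ (k * κ) s l - ζ k s l) l) (B k)) (s : Bool) :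
    Bd P (fun l => (delta a b l : ℂ) * cut N (fun l => ξ (n * κ) s l - ζ n s l) l)
      ((2 * A + T * nlConst p A ^ 2 + midConst p T A m + T * aliasConst p A M) *
        (ϱ + κ ^ 2 / e + (κ / e) ^ (m + 1)) +
        κ * lipConst p A * ∑ k ∈ Finset.range n, B k) := by
  have he := H.pos
  have hP := H.exponent
  have hA := H.zero_le
  have hP0 : 0 < P := by linarith
  have hc := zero_le_one.trans (one_le_nlConst (p := p) H.one_le)
  have hL : 0 ≤ lipConst p A := by unfold lipConst; positivity
  have hal0 := aliasConst_nonneg (p := p) H.one_le M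
  have hT : 0 ≤ T := le_trans (by positivity) hn
  have hmid := midConst_nonneg (p := p) hT H.one_le m
  have hkT : ∀ k : ℕ, k ≤ n → (k : ℝ) * κ ∈ Set.Icc 0 T := fun k hk =>
    ⟨by positivity, le_trans (by gcongr) hn⟩
  have hkn : ∀ k ∈ Finset.range n, (k : ℝ) * κ ∈ Set.Icc 0 T := fun k hk =>
    hkT k (Finset.mem_range.1 hk).le
  have hrem : ∀ k ∈ Finset.range n, Bd P (fun l => (delta a b l : ℂ) *
      (ξ ((k + 1 : ℕ) * κ) s l - ξ (k * κ) s l) -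
      Complex.I * sg s * freeInt a b p e s (k * κ) κ (ξ (k * κ)) l)
      (nlConst p A ^ 2 * κ ^ 3 / e) := by
    intro k hk
    have h1 := H.remainder_bd (hkn k hk).1 (t' := (k + 1 : ℕ) * κ)
      (by push_cast; nlinarith) (hkT (k + 1) (Finset.mem_range.1 hk)).2 s
    have h2 : ((k + 1 : ℕ) : ℝ) * κ - k * κ = κ := by push_cast; ring
    rwa [h2] at h1
  have hcomb1 : ∀ k ∈ Finset.range n, ∀ t, Bd 1 (comb a b e t (ξ (k * κ))) A := fun k hk t =>
    comb_bd_one le_rfl hA (H.bd' (hkn k hk))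
  have hali : ∀ k ∈ Finset.range n, Bd P (cut N fun l =>
      nl p (AddMonoidHom.id _) (comb a b e (k * κ + κ / 2) (ξ (k * κ))) l -
      nl p (red N) (cut N (comb a b e (k * κ + κ / 2) (ξ (k * κ)))) (red N l))
      (ϱ * aliasConst p A M) := fun k hk =>
    nl_cut_bd hN hP hϱ H.one_le hal (hcomb1 k hk _)
      (comb_bd (by norm_num) hA (hS _ (hkn k hk)))
  have hsta : ∀ k ∈ Finset.range n, Bd P (cut N fun l =>
      nl p (red N) (cut N (comb a b e (k * κ + κ / 2) (ξ (k * κ)))) (red N l) -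
      nl p (red N) (comb a b e (k * κ + κ / 2) (ζ k)) (red N l)) (lipConst p A * B k) := by
    intro k hk
    have hk' := Finset.mem_range.1 hk
    refine nl_red_sub_bd hN hP hA (((hcomb1 k hk _).cut (by norm_num)).mono_const (by linarith))
      (comb_bd_one le_rfl (by positivity) (hb k hk')) (fun l hl => by simp [cut, hl])
      (fun l hl => by simp [comb, hζ.supp k _ l hl]) ?_
    have h1 := comb_bd_one (a := a) (b := b) (e := e) (r := k * κ + κ / 2) hP (hB0 k hk')
      (fun s => H.bd_of_delta hP0.le (hB k hk' s))
    refine h1.mono hP0.le fun l => ?_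
    rw [cut_comb, comb_sub]
    apply le_of_eq
    congr 2
    funext s l
    unfold cut
    split_ifs with hl
    · rfl
    · simp [hζ.supp k s l hl]
  -- Initial error, freezing remainders, midpoint errors, and then aliasing together with stability.
  -- The midpoint errors enter as one sum over all steps, since their smallness comes from
  -- cancellation between steps; the others are estimated step by step.
  have hsum := (((h0 s).add hP ((Bd.sum hP (Finset.range n) hrem fun k _ => by positivity).cut
      (N := N) hP0.le) (by positivity) (Finset.sum_nonneg fun k _ => by positivity)).add hP
    ((H.sum_midpoint_bd hκ n hn s).cut (N := N) hP0.le |>.of_le_mul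
      (y := fun l => Complex.I * sg s * cut N (fun l => ∑ k ∈ Finset.range n,
        (freeInt a b p e s (k * κ) κ (ξ (k * κ)) l - κ * (rot a b e s (-(k * κ + κ / 2)) l *
        nl p (AddMonoidHom.id _) (comb a b e (k * κ + κ / 2) (ξ (k * κ))) l))) l)
      hP0 zero_le_one fun l => by
        rw [norm_mul, norm_mul, norm_sg, Complex.norm_I]; simp)
    (add_nonneg (by positivity) (Finset.sum_nonneg fun k _ => by positivity))
    (by positivity)).add hP
    (Bd.sum hP (Finset.range n) (fun k hk => ((hali k hk).add hP (hsta k hk) (by positivity)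
      (mul_nonneg hL (hB0 k (Finset.mem_range.1 hk)))).of_le_mul (c := κ)
        (y := fun l => Complex.I * sg s * κ * rot a b e s (-(k * κ + κ / 2)) l * (cut N (fun l =>
      nl p (AddMonoidHom.id _) (comb a b e (k * κ + κ / 2) (ξ (k * κ))) l -
      nl p (red N) (cut N (comb a b e (k * κ + κ / 2) (ξ (k * κ)))) (red N l)) l + cut N (fun l =>
      nl p (red N) (cut N (comb a b e (k * κ + κ / 2) (ξ (k * κ)))) (red N l) -
      nl p (red N) (comb a b e (k * κ + κ / 2) (ζ k)) (red N l)) l)) hP0 hκ fun l => by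
        rw [norm_mul, norm_mul, norm_mul, norm_mul, norm_sg, Complex.norm_I, norm_rot,
          Complex.norm_real, Real.norm_of_nonneg hκ]
        simp)
      fun k hk => by
        have := mul_nonneg hL (hB0 k (Finset.mem_range.1 hk))
        positivity)
    (add_nonneg (add_nonneg (by positivity) (Finset.sum_nonneg fun k _ => by positivity))
      (by positivity))
    (Finset.sum_nonneg fun k hk => by
        have := mul_nonneg hL (hB0 k (Finset.mem_range.1 hk))
        positivity)
  refine (hsum.mono_const ?_).mono hP0.le fun l => ?_
  · simp only [Finset.sum_const, Finset.card_range, nsmul_eq_mul, one_mul]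
    rw [← Finset.mul_sum, Finset.sum_add_distrib, Finset.sum_const, Finset.card_range, nsmul_eq_mul,
      ← Finset.mul_sum]
    have hX : 0 ≤ κ ^ 2 / e := by positivity
    have hY : 0 ≤ (κ / e) ^ (m + 1) := by positivity
    have t1 : n * (nlConst p A ^ 2 * κ ^ 3 / e) ≤ T * nlConst p A ^ 2 * (κ ^ 2 / e) := by
      calc _ = (n * κ) * (nlConst p A ^ 2 * (κ ^ 2 / e)) := by ring
        _ ≤ T * (nlConst p A ^ 2 * (κ ^ 2 / e)) := by gcongr
        _ = _ := by ring
    have t2 : κ * (n * (ϱ * aliasConst p A M)) ≤ T * aliasConst p A M * ϱ := by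
      calc _ = (n * κ) * (ϱ * aliasConst p A M) := by ring
        _ ≤ T * (ϱ * aliasConst p A M) := by gcongr
        _ = _ := by ring
    have u1 : 0 ≤ 2 * A * (κ ^ 2 / e + (κ / e) ^ (m + 1)) := by positivity
    have u2 : 0 ≤ T * nlConst p A ^ 2 * (ϱ + (κ / e) ^ (m + 1)) := by positivity
    have u3 : 0 ≤ midConst p T A m * ϱ := by positivity
    have u4 : 0 ≤ T * aliasConst p A M * (κ ^ 2 / e + (κ / e) ^ (m + 1)) := by positivity
    linarith
  · apply le_of_eq
    congr 1
    by_cases hl : l ∈ modes N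
    swap
    · simp [cut, hl]
    have hd : (delta a b l : ℂ) ≠ 0 := by exact_mod_cast (delta_pos a b l).ne'
    simp only [cut, if_pos hl]
    -- The error is unrolled down to the initial time, as a telescoping sum of exact increments
    -- minus numerical ones.
    have key : ∀ j : ℕ, (delta a b l : ℂ) * (ξ (j * κ) s l - ζ j s l) =
        delta a b l * (ξ 0 s l - ζ 0 s l) + ∑ k ∈ Finset.range j, (delta a b l *
          (ξ ((k + 1 : ℕ) * κ) s l - ξ (k * κ) s l) - Complex.I * sg s * κ *
          (rot a b e s (-(k * κ + κ / 2)) l *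
            nl p (red N) (comb a b e (k * κ + κ / 2) (ζ k)) (red N l))) := by
      intro j
      induction j with
      | zero => simp
      | succ j ih =>
        rw [Finset.sum_range_succ, ← add_assoc, ← ih, hζ.step j s l hl]
        field_simp
        ring
    rw [key, add_assoc, add_assoc]
    congr 1
    rw [Finset.mul_sum, ← Finset.sum_add_distrib, ← Finset.sum_add_distrib]
    refine Finset.sum_congr rfl fun k _ => ?_
    ring

/-- Gronwall's argument applied to `err_step`. The ℓ¹ bound on the numerical solution is required at
earlier steps only, which lets `numeric_bd` use this lemma inside its induction. -/
lemma err_bd (H : TwistedBounds a b p e T A P m ξ) (hN : ∀ i, 0 < N i ∧ Even (N i)) {M : ℕ}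
    (hS : ∀ r ∈ Set.Icc 0 T, ∀ s, Bd 2 (fun l => ((delta a b l ^ M : ℝ) : ℂ) * ξ r s l) A)
    {ϱ : ℝ} (hϱ : 0 ≤ ϱ) (hal : AliasBd a b N M P ϱ) {κ : ℝ} (hκ : 0 ≤ κ)
    {ζ : ℕ → Bool → (Fin d → ℤ) → ℂ} (hζ : IsNumeric a b p e N κ ζ)
    (h0 : ∀ s, Bd P (fun l => (delta a b l : ℂ) * cut N (fun l => ξ 0 s l - ζ 0 s l) l)
      (2 * A * ϱ)) (n : ℕ) (hn : n * κ ≤ T)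
    (hb : ∀ k < n, ∀ s, Bd 1 (ζ k s) (2 * A)) (s : Bool) :
    Bd P (fun l => (delta a b l : ℂ) * cut N (fun l => ξ (n * κ) s l - ζ n s l) l)
      (errConst p T A m M * (ϱ + κ ^ 2 / e + (κ / e) ^ (m + 1))) := by
  have he := H.pos
  have hA := H.zero_le
  have hT : 0 ≤ T := le_trans (by positivity) hn
  have hc := zero_le_one.trans (one_le_nlConst (p := p) H.one_le)
  have hL : 0 ≤ lipConst p A := by unfold lipConst; positivity
  have hal0 := aliasConst_nonneg (p := p) H.one_le M
  have hmid := midConst_nonneg (p := p) hT H.one_le m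
  set K := (2 * A + T * nlConst p A ^ 2 + midConst p T A m + T * aliasConst p A M) *
    (ϱ + κ ^ 2 / e + (κ / e) ^ (m + 1)) with hK
  have hK0 : 0 ≤ K := by positivity
  have main : ∀ j ≤ n, ∀ s, Bd P (fun l => (delta a b l : ℂ) *
      cut N (fun l => ξ (j * κ) s l - ζ j s l) l) (K * (1 + κ * lipConst p A) ^ j) := by
    intro j
    induction j using Nat.strong_induction_on with
    | _ j ih =>
      intro hj s
      have hjT : (j : ℝ) * κ ≤ T := le_trans (by gcongr) hn
      have := H.err_step hN hS hϱ hal hκ hζ h0 hjT (fun k hk => hb k (by omega))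
        (B := fun k => K * (1 + κ * lipConst p A) ^ k) (fun k _ => by positivity)
        (fun k hk s => ih k hk (by omega) s) s
      exact this.mono_const (le_of_eq (geom_gronwall K (κ * lipConst p A) j))
  refine (main n le_rfl s).mono_const ?_
  have h1 : (1 + κ * lipConst p A) ^ n ≤ Real.exp (lipConst p A * T) := by
    calc (1 + κ * lipConst p A) ^ n ≤ (Real.exp (κ * lipConst p A)) ^ n := by
          gcongr
          linarith [Real.add_one_le_exp (κ * lipConst p A)]
      _ = Real.exp (lipConst p A * (n * κ)) := by
          rw [← Real.exp_nat_mul]; congr 1; ring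
      _ ≤ _ := by gcongr
  calc K * (1 + κ * lipConst p A) ^ n ≤ K * Real.exp (lipConst p A * T) := by gcongr
    _ = _ := by rw [hK, errConst]; ring

/-- The numerical solution is bounded in `ℓ¹` for fine discretizations. -/
lemma numeric_bd (H : TwistedBounds a b p e T A P m ξ) (hN : ∀ i, 0 < N i ∧ Even (N i)) {M : ℕ}
    (hS : ∀ r ∈ Set.Icc 0 T, ∀ s, Bd 2 (fun l => ((delta a b l ^ M : ℝ) : ℂ) * ξ r s l) A)
    {ϱ : ℝ} (hϱ : 0 ≤ ϱ) (hal : AliasBd a b N M 1 ϱ) {κ : ℝ} (hκ : 0 ≤ κ)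
    {ζ : ℕ → Bool → (Fin d → ℤ) → ℂ} (hζ : IsNumeric a b p e N κ ζ)
    (h0 : ∀ s, Bd 1 (fun l => (delta a b l : ℂ) * cut N (fun l => ξ 0 s l - ζ 0 s l) l)
      (2 * A * ϱ)) (hsmall : errConst p T A 0 M * (ϱ + κ ^ 2 / e + κ / e) ≤ 1)
    (n : ℕ) (hn : n * κ ≤ T) (s : Bool) : Bd 1 (ζ n s) (2 * A) := by
  have hA := H.one_le
  induction n using Nat.strong_induction_on generalizing s with
  | _ n ih =>
    -- The bounds at earlier steps give an ℓ¹ error of at most 1 at step `n`. Since 1 ≤ A, the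
    -- numerical solution is bounded by A + 1 ≤ 2A there as well.
    have h1 := H.exponent_one.err_bd hN hS hϱ hal hκ hζ h0 n hn
      (fun k hk s => ih k hk (le_trans (by gcongr) hn) s) s
    rw [zero_add, pow_one] at h1
    have h2 := H.bd_of_delta (by norm_num) (h1.mono_const hsmall)
    have h3 := (H.bd' (r := n * κ) ⟨by positivity, hn⟩ s).cut (N := N) (by norm_num)
    refine ((h3.sub le_rfl h2 H.zero_le zero_le_one).mono_const (by linarith)).mono (by norm_num)
      fun l => ?_
    apply le_of_eq
    congr 1
    unfold cut
    split_ifs with hl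
    · ring
    · simp [hζ.supp n s l hl]

end TwistedBounds

end numeric

/-! ### Plane waves on the box and Fourier series on the torus. -/

section torus

variable {d : ℕ} {a b : Fin d → ℝ}

lemma wave_add (l k : Fin d → ℤ) (x : Pt d) : wave a b (l + k) x = wave a b l x * wave a b k x := by
  unfold wave
  rw [← Complex.exp_add, ← mul_add, ← Complex.ofReal_add, ← Finset.sum_add_distrib]
  simp only [freq_add, add_mul]

lemma wave_zero (x : Pt d) : wave a b 0 x = 1 := by simp [wave, freq]

lemma norm_wave (l : Fin d → ℤ) (x : Pt d) : ‖wave a b l x‖ = 1 := by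
  rw [wave, mul_comm, Complex.norm_exp_ofReal_mul_I]

lemma wave_neg (l : Fin d → ℤ) (x : Pt d) : wave a b (-l) x = star (wave a b l x) := by
  have h1 : wave a b (-l) x * wave a b l x = 1 := by rw [← wave_add, neg_add_cancel, wave_zero]
  have h2 : star (wave a b l x) * wave a b l x = 1 := by
    rw [mul_comm, Complex.star_def, Complex.mul_conj, Complex.normSq_eq_norm_sq, norm_wave]
    simp
  have h3 : wave a b l x ≠ 0 := by
    rw [← norm_ne_zero_iff, norm_wave]; norm_num
  exact mul_right_cancel₀ h3 (h1.trans h2.symm)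

lemma contDiff_wave (l : Fin d → ℤ) : ContDiff ℝ ∞ (wave a b l) := by
  have h : ContDiff ℝ ∞ fun x : Pt d => ∑ i, freq a b l i * (x i - a i) := by
    refine ContDiff.sum fun i _ => contDiff_const.mul (ContDiff.sub ?_ contDiff_const)
    exact (EuclideanSpace.proj i : EuclideanSpace ℝ (Fin d) →L[ℝ] ℝ).contDiff
  exact (contDiff_const.mul (Complex.ofRealCLM.contDiff.comp h)).cexp

lemma continuous_wave (l : Fin d → ℤ) : Continuous (wave a b l) := (contDiff_wave l).continuous

lemma isPeriodic_wave (hab : ∀ i, a i < b i) (l : Fin d → ℤ) : IsPeriodic a b (wave a b l) := by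
  intro i x
  unfold wave
  rw [Complex.exp_eq_exp_iff_exists_int]
  refine ⟨l i, ?_⟩
  have h : ∑ j, freq a b l j * ((x + EuclideanSpace.single i (b i - a i)) j - a j) =
      ∑ j, freq a b l j * (x j - a j) + 2 * Real.pi * l i := by
    have h1 : ∀ j, freq a b l j * ((x + EuclideanSpace.single i (b i - a i)) j - a j) =
        freq a b l j * (x j - a j) + if j = i then 2 * Real.pi * l i else 0 := by
      intro j
      have hj := sub_pos.2 (hab j)
      by_cases h : j = i
      · subst h
        simp only [PiLp.add_apply, PiLp.single_apply, if_true, freq]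
        field_simp
        ring
      · simp [h]
    rw [Finset.sum_congr rfl fun j _ => h1 j, Finset.sum_add_distrib]
    simp
  rw [h]
  push_cast
  ring

variable (a b) in
/-- The point of the unit torus below a point of `ℝ^d`. -/
def toTorus (x : Pt d) : UnitAddTorus (Fin d) :=
  fun i => (((x i - a i) / (b i - a i) : ℝ) : UnitAddCircle)

lemma wave_eq_mFourier (l : Fin d → ℤ) (x : Pt d) :
    wave a b l x = UnitAddTorus.mFourier l (toTorus a b x) := by
  simp only [wave, UnitAddTorus.mFourier, ContinuousMap.coe_mk, toTorus, fourier_coe_apply]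
  rw [← Complex.exp_sum]
  congr 1
  push_cast
  rw [Finset.mul_sum]
  refine Finset.sum_congr rfl fun i _ => ?_
  simp only [freq]
  push_cast
  ring

/-- A rescaling homeomorphism followed by the quotient maps of the circles. Being a quotient map is
what lets continuity descend to the torus. -/
lemma isOpenQuotientMap_toTorus (hab : ∀ i, a i < b i) : IsOpenQuotientMap (toTorus a b) := by
  have h1 : IsOpenQuotientMap (Pi.map fun (_ : Fin d) (t : ℝ) => (t : UnitAddCircle)) :=
    IsOpenQuotientMap.piMap fun _ => QuotientAddGroup.isOpenQuotientMap_mk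
  have h2 : IsOpenQuotientMap (Pi.map fun (i : Fin d) (t : ℝ) => (t - a i) / (b i - a i)) :=
    IsOpenQuotientMap.piMap fun i => ((Homeomorph.subRight (a i)).trans
      (Homeomorph.mulRight₀ (b i - a i)⁻¹
        (inv_ne_zero (sub_pos.2 (hab i)).ne'))).isOpenQuotientMap
  exact h1.comp (h2.comp (EuclideanSpace.equiv (Fin d) ℝ).toHomeomorph.isOpenQuotientMap)

lemma IsPeriodic.zsmul {u : Pt d → ℂ} (hu : IsPeriodic a b u) (i : Fin d) (n : ℤ) (x : Pt d) :
    u (x + n • EuclideanSpace.single i (b i - a i)) = u x := by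
  have h : Function.Periodic u (EuclideanSpace.single i (b i - a i)) := hu i
  exact h.zsmul n x

lemma IsPeriodic.sum {u : Pt d → ℂ} (hu : IsPeriodic a b u) (n : Fin d → ℤ) (s : Finset (Fin d))
    (x : Pt d) : u (x + ∑ i ∈ s, n i • EuclideanSpace.single i (b i - a i)) = u x := by
  induction s using Finset.cons_induction generalizing x with
  | empty => simp
  | cons i s hi ih => rw [Finset.sum_cons, ← add_assoc, ih, hu.zsmul]

/-- A continuous periodic function descends to the torus. -/
lemma exists_lift (hab : ∀ i, a i < b i) {u : Pt d → ℂ} (hc : Continuous u)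
    (hu : IsPeriodic a b u) :
    ∃ F : C(UnitAddTorus (Fin d), ℂ), ∀ x, F (toTorus a b x) = u x := by
  have hq := isOpenQuotientMap_toTorus hab
  have key : ∀ x y, toTorus a b x = toTorus a b y → u x = u y := by
    intro x y hxy
    have h1 : ∀ i, ∃ n : ℤ, x i - y i = n * (b i - a i) := by
      intro i
      have h2 := congrFun hxy i
      simp only [toTorus] at h2
      obtain ⟨n, hn⟩ := AddSubgroup.mem_zmultiples_iff.1 (QuotientAddGroup.eq.1 h2.symm)
      have hi := (sub_pos.2 (hab i)).ne'
      refine ⟨n, ?_⟩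
      have h3 : (n : ℝ) = -((y i - a i) / (b i - a i)) + (x i - a i) / (b i - a i) := by
        rw [← hn]; simp
      rw [h3]
      field_simp
      ring
    choose n hn using h1
    rw [← hu.sum n Finset.univ y]
    congr 1
    ext i
    simp only [PiLp.add_apply, WithLp.ofLp_sum, Finset.sum_apply, PiLp.smul_apply,
      PiLp.single_apply, smul_ite, smul_zero, Finset.sum_ite_eq, Finset.mem_univ, if_true]
    rw [zsmul_eq_mul, ← hn i]
    ring
  have h : ∀ x, u (Function.surjInv hq.surjective (toTorus a b x)) = u x := fun x =>
    key _ _ (Function.surjInv_eq hq.surjective _)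
  refine ⟨⟨fun t => u (Function.surjInv hq.surjective t), ?_⟩, h⟩
  rw [← hq.continuous_comp_iff]
  exact hc.congr fun x => (h x).symm

/-- An affine change of variables whose Jacobian is the volume of the box; the open and half-open
unit cubes agree up to a null set. -/
lemma integral_box (hab : ∀ i, a i < b i) (G : UnitAddTorus (Fin d) → ℂ) :
    ((∏ i, (b i - a i) : ℝ) : ℂ)⁻¹ * ∫ x in box a b, G (toTorus a b x) =
      ∫ y in {y : Fin d → ℝ | ∀ i, y i ∈ Set.Ioc ((0 : Fin d → ℝ) i) ((0 : Fin d → ℝ) i + 1)},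
        G (fun i => (y i : UnitAddCircle)) := by
  have hpos : 0 < ∏ i, (b i - a i) := Finset.prod_pos fun i _ => sub_pos.2 (hab i)
  let L : (Fin d → ℝ) →L[ℝ] (Fin d → ℝ) :=
    LinearMap.toContinuousLinearMap (Matrix.toLin' (Matrix.diagonal fun i => b i - a i))
  have hL : ∀ y i, L y i = (b i - a i) * y i := fun y i => by
    simp [L, Matrix.mulVec_diagonal]
  have hdet : L.det = ∏ i, (b i - a i) := by
    simp only [L, ContinuousLinearMap.det, LinearMap.coe_toContinuousLinearMap,
      LinearMap.det_toLin', Matrix.det_diagonal]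
  have h1 : ∫ x in box a b, G (toTorus a b x) =
      ∫ x in {x : Fin d → ℝ | ∀ i, x i ∈ Set.Ioo (a i) (b i)}, G (toTorus a b (WithLp.toLp 2 x)) :=
    ((PiLp.volume_preserving_toLp (Fin d)).setIntegral_preimage_emb
      (MeasurableEquiv.toLp 2 (Fin d → ℝ)).measurableEmbedding _ (box a b)).symm
  have h2 : {x : Fin d → ℝ | ∀ i, x i ∈ Set.Ioo (a i) (b i)} =
      (fun y => a + L y) '' (Set.univ.pi fun _ => Set.Ioo 0 1) := by
    ext x
    simp only [Set.mem_ofPred_eq, Set.mem_image, Set.mem_pi, Set.mem_univ, true_imp_iff, Set.mem_Ioo]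
    constructor
    · intro h
      refine ⟨fun i => (x i - a i) / (b i - a i), fun i => ?_, ?_⟩
      · have hi := sub_pos.2 (hab i)
        rw [lt_div_iff₀ hi, div_lt_iff₀ hi]
        constructor <;> linarith [(h i).1, (h i).2]
      · funext i
        have hi := (sub_pos.2 (hab i)).ne'
        rw [Pi.add_apply, hL]
        field_simp
        ring
    · rintro ⟨y, hy, rfl⟩ i
      have hi := sub_pos.2 (hab i)
      rw [Pi.add_apply, hL]
      constructor <;> nlinarith [(hy i).1, (hy i).2]
  have h3 : (Set.univ.pi fun _ : Fin d => Set.Ioo (0 : ℝ) 1) =ᵐ[MeasureTheory.volume]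
      {y : Fin d → ℝ | ∀ i, y i ∈ Set.Ioc ((0 : Fin d → ℝ) i) ((0 : Fin d → ℝ) i + 1)} := by
    have h4 : {y : Fin d → ℝ | ∀ i, y i ∈ Set.Ioc ((0 : Fin d → ℝ) i) ((0 : Fin d → ℝ) i + 1)} =
        Set.univ.pi fun _ : Fin d => Set.Ioc (0 : ℝ) 1 := by
      ext; simp
    rw [h4]
    exact (MeasureTheory.Measure.univ_pi_Ioo_ae_eq_Icc (f := fun _ => (0 : ℝ))
      (g := fun _ => (1 : ℝ))).trans
      (MeasureTheory.Measure.univ_pi_Ioc_ae_eq_Icc (f := fun _ => (0 : ℝ))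
      (g := fun _ => (1 : ℝ))).symm
  rw [h1, h2, MeasureTheory.integral_image_eq_integral_abs_det_fderiv_smul MeasureTheory.volume
    (MeasurableSet.univ_pi fun _ => measurableSet_Ioo)
    (fun y _ => (L.hasFDerivAt.const_add a).hasFDerivWithinAt) ?_,
    ← MeasureTheory.setIntegral_congr_set h3]
  · rw [MeasureTheory.integral_smul, hdet, abs_of_pos hpos, Complex.real_smul, ← mul_assoc,
      inv_mul_cancel₀ (by exact_mod_cast hpos.ne'), one_mul]
    congr 1
    funext y
    congr 1
    funext i
    have hi := (sub_pos.2 (hab i)).ne'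
    simp only [toTorus, Pi.add_apply, hL]
    congr 1
    field_simp
    ring
  · intro y _ z _ hyz
    funext i
    have h5 := congrFun (add_left_cancel hyz) i
    rw [hL, hL] at h5
    exact mul_left_cancel₀ (sub_pos.2 (hab i)).ne' h5

lemma fourierCoef_lift (hab : ∀ i, a i < b i) (F : UnitAddTorus (Fin d) → ℂ) (l : Fin d → ℤ) :
    fourierCoef a b (fun x => F (toTorus a b x)) l = UnitAddTorus.mFourierCoeff F l := by
  rw [UnitAddTorus.mFourierCoeff_eq_integral F l 0, ← integral_box hab
    fun t => UnitAddTorus.mFourier (-l) t • F t, fourierCoef]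
  simp only [wave_eq_mFourier, smul_eq_mul, mul_comm]

/-- Orthonormality of the Fourier basis of the torus, read off from the coordinates of a basis
vector. -/
lemma fourierCoef_wave (hab : ∀ i, a i < b i) (k l : Fin d → ℤ) :
    fourierCoef a b (wave a b k) l = if k = l then 1 else 0 := by
  have h : wave a b k = fun x => UnitAddTorus.mFourier k (toTorus a b x) :=
    funext (wave_eq_mFourier k)
  have h2 := UnitAddTorus.mFourierBasis_repr (UnitAddTorus.mFourierBasis k) l
  rw [HilbertBasis.repr_self, UnitAddTorus.coe_mFourierBasis] at h2
  rw [h, fourierCoef_lift hab]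
  refine ((UnitAddTorus.mFourierCoeff_toLp _ l).symm.trans h2.symm).trans ?_
  rw [lp.single_apply]
  by_cases hkl : k = l
  · subst hkl; simp
  · simp [hkl, Ne.symm hkl]

/-- Fourier inversion. -/
lemma hasSum_fourierCoef (hab : ∀ i, a i < b i) {u : Pt d → ℂ} (hc : Continuous u)
    (hu : IsPeriodic a b u) (hs : Summable (fourierCoef a b u)) (x : Pt d) :
    HasSum (fun l => fourierCoef a b u l * wave a b l x) (u x) := by
  obtain ⟨F, hF⟩ := exists_lift hab hc hu
  have h : ∀ l, fourierCoef a b u l = UnitAddTorus.mFourierCoeff F l := fun l => by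
    rw [← fourierCoef_lift hab]
    simp only [hF]
  have h2 := UnitAddTorus.hasSum_mFourier_series_apply_of_summable (f := F)
    (by rwa [show fourierCoef a b u = UnitAddTorus.mFourierCoeff F from funext h] at hs)
    (toTorus a b x)
  rw [hF] at h2
  simpa only [h, wave_eq_mFourier, smul_eq_mul] using h2

end torus

/-! ### Fourier coefficients of sums of plane waves and of the nonlinearity. -/

section coefficients

variable {d : ℕ} {a b : Fin d → ℝ} {p : ℕ}

lemma wave_sum {ι : Type*} (s : Finset ι) (k : ι → Fin d → ℤ) (x : Pt d) :
    wave a b (∑ i ∈ s, k i) x = ∏ i ∈ s, wave a b (k i) x := by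
  classical
  induction s using Finset.induction_on with
  | empty => simp [wave_zero]
  | insert i s hi ih => rw [Finset.sum_insert hi, Finset.prod_insert hi, wave_add, ih]

/-- The derivative is the wave times the linear form v ↦ i μ·v. Tracing the second derivative over
the standard basis gives −|μ|². -/
lemma laplacian_wave (l : Fin d → ℤ) (x : Pt d) :
    Laplacian.laplacian (wave a b l) x = -((∑ i, freq a b l i ^ 2 : ℝ) : ℂ) * wave a b l x := by
  let Λ : Pt d →L[ℝ] ℂ := Complex.I • (Complex.ofRealCLM.comp
    (∑ i, freq a b l i • (EuclideanSpace.proj i : EuclideanSpace ℝ (Fin d) →L[ℝ] ℝ)))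
  have hΛ : ∀ v, Λ v = Complex.I * ((∑ i, freq a b l i * v i : ℝ) : ℂ) := fun v => by
    simp [Λ]
  have h1 : ∀ x, HasFDerivAt (wave a b l) (wave a b l x • Λ) x := by
    intro x
    have h2 : HasFDerivAt (fun y : Pt d =>
        Complex.I * ((∑ i, freq a b l i * (y i - a i) : ℝ) : ℂ)) Λ x := by
      have h3 : (fun y : Pt d => Complex.I * ((∑ i, freq a b l i * (y i - a i) : ℝ) : ℂ)) =
          fun y => Λ y + Complex.I * ((∑ i, freq a b l i * (- a i) : ℝ) : ℂ) := by
        funext y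
        rw [hΛ, ← mul_add, ← Complex.ofReal_add, ← Finset.sum_add_distrib]
        simp only [sub_eq_add_neg, mul_add]
      rw [h3]
      exact Λ.hasFDerivAt.add_const _
    exact h2.cexp
  have h4 : fderiv ℝ (wave a b l) = fun x => wave a b l x • Λ := funext fun x => (h1 x).fderiv
  have h5 : fderiv ℝ (fun x => wave a b l x • Λ) x = (wave a b l x • Λ).smulRight Λ :=
    ((h1 x).smul_const Λ).fderiv
  rw [InnerProductSpace.laplacian_eq_iteratedFDeriv_orthonormalBasis _
    (EuclideanSpace.basisFun (Fin d) ℝ)]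
  simp only [iteratedFDeriv_two_apply, h4, h5, EuclideanSpace.basisFun_apply]
  simp only [Matrix.cons_val_zero, Matrix.cons_val_one, ContinuousLinearMap.smulRight_apply,
    smul_apply, hΛ, smul_eq_mul]
  rw [Complex.ofReal_sum, ← Finset.sum_neg_distrib, Finset.sum_mul]
  refine Finset.sum_congr rfl fun i _ => ?_
  have h6 : (∑ j, freq a b l j * (EuclideanSpace.single i (1 : ℝ)) j : ℝ) = freq a b l i := by
    simp [PiLp.single_apply]
  rw [h6]
  push_cast
  linear_combination (wave a b l x * (freq a b l i : ℂ) ^ 2) * Complex.I_sq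

lemma isFiniteMeasure_box :
    MeasureTheory.IsFiniteMeasure (MeasureTheory.volume.restrict (box a b)) := by
  refine ⟨?_⟩
  rw [MeasureTheory.Measure.restrict_apply_univ]
  refine Bornology.IsBounded.measure_lt_top ?_
  refine (isCompact_univ_pi fun i => isCompact_Icc (a := a i) (b := b i)).image
    (PiLp.continuous_toLp 2 _) |>.isBounded.subset ?_
  intro x hx
  exact ⟨WithLp.ofLp x, fun i _ => ⟨(hx i).1.le, (hx i).2.le⟩, rfl⟩

lemma integrableOn_box {u : Pt d → ℂ} (hu : Continuous u) :
    MeasureTheory.IntegrableOn u (box a b) := by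
  have h1 : IsCompact ((WithLp.toLp 2 : (Fin d → ℝ) → Pt d) ''
      (Set.univ.pi fun i => Set.Icc (a i) (b i))) :=
    (isCompact_univ_pi fun i => isCompact_Icc).image (PiLp.continuous_toLp 2 _)
  refine (hu.continuousOn.integrableOn_compact h1).mono_set fun x hx => ?_
  exact ⟨WithLp.ofLp x, fun i _ => ⟨(hx i).1.le, (hx i).2.le⟩, rfl⟩

lemma fourierCoef_sub {u v : Pt d → ℂ} (hu : Continuous u) (hv : Continuous v) (l : Fin d → ℤ) :
    fourierCoef a b (fun x => u x - v x) l = fourierCoef a b u l - fourierCoef a b v l := by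
  have h := continuous_wave (a := a) (b := b) (-l)
  simp only [fourierCoef, sub_mul]
  rw [MeasureTheory.integral_sub (integrableOn_box (by fun_prop)) (integrableOn_box (by fun_prop)),
    mul_sub]

/-- The Fourier coefficients of an absolutely convergent sum of plane waves. -/
lemma fourierCoef_tsum (hab : ∀ i, a i < b i) {ι : Type*} [Countable ι] {F : ι → ℂ}
    (S : ι → Fin d → ℤ) (hF : Summable fun i => ‖F i‖) (l : Fin d → ℤ) :
    fourierCoef a b (fun x => ∑' i, F i * wave a b (S i) x) l = push S F l := by
  classical
  have := isFiniteMeasure_box (a := a) (b := b)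
  have h1 : ∀ x, (∑' i, F i * wave a b (S i) x) * wave a b (-l) x =
      ∑' i, F i * (wave a b (S i) x * wave a b (-l) x) := by
    intro x
    rw [← tsum_mul_right]
    simp only [mul_assoc]
  unfold fourierCoef push
  simp only [h1]
  have h2 := MeasureTheory.hasSum_integral_of_summable_integral_norm
    (μ := MeasureTheory.volume.restrict (box a b))
    (F := fun i x => F i * (wave a b (S i) x * wave a b (-l) x)) (fun i => integrableOn_box
      (continuous_const.mul ((continuous_wave _).mul (continuous_wave _)))) ?_
  · rw [← h2.tsum_eq, ← tsum_mul_left]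
    refine tsum_congr fun i => ?_
    rw [MeasureTheory.integral_const_mul, mul_left_comm]
    have h3 := fourierCoef_wave hab (S i) l
    unfold fourierCoef at h3
    rw [h3]
    split_ifs <;> simp
  · simp only [norm_mul, norm_wave, mul_one, MeasureTheory.integral_const, smul_eq_mul]
    exact hF.mul_left _

lemma fourierCoef_finset_sum (hab : ∀ i, a i < b i) (s : Finset (Fin d → ℤ))
    (c : (Fin d → ℤ) → ℂ) (l : Fin d → ℤ) :
    fourierCoef a b (fun x => ∑ k ∈ s, c k * wave a b k x) l = if l ∈ s then c l else 0 := by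
  classical
  have h := fourierCoef_tsum hab (F := fun k => if k ∈ s then c k else 0) (fun k => k)
    (summable_of_ne_finset_zero (s := s) fun k hk => by simp [hk]) l
  have h1 : push (fun k => k) (fun k => if k ∈ s then c k else 0) l = if l ∈ s then c l else 0 :=
    congrFun (push_id (fun k => if k ∈ s then c k else 0)) l
  rw [h1] at h
  rw [← h]
  congr 1
  funext x
  rw [tsum_eq_sum (s := s) fun k hk => by simp [hk]]
  exact Finset.sum_congr rfl fun k hk => by simp [hk]

lemma slot_wave (j : Fin (2 * p + 1)) (l : Fin d → ℤ) (x : Pt d) :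
    slot p j (wave a b l x) = wave a b (slotSign p j • l) x := by
  unfold slot slotSign
  split_ifs
  · simp
  · simp [wave_neg]

/-- The power is w^{p+1} times the p-th power of the conjugate of w; slots 0 to p hold the
unconjugated factors. -/
lemma nonlin_eq_prod (w : ℂ) : nonlin p w = ∏ j, slot p j w := by
  have h := Fin.prod_univ_eq_prod_range (fun j => if j ≤ p then w else starRingEnd ℂ w) (2 * p + 1)
  unfold slot
  rw [h, show 2 * p + 1 = (p + 1) + p by ring, Finset.prod_range_add,
    Finset.prod_congr rfl fun j hj => if_pos (Nat.lt_succ_iff.1 (Finset.mem_range.1 hj)),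
    Finset.prod_congr rfl fun j (_ : j ∈ Finset.range p) => if_neg (by omega : ¬p + 1 + j ≤ p)]
  simp only [Finset.prod_const, Finset.card_range]
  rw [nonlin, pow_succ w, mul_right_comm, ← mul_pow, Complex.mul_conj, Complex.normSq_eq_norm_sq,
    pow_mul]
  push_cast
  rfl

/-- The expansion of the power nonlinearity. -/
lemma nonlin_tsum {z : (Fin d → ℤ) → ℂ} (hz : Summable fun l => ‖z l‖) (x : Pt d) :
    nonlin p (∑' l, z l * wave a b l x) = ∑' v, mono p z v * wave a b (tot p v) x := by
  have h1 : ∀ j : Fin (2 * p + 1), slot p j (∑' l, z l * wave a b l x) =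
      ∑' l, slot p j (z l) * wave a b (slotSign p j • l) x := by
    intro j
    have h2 : slot p j (∑' l, z l * wave a b l x) = ∑' l, slot p j (z l * wave a b l x) := by
      unfold slot
      split_ifs
      · rfl
      · exact tsum_star
    rw [h2]
    simp only [slot_mul, slot_wave]
  rw [nonlin_eq_prod, Finset.prod_congr rfl fun j _ => h1 j,
    prod_tsum_tuple (x := fun j l => slot p j (z l) * wave a b (slotSign p j • l) x)
      (fun j => by simpa only [norm_mul, norm_slot, norm_wave, mul_one] using hz)]
  refine tsum_congr fun v => ?_
  rw [Finset.prod_mul_distrib, tot, wave_sum, mono]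

lemma fourierCoef_nonlin (hab : ∀ i, a i < b i) {z : (Fin d → ℤ) → ℂ}
    (hz : Summable fun l => ‖z l‖) {u : Pt d → ℂ} (hu : ∀ x, u x = ∑' l, z l * wave a b l x)
    (l : Fin d → ℤ) :
    fourierCoef a b (fun x => nonlin p (u x)) l = nl p (AddMonoidHom.id _) z l := by
  simp only [hu, nonlin_tsum hz]
  rw [fourierCoef_tsum hab _ (summable_mono hz), nl_id]

end coefficients

/-! ### The twisted variables of a solution. -/

section solutions

variable {d : ℕ} {a b : Fin d → ℝ} {p : ℕ}

lemma sobolevNorm_eq_nrm (s : ℕ) (u : Pt d → ℂ) :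
    sobolevNorm a b s u =
      nrm 2 fun l => ‖((delta a b l ^ s : ℝ) : ℂ) * fourierCoef a b u l‖ₑ := by
  unfold sobolevNorm nrm
  congr 1
  refine tsum_congr fun l => ?_
  beta_reduce
  rw [← ofReal_norm, norm_mul, Complex.norm_real,
    Real.norm_of_nonneg (pow_nonneg (delta_pos a b l).le _),
    ENNReal.ofReal_rpow_of_nonneg (by have := delta_pos a b l; positivity) (by norm_num)]
  congr 1
  rw [Real.rpow_ofNat, mul_pow, ← pow_mul, mul_comm s 2, pow_mul, delta_sq]

lemma sobolevNorm_le_iff {s : ℕ} {u : Pt d → ℂ} {K : ℝ} :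
    sobolevNorm a b s u ≤ ENNReal.ofReal K ↔
      Bd 2 (fun l => ((delta a b l ^ s : ℝ) : ℂ) * fourierCoef a b u l) K := by
  rw [sobolevNorm_eq_nrm]; rfl

variable {ε T : ℝ} {u₀ u₁ : Pt d → ℂ} {ν μ : ℝ → Pt d → ℂ}

variable (a b) in
/-- The Fourier coefficients of the twisted variables of a pair `(ν, e μ)`. -/
def twist (e : ℝ) (ν μ : ℝ → Pt d → ℂ) (r : ℝ) (s : Bool) (l : Fin d → ℤ) : ℂ :=
  rot a b e s (-r) l * (fourierCoef a b (ν r) l -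
    Complex.I * sg s / delta a b l * (e * fourierCoef a b (μ r) l))

lemma rot_mul_twist (e : ℝ) (ν μ : ℝ → Pt d → ℂ) (r : ℝ) (s : Bool) (l : Fin d → ℤ) :
    rot a b e s r l * twist a b e ν μ r s l = fourierCoef a b (ν r) l -
      Complex.I * sg s / delta a b l * (e * fourierCoef a b (μ r) l) := by
  rw [twist, ← mul_assoc, rot_mul_rot_neg, one_mul]

/-- The half-sum removes the velocity, so the nonlinearity depends on the twisted pair only through
the coefficients of ν. -/
lemma comb_twist (e : ℝ) (ν μ : ℝ → Pt d → ℂ) (r : ℝ) :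
    comb a b e r (twist a b e ν μ r) = fourierCoef a b (ν r) := by
  funext l
  simp only [comb, ← mul_div_assoc, rot_mul_twist, Fintype.sum_bool, sg, if_true,
    Bool.false_eq_true, if_false]
  push_cast
  ring

lemma twist_bd {e : ℝ} (he : 0 < e) {m : ℕ} {M : ℝ} {r : ℝ}
    (h1 : sobolevNorm a b (m + 1) (ν r) ≤ ENNReal.ofReal M)
    (h2 : sobolevNorm a b m (μ r) ≤ ENNReal.ofReal (M / e)) (s : Bool) :
    Bd 2 (fun l => ((delta a b l ^ (m + 1) : ℝ) : ℂ) * twist a b e ν μ r s l) (2 * |M|) := by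
  have h3 := (sobolevNorm_le_iff.1 h1).mono_const (le_abs_self M)
  have h4 := ((sobolevNorm_le_iff.1 h2).of_le_mul
    (y := fun l => ((delta a b l ^ m : ℝ) : ℂ) * (e * fourierCoef a b (μ r) l)) (by norm_num) he.le
    fun l => by
      rw [mul_left_comm, norm_mul, Complex.norm_real, Real.norm_of_nonneg he.le]).mono_const
    (L := |M|) (by rw [mul_div_cancel₀ _ he.ne']; exact le_abs_self M)
  have h5 := h4.mono (y := fun l => Complex.I * sg s * (((delta a b l ^ m : ℝ) : ℂ) *
    (e * fourierCoef a b (μ r) l))) (by norm_num) fun l => by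
      rw [norm_mul, norm_mul Complex.I, norm_sg, Complex.norm_I, one_mul, one_mul]
  refine ((h3.sub (by norm_num) h5 (abs_nonneg _) (abs_nonneg _)).mono_const
    (by linarith)).mono (by norm_num) fun l => le_of_eq ?_
  have hδ : (delta a b l : ℂ) ≠ 0 := by exact_mod_cast (delta_pos a b l).ne'
  rw [twist, mul_left_comm, norm_mul, norm_rot, one_mul]
  congr 1
  rw [mul_sub]
  congr 1
  push_cast
  field_simp
  ring

namespace IsSolution

variable (H : IsSolution a b p ε T u₀ u₁ ν μ)
include H

lemma hasDerivWithinAt_left (hab : ∀ i, a i < b i) {r : ℝ} (hr : r ∈ Set.Icc 0 T)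
    (l : Fin d → ℤ) :
    HasDerivWithinAt (fun r => fourierCoef a b (ν r) l) (fourierCoef a b (μ r) l)
      (Set.Icc 0 T) r :=
  (H.deriv_left _ (contDiff_wave (-l)) (isPeriodic_wave hab _) r hr).const_mul _

/-- The weak equation tested against the plane wave of index −l, on which Δ − 1 acts as −δ_l². -/
lemma hasDerivWithinAt_right (hab : ∀ i, a i < b i) {r : ℝ} (hr : r ∈ Set.Icc 0 T)
    (l : Fin d → ℤ) :
    HasDerivWithinAt (fun r => ((ε ^ (2 * p) : ℝ) : ℂ) * fourierCoef a b (μ r) l)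
      (-(((ε ^ (2 * p) : ℝ) : ℂ)⁻¹ * ((delta a b l : ℂ) ^ 2 * fourierCoef a b (ν r) l)) -
        fourierCoef a b (fun x => nonlin p (ν r x)) l) (Set.Icc 0 T) r := by
  have h := (H.deriv_right _ (contDiff_wave (-l)) (isPeriodic_wave hab _) r hr).const_mul
    (((∏ i, (b i - a i) : ℝ) : ℂ)⁻¹)
  have h1 : ∀ x, ν r x * (Laplacian.laplacian (wave a b (-l)) x - wave a b (-l) x) =
      -(delta a b l : ℂ) ^ 2 * (ν r x * wave a b (-l) x) := by
    intro x
    rw [laplacian_wave, ← Complex.ofReal_pow, delta_sq]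
    simp only [freq_neg, neg_sq, weight]
    push_cast
    ring
  simp only [h1, MeasureTheory.integral_const_mul] at h
  refine HasDerivWithinAt.congr_deriv (h.congr (fun y _ => ?_) ?_) ?_
  · simp only [fourierCoef]; ring
  · simp only [fourierCoef]; ring
  · simp only [fourierCoef]; ring

/-- The rotation has frequency σδ/e, so its derivative cancels the linear part of the first order
system; σ² = 1 and i² = −1 match the position and velocity terms. -/
lemma isTwisted (hab : ∀ i, a i < b i) (hε : 0 < ε)
    (hs : ∀ r ∈ Set.Icc 0 T, Summable fun l => ‖fourierCoef a b (ν r) l‖) :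
    IsTwisted a b p (ε ^ (2 * p)) T (twist a b (ε ^ (2 * p)) ν μ) := by
  intro s l r hr
  have he : ((ε ^ (2 * p) : ℝ) : ℂ) ≠ 0 := by exact_mod_cast (pow_pos hε _).ne'
  have hδ : (delta a b l : ℂ) ≠ 0 := by exact_mod_cast (delta_pos a b l).ne'
  have h1 : HasDerivAt (fun r => rot a b (ε ^ (2 * p)) s (-r) l)
      (-(Complex.I * ((sg s * delta a b l / ε ^ (2 * p) : ℝ) : ℂ) *
        rot a b (ε ^ (2 * p)) s (-r) l)) r := by
    have := (hasDerivAt_rot (a := a) (b := b) (e := ε ^ (2 * p)) s (-r) l).scomp r (hasDerivAt_neg r)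
    simpa [Function.comp_def] using this
  have h2 := h1.hasDerivWithinAt.mul ((H.hasDerivWithinAt_left hab hr l).sub
    ((H.hasDerivWithinAt_right hab hr l).const_mul (Complex.I * sg s / delta a b l)))
  refine h2.congr_deriv ?_
  rw [comb_twist, ← fourierCoef_nonlin hab (hs r hr) fun x => (hasSum_fourierCoef hab
    (H.continuous_left r hr) (H.periodic_left r hr) (hs r hr).of_norm x).tsum_eq.symm]
  have hsq := sg_mul_self s
  have hE := inv_mul_cancel₀ he
  have hD := mul_inv_cancel₀ hδ
  rw [Complex.ofReal_div, Complex.ofReal_mul, Pi.sub_apply]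
  generalize ((ε ^ (2 * p) : ℝ) : ℂ) = E at *
  generalize (delta a b l : ℂ) = D at *
  generalize rot a b (ε ^ (2 * p)) s (-r) l = R
  generalize fourierCoef a b (ν r) l = c
  generalize fourierCoef a b (μ r) l = v
  generalize ((sg s : ℝ) : ℂ) = σ at *
  simp only [div_eq_mul_inv]
  linear_combination (Complex.I * σ * D * E⁻¹ * c * R) * hD +
    Complex.I ^ 2 * σ ^ 2 * R * v * (E⁻¹ * E * hD + hE) +
    R * v * (Complex.I ^ 2 * hsq + Complex.I_sq)

end IsSolution

end solutions

/-! ### Discrete Fourier coefficients and the scheme in twisted form. -/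

section grid

variable {d : ℕ} {a b : Fin d → ℝ} {p : ℕ} {N : Fin d → ℕ}

lemma sum_exp_eq {n : ℕ} (hn : 0 < n) (m : ℤ) :
    ∑ j : Fin n, Complex.exp (2 * Real.pi * Complex.I * (m / n)) ^ (j : ℕ) =
      if (n : ℤ) ∣ m then (n : ℂ) else 0 := by
  have hn' : (n : ℂ) ≠ 0 := by exact_mod_cast hn.ne'
  have hpi := Complex.two_pi_I_ne_zero
  have h1 : Complex.exp (2 * Real.pi * Complex.I * (m / n)) = 1 ↔ (n : ℤ) ∣ m := by
    rw [Complex.exp_eq_one_iff]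
    constructor
    · rintro ⟨k, hk⟩
      refine ⟨k, ?_⟩
      rw [mul_comm (k : ℂ)] at hk
      have h2 := mul_left_cancel₀ hpi hk
      rw [div_eq_iff hn'] at h2
      rw [mul_comm]
      exact_mod_cast h2
    · rintro ⟨k, rfl⟩
      refine ⟨k, ?_⟩
      push_cast
      field_simp
  rw [Fin.sum_univ_eq_sum_range fun j => Complex.exp (2 * Real.pi * Complex.I * (m / n)) ^ j]
  split_ifs with h
  · simp [h1.2 h]
  · have h2 : Complex.exp (2 * Real.pi * Complex.I * (m / n)) ≠ 1 := fun h3 => h (h1.1 h3)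
    rw [geom_sum_eq h2, ← Complex.exp_nat_mul]
    have h4 : (n : ℂ) * (2 * Real.pi * Complex.I * (m / n)) = m * (2 * Real.pi * Complex.I) := by
      field_simp
    rw [h4, Complex.exp_int_mul_two_pi_mul_I]
    simp

lemma wave_gridPt (hab : ∀ i, a i < b i) (l : Fin d → ℤ) (j : (i : Fin d) → Fin (N i)) :
    wave a b l (gridPt a b N j) =
      ∏ i, Complex.exp (2 * Real.pi * Complex.I * (l i / N i)) ^ (j i : ℕ) := by
  unfold wave
  simp only [← Complex.exp_nat_mul]
  rw [← Complex.exp_sum]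
  congr 1
  push_cast
  rw [Finset.mul_sum]
  refine Finset.sum_congr rfl fun i _ => ?_
  have hi : ((b i : ℂ) - a i) ≠ 0 := by exact_mod_cast (sub_pos.2 (hab i)).ne'
  simp only [freq, gridPt]
  push_cast
  field_simp
  ring

open Classical in
/-- Aliasing of plane waves on the grid. -/
lemma dft_wave (hab : ∀ i, a i < b i) (hN : ∀ i, 0 < N i ∧ Even (N i)) (k l : Fin d → ℤ) :
    dft a b N (fun j => wave a b k (gridPt a b N j)) l = if red N k = red N l then 1 else 0 := by
  unfold dft
  simp only [← wave_add]
  simp only [wave_gridPt hab]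
  have h1 := Finset.prod_univ_sum (fun i : Fin d => (Finset.univ : Finset (Fin (N i))))
    (fun i j => Complex.exp (2 * Real.pi * Complex.I * (((k + -l) i : ℤ) / N i)) ^ (j : ℕ))
  rw [Fintype.piFinset_univ] at h1
  rw [← h1, Finset.prod_congr rfl fun i _ => sum_exp_eq (hN i).1 ((k + -l) i)]
  have hN0 : (∏ i, (N i : ℂ)) ≠ 0 :=
    Finset.prod_ne_zero_iff.2 fun i _ => by exact_mod_cast (hN i).1.ne'
  split_ifs with h
  · rw [red_eq_iff] at h
    rw [Finset.prod_congr rfl fun i _ => if_pos (by simpa [sub_eq_add_neg] using h i)]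
    push_cast
    exact inv_mul_cancel₀ hN0
  · rw [red_eq_iff] at h
    push Not at h
    obtain ⟨i, hi⟩ := h
    have h2 : ∏ i, (if (N i : ℤ) ∣ (k + -l) i then (N i : ℂ) else 0) = 0 :=
      Finset.prod_eq_zero (Finset.mem_univ i) (if_neg (by simpa [sub_eq_add_neg] using hi))
    rw [h2, mul_zero]

/-- Aliasing of absolutely convergent sums of plane waves on the grid. -/
lemma dft_tsum (hab : ∀ i, a i < b i) (hN : ∀ i, 0 < N i ∧ Even (N i)) {ι : Type*} {F : ι → ℂ}
    (S : ι → Fin d → ℤ) (hF : Summable fun i => ‖F i‖) (l : Fin d → ℤ) :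
    dft a b N (fun j => ∑' i, F i * wave a b (S i) (gridPt a b N j)) l =
      push (fun i => red N (S i)) F (red N l) := by
  classical
  have hs : ∀ x : Pt d, Summable fun i => F i * wave a b (S i) x := fun x =>
    Summable.of_norm (by simpa only [norm_mul, norm_wave, mul_one] using hF)
  unfold dft push
  simp only [← tsum_mul_right]
  rw [← Summable.tsum_finsetSum fun j _ => (hs _).mul_right _, ← tsum_mul_left]
  refine tsum_congr fun i => ?_
  have h := dft_wave hab hN (S i) l
  unfold dft at h
  simp only [mul_assoc]
  rw [← Finset.mul_sum, mul_left_comm, h]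
  split_ifs <;> simp

lemma dft_finset_sum (hab : ∀ i, a i < b i) (hN : ∀ i, 0 < N i ∧ Even (N i))
    (c : (Fin d → ℤ) → ℂ) {l : Fin d → ℤ} (hl : l ∈ modes N) :
    dft a b N (fun j => ∑ k ∈ modes N, c k * wave a b k (gridPt a b N j)) l = c l := by
  classical
  unfold dft
  simp only [Finset.sum_mul, mul_assoc]
  rw [Finset.sum_comm, Finset.mul_sum, Finset.sum_eq_single_of_mem l hl]
  · have h := dft_wave hab hN l l
    rw [if_pos rfl] at h
    unfold dft at h
    rw [← Finset.mul_sum, mul_left_comm, h, mul_one]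
  · intro k hk hkl
    have h := dft_wave hab hN k l
    rw [if_neg fun h => hkl (red_injOn hN hk hl h)] at h
    unfold dft at h
    rw [← Finset.mul_sum, mul_left_comm, h, mul_zero]

lemma dft_multiplier (hab : ∀ i, a i < b i) (hN : ∀ i, 0 < N i ∧ Even (N i))
    (g : (Fin d → ℤ) → ℂ) (U : GridVec N) {l : Fin d → ℤ} (hl : l ∈ modes N) :
    dft a b N (multiplier a b N g U) l = g l * dft a b N U l :=
  dft_finset_sum hab hN (fun l => g l * dft a b N U l) hl

lemma dft_add (U V : GridVec N) (l : Fin d → ℤ) :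
    dft a b N (fun j => U j + V j) l = dft a b N U l + dft a b N V l := by
  simp only [dft, add_mul, Finset.sum_add_distrib, mul_add]

lemma dft_const_mul (c : ℂ) (U : GridVec N) (l : Fin d → ℤ) :
    dft a b N (fun j => c * U j) l = c * dft a b N U l := by
  simp only [dft, mul_assoc, ← Finset.mul_sum]
  ring

lemma dft_sub (U V : GridVec N) (l : Fin d → ℤ) :
    dft a b N (fun j => U j - V j) l = dft a b N U l - dft a b N V l := by
  simp only [dft, sub_mul, Finset.sum_sub_distrib, mul_sub]

/-- The discrete Fourier coefficients of the nonlinearity. -/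
lemma dft_nonlin (hab : ∀ i, a i < b i) (hN : ∀ i, 0 < N i ∧ Even (N i))
    {z : (Fin d → ℤ) → ℂ} (hz : ∀ l ∉ modes N, z l = 0) {U : GridVec N}
    (hU : ∀ j, U j = ∑ l ∈ modes N, z l * wave a b l (gridPt a b N j)) (l : Fin d → ℤ) :
    dft a b N (fun j => nonlin p (U j)) l = nl p (red N) z (red N l) := by
  have hs : Summable fun l => ‖z l‖ :=
    summable_of_ne_finset_zero (s := modes N) fun l hl => by simp [hz l hl]
  have h1 : ∀ j, U j = ∑' l, z l * wave a b l (gridPt a b N j) := fun j => by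
    rw [hU, tsum_eq_sum (s := modes N) fun l hl => by simp [hz l hl]]
  simp only [h1, nonlin_tsum hs]
  rw [dft_tsum hab hN _ (summable_mono hs)]
  rfl

/-- The component of sign `s` of a pair. -/
def side (s : Bool) (η : GridVec N × GridVec N) : GridVec N := if s then η.1 else η.2

lemma dft_halfStep (hab : ∀ i, a i < b i) (hN : ∀ i, 0 < N i ∧ Even (N i)) (s : Bool) (κ e : ℝ)
    (U : GridVec N) {l : Fin d → ℤ} (hl : l ∈ modes N) :
    dft a b N (halfStep a b N (sg s) (κ / e) U) l = rot a b e s (κ / 2) l * dft a b N U l := by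
  rw [halfStep, dft_multiplier hab hN _ _ hl, rot, cis]
  congr 4
  ring

lemma side_tsfpStep (s : Bool) (ε τ : ℝ) (η : GridVec N × GridVec N) :
    side s (tsfpStep a b N p ε τ η) = halfStep a b N (sg s) τ fun j =>
      halfStep a b N (sg s) τ (side s η) j + ((sg s * (ε ^ (2 * p) * τ) : ℝ) : ℂ) *
        multiplier a b N (fun l => Complex.I / (delta a b l : ℂ)) (fun j => nonlin p
          ((halfStep a b N 1 τ η.1 j + halfStep a b N (-1) τ η.2 j) / 2)) j := by
  cases s
  · simp [side, tsfpStep, sg, sub_eq_add_neg]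
  · simp [side, tsfpStep, sg]

variable (a b p N) in
/-- The discrete Fourier coefficients of the twisted numerical solution. -/
def numTwist (ε κ : ℝ) (u₀ u₁ : Pt d → ℂ) (n : ℕ) (s : Bool) : (Fin d → ℤ) → ℂ :=
  cut N fun l => rot a b (ε ^ (2 * p)) s (-(n * κ)) l *
    dft a b N (side s (tsfp a b N p ε (κ / ε ^ (2 * p)) u₀ u₁ n)) l

lemma rot_mul_numTwist {ε κ : ℝ} {u₀ u₁ : Pt d → ℂ} (n : ℕ) (s : Bool) {l : Fin d → ℤ}
    (hl : l ∈ modes N) (r : ℝ) :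
    rot a b (ε ^ (2 * p)) s (n * κ + r) l * numTwist a b p N ε κ u₀ u₁ n s l =
      rot a b (ε ^ (2 * p)) s r l *
        dft a b N (side s (tsfp a b N p ε (κ / ε ^ (2 * p)) u₀ u₁ n)) l := by
  rw [numTwist, cut, if_pos hl, rot_add]
  linear_combination (rot a b (ε ^ (2 * p)) s r l *
    dft a b N (side s (tsfp a b N p ε (κ / ε ^ (2 * p)) u₀ u₁ n)) l) *
    rot_mul_rot_neg (a := a) (b := b) (e := ε ^ (2 * p)) s (n * κ) l

/-- On the discrete coefficients at the modes every multiplier is diagonal. The two half steps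
therefore shift the rotation to the midpoint nκ + κ/2 and leave the midpoint rule for the twisted
equation; the prefactor of the nonlinearity is ε^{2p}τ = κ. -/
lemma isNumeric_numTwist (hab : ∀ i, a i < b i) (hN : ∀ i, 0 < N i ∧ Even (N i)) {ε κ : ℝ}
    (hε : 0 < ε) (u₀ u₁ : Pt d → ℂ) :
    IsNumeric a b p (ε ^ (2 * p)) N κ (numTwist a b p N ε κ u₀ u₁) := by
  refine ⟨fun n s l hl => by simp [numTwist, cut, hl], fun n s l hl => ?_⟩
  have he : ε ^ (2 * p) ≠ 0 := (pow_pos hε _).ne'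
  set η := tsfp a b N p ε (κ / ε ^ (2 * p)) u₀ u₁ n with hη
  have hsucc : tsfp a b N p ε (κ / ε ^ (2 * p)) u₀ u₁ (n + 1) =
      tsfpStep a b N p ε (κ / ε ^ (2 * p)) η := Function.iterate_succ_apply' _ _ _
  have hz : ∀ j, (halfStep a b N 1 (κ / ε ^ (2 * p)) η.1 j +
      halfStep a b N (-1) (κ / ε ^ (2 * p)) η.2 j) / 2 = ∑ l ∈ modes N,
        comb a b (ε ^ (2 * p)) (n * κ + κ / 2) (numTwist a b p N ε κ u₀ u₁ n) l *
          wave a b l (gridPt a b N j) := by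
    intro j
    simp only [halfStep, multiplier]
    rw [← Finset.sum_add_distrib, Finset.sum_div]
    refine Finset.sum_congr rfl fun l hl => ?_
    have h4 := rot_mul_numTwist (a := a) (b := b) (p := p) (ε := ε) (κ := κ) (u₀ := u₀) (u₁ := u₁)
      n true hl (κ / 2)
    have h5 := rot_mul_numTwist (a := a) (b := b) (p := p) (ε := ε) (κ := κ) (u₀ := u₀) (u₁ := u₁)
      n false hl (κ / 2)
    have h1 : ∀ s : Bool, Complex.exp (Complex.I *
        ((sg s * (κ / ε ^ (2 * p) * delta a b l / 2) : ℝ) : ℂ)) =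
        rot a b (ε ^ (2 * p)) s (κ / 2) l := by
      intro s
      rw [rot, cis]
      congr 3
      ring
    have h2 := h1 true
    have h3 := h1 false
    simp only [sg, if_true, Bool.false_eq_true, if_false] at h2 h3
    rw [h2, h3, comb, Fintype.sum_bool]
    simp only [side, if_true, Bool.false_eq_true, if_false, ← hη] at h4 h5
    linear_combination -(wave a b l (gridPt a b N j) / 2) * (h4 + h5)
  rw [numTwist, cut, if_pos hl, hsucc, side_tsfpStep, dft_halfStep hab hN s κ _ _ hl, dft_add,
    dft_const_mul, dft_halfStep hab hN s κ _ _ hl, dft_multiplier hab hN _ _ hl,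
    dft_nonlin hab hN (fun l hl => by simp [comb, numTwist, cut, hl]) hz, mul_div_cancel₀ _ he]
  rw [numTwist, cut, if_pos hl, ← hη]
  have h4 : rot a b (ε ^ (2 * p)) s (-((n + 1 : ℕ) * κ)) l *
      (rot a b (ε ^ (2 * p)) s (κ / 2) l * rot a b (ε ^ (2 * p)) s (κ / 2) l) =
      rot a b (ε ^ (2 * p)) s (-(n * κ)) l := by
    rw [← rot_add, ← rot_add]
    congr 1
    push_cast
    ring
  have h5 : rot a b (ε ^ (2 * p)) s (-((n + 1 : ℕ) * κ)) l * rot a b (ε ^ (2 * p)) s (κ / 2) l =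
      rot a b (ε ^ (2 * p)) s (-(n * κ + κ / 2)) l := by
    rw [← rot_add]
    congr 1
    push_cast
    ring
  rw [← h4, ← h5]
  push_cast
  ring

end grid

/-! ### Initial errors and the norm of the total error. -/

section convergence

variable {d : ℕ} {a b : Fin d → ℝ} {p : ℕ} {N : Fin d → ℕ}

/-- The interpolation error on the modes of the grid. -/
lemma alias_sub_bd (hN : ∀ i, 0 < N i ∧ Even (N i)) {P : ℝ} (hP : 0 < P) {m : ℕ} {ϱ K : ℝ}
    (hϱ : 0 ≤ ϱ) (hal : AliasBd a b N m P ϱ) {x : (Fin d → ℤ) → ℂ} (hx : Summable fun l => ‖x l‖)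
    {w : (Fin d → ℤ) → ℝ} (hw0 : ∀ l, 0 ≤ w l)
    (hw : ∀ l ∈ modes N, ∀ k, red N k = red N l → w l ≤ w k)
    (h : Bd 2 (fun l => ((delta a b l ^ m : ℝ) : ℂ) * (w l * x l)) K) :
    Bd P (fun l => (w l : ℂ) * cut N (fun l => x l - push (red N) x (red N l)) l) (ϱ * K) := by
  classical
  let y : (Fin d → ℤ) → ℝ≥0∞ := fun k => if k ∈ modes N then 0 else ENNReal.ofReal (w k) * ‖x k‖ₑ
  have hpt : ∀ l, ‖(w l : ℂ) * cut N (fun l => x l - push (red N) x (red N l)) l‖ₑ ≤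
      if l ∈ modes N then push (red N) y (red N l) else 0 := by
    intro l
    unfold cut
    by_cases hl : l ∈ modes N
    swap
    · simp [hl]
    rw [if_pos hl, if_pos hl, enorm_weight_mul (hw0 l), ← enorm_neg, neg_sub]
    have h1 := push_sub_push (S := red N) (S' := AddMonoidHom.id (Fin d → ℤ)) (g := red N l) hx
      (fun k (hk : AddMonoidHom.id _ k = l) => by rw [← hk]; rfl)
    rw [push_id] at h1
    rw [h1]
    refine (mul_le_mul_right (enorm_push_le _ _ _) _).trans ?_
    rw [← push_const_mul]
    unfold push
    refine ENNReal.tsum_le_tsum fun k => ?_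
    by_cases h3 : red N k = red N l
    · by_cases h4 : k = l
      · simp [h4]
      · have h5 : k ∉ modes N := fun h5 => h4 (red_injOn hN h5 hl h3)
        simp only [AddMonoidHom.id_apply, h3, h4, h5, y, if_true, if_false]
        gcongr
        -- A weight at a mode may be moved to any aliased frequency, because the mode has the least
        -- weight in its class.
        exact hw l hl k h3
    · simp [h3]
  refine (nrm_mono hP.le hpt).trans ((nrm_modes_le hN hP _).trans ?_)
  refine (hal y fun l hl => by simp [y, hl]).trans ?_
  rw [ENNReal.ofReal_mul hϱ]
  gcongr
  refine (nrm_mono (by norm_num) fun l => ?_).trans h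
  rw [enorm_weight_mul (pow_nonneg (delta_pos a b l).le _), enorm_weight_mul (hw0 l)]
  gcongr
  simp only [y]
  split_ifs <;> simp

lemma rot_zero (e : ℝ) (s : Bool) (l : Fin d → ℤ) : rot a b e s 0 l = 1 := by simp [rot]

variable {ε T κ : ℝ} {u₀ u₁ : Pt d → ℂ} {ν μ : ℝ → Pt d → ℂ}

lemma rot_mul_numTwist_self (n : ℕ) (s : Bool) {l : Fin d → ℤ} (hl : l ∈ modes N) :
    rot a b (ε ^ (2 * p)) s (n * κ) l * numTwist a b p N ε κ u₀ u₁ n s l =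
      dft a b N (side s (tsfp a b N p ε (κ / ε ^ (2 * p)) u₀ u₁ n)) l := by
  have := rot_mul_numTwist (a := a) (b := b) (p := p) (ε := ε) (κ := κ) (u₀ := u₀) (u₁ := u₁)
    n s hl 0
  rwa [add_zero, rot_zero, one_mul] at this

lemma dft_eq_push (hab : ∀ i, a i < b i) (hN : ∀ i, 0 < N i ∧ Even (N i)) {u : Pt d → ℂ}
    (hc : Continuous u) (hu : IsPeriodic a b u) (hs : Summable fun l => ‖fourierCoef a b u l‖)
    (l : Fin d → ℤ) :
    dft a b N (fun j => u (gridPt a b N j)) l = push (red N) (fourierCoef a b u) (red N l) := by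
  have h : ∀ j, u (gridPt a b N j) = ∑' l, fourierCoef a b u l * wave a b l (gridPt a b N j) :=
    fun j => (hasSum_fourierCoef hab hc hu hs.of_norm _).tsum_eq.symm
  simp only [h]
  exact dft_tsum hab hN (fun l => l) hs l

/-- The error of the initial values. -/
lemma init_bd (H : IsSolution a b p ε T u₀ u₁ ν μ) (hab : ∀ i, a i < b i) (hT : 0 ≤ T)
    (hε : 0 < ε) (hN : ∀ i, 0 < N i ∧ Even (N i)) {P : ℝ} (hP : 1 ≤ P) {m : ℕ} {ϱ K : ℝ}
    (hϱ : 0 ≤ ϱ) (hK : 0 ≤ K) (hal : AliasBd a b N m P ϱ)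
    (hs : Summable fun l => ‖fourierCoef a b (ν 0) l‖)
    (hs' : Summable fun l => ‖fourierCoef a b (μ 0) l‖)
    (h1 : Bd 2 (fun l => ((delta a b l ^ (m + 1) : ℝ) : ℂ) * fourierCoef a b (ν 0) l) K)
    (h2 : Bd 2 (fun l => ((delta a b l ^ m : ℝ) : ℂ) *
      (((ε ^ (2 * p) : ℝ) : ℂ) * fourierCoef a b (μ 0) l)) K) (s : Bool) :
    Bd P (fun l => (delta a b l : ℂ) * cut N (fun l => twist a b (ε ^ (2 * p)) ν μ 0 s l -
      numTwist a b p N ε κ u₀ u₁ 0 s l) l) (2 * K * ϱ) := by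
  have h0 : (0 : ℝ) ∈ Set.Icc 0 T := ⟨le_rfl, hT⟩
  have he : ((ε ^ (2 * p) : ℝ) : ℂ) ≠ 0 := by exact_mod_cast (pow_pos hε _).ne'
  have hd0 : ∀ j, u₀ (gridPt a b N j) = ν 0 (gridPt a b N j) := fun j => (H.initial_left _).symm
  have hd1 : ∀ j, u₁ (gridPt a b N j) = ((ε ^ (2 * p) : ℝ) : ℂ) * μ 0 (gridPt a b N j) := fun j => by
    rw [H.initial_right, mul_inv_cancel_left₀ he]
  -- For the position the weight δ stays with the coefficients, so m + 1 derivatives are used.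
  have e1 := alias_sub_bd hN (by linarith) hϱ hal (w := delta a b) hs
    (fun l => (delta_pos a b l).le) (fun l hl k hk => delta_le_of_red_eq hab hN hl hk)
    (K := K) (by
      convert h1 using 2 with l
      push_cast
      ring)
  -- For the velocity the weight δ cancels against the multiplier δ⁻¹, so the trivial weight and m
  -- derivatives suffice.
  have e2 := (alias_sub_bd hN (by linarith) hϱ hal (w := fun _ => 1)
    (x := fun l => ((ε ^ (2 * p) : ℝ) : ℂ) * fourierCoef a b (μ 0) l)
    (by simpa only [norm_mul] using hs'.mul_left _) (fun l => zero_le_one) (fun l _ k _ => le_rfl)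
    (K := K) (by simpa using h2)).mono (y := fun l => Complex.I * sg s * ((1 : ℝ) *
      cut N (fun l => ((ε ^ (2 * p) : ℝ) : ℂ) * fourierCoef a b (μ 0) l - push (red N)
        (fun l => ((ε ^ (2 * p) : ℝ) : ℂ) * fourierCoef a b (μ 0) l) (red N l)) l)) (by linarith)
    fun l => by rw [norm_mul, norm_mul Complex.I, norm_sg, Complex.norm_I, one_mul, one_mul]
  refine ((e1.sub hP e2 (by positivity) (by positivity)).mono_const (by linarith)).mono
    (by linarith) fun l => le_of_eq ?_
  congr 1
  by_cases hl : l ∈ modes N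
  swap
  · simp [cut, hl]
  have hδ : (delta a b l : ℂ) ≠ 0 := by exact_mod_cast (delta_pos a b l).ne'
  have h3 : numTwist a b p N ε κ u₀ u₁ 0 s l = push (red N) (fourierCoef a b (ν 0)) (red N l) -
      Complex.I * sg s / delta a b l * push (red N)
        (fun l => ((ε ^ (2 * p) : ℝ) : ℂ) * fourierCoef a b (μ 0) l) (red N l) := by
    have h4 := rot_mul_numTwist_self (a := a) (b := b) (p := p) (ε := ε) (κ := κ) (u₀ := u₀)
      (u₁ := u₁) 0 s hl
    rw [Nat.cast_zero, zero_mul, rot_zero, one_mul] at h4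
    have h5 : side s (tsfp a b N p ε (κ / ε ^ (2 * p)) u₀ u₁ 0) = fun j => u₀ (gridPt a b N j) +
        (-(Complex.I * sg s)) * multiplier a b N (fun l => (delta a b l : ℂ)⁻¹)
          (fun j => u₁ (gridPt a b N j)) j := by
      cases s
      · simp [side, tsfp, tsfpInit, sg]
      · simp [side, tsfp, tsfpInit, sg, sub_eq_add_neg]
    rw [h4, h5, dft_add, dft_const_mul, dft_multiplier hab hN _ _ hl]
    simp only [hd0, hd1]
    rw [dft_const_mul, dft_eq_push hab hN (H.continuous_left 0 h0) (H.periodic_left 0 h0) hs,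
      dft_eq_push hab hN (H.continuous_right 0 h0) (H.periodic_right 0 h0) hs', push_mul_left]
    ring
  simp only [cut, if_pos hl]
  rw [h3, twist, neg_zero, rot_zero]
  push_cast
  field_simp
  ring

lemma continuous_interp (U : GridVec N) : Continuous (interp a b N U) := by
  unfold interp
  exact continuous_finsetSum _ fun l _ => continuous_const.mul (continuous_wave l)

/-- The error of the scheme, in terms of the twisted variables. -/
lemma tsfpError_le (H : IsSolution a b p ε T u₀ u₁ ν μ) (hab : ∀ i, a i < b i) (hε : 0 < ε)
    (hN : ∀ i, 0 < N i ∧ Even (N i)) {n : ℕ} (hn : n * κ ∈ Set.Icc 0 T) {B : ℝ} (hB : 0 ≤ B)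
    (h : ∀ s, Bd 2 (fun l => (delta a b l : ℂ) * (twist a b (ε ^ (2 * p)) ν μ (n * κ) s l -
      numTwist a b p N ε κ u₀ u₁ n s l)) B) :
    tsfpError a b N p ε κ u₀ u₁ ν μ n ≤ ENNReal.ofReal (2 * B) := by
  have he0 : 0 < ε ^ (2 * p) := pow_pos hε _
  have he : ((ε ^ (2 * p) : ℝ) : ℂ) ≠ 0 := by exact_mod_cast he0.ne'
  have hsupp : ∀ s, ∀ l ∉ modes N, numTwist a b p N ε κ u₀ u₁ n s l = 0 :=
    fun s l hl => by simp [numTwist, cut, hl]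
  have hν : ∀ l, fourierCoef a b
      (fun x => ν (n * κ) x - interp a b N (tsfpNu a b N p ε κ u₀ u₁ n) x) l =
      comb a b (ε ^ (2 * p)) (n * κ) (fun s l => twist a b (ε ^ (2 * p)) ν μ (n * κ) s l -
      numTwist a b p N ε κ u₀ u₁ n s l) l := by
    intro l
    rw [fourierCoef_sub (H.continuous_left _ hn) (continuous_interp _), ← comb_sub, comb_twist]
    congr 1
    unfold interp
    rw [fourierCoef_finset_sum hab]
    by_cases hl : l ∈ modes N
    · rw [if_pos hl, comb, Fintype.sum_bool]
      have h1 := rot_mul_numTwist_self (a := a) (b := b) (p := p) (ε := ε) (κ := κ) (u₀ := u₀)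
        (u₁ := u₁) n true hl
      have h2 := rot_mul_numTwist_self (a := a) (b := b) (p := p) (ε := ε) (κ := κ) (u₀ := u₀)
        (u₁ := u₁) n false hl
      have h3 : tsfpNu a b N p ε κ u₀ u₁ n = fun j => (2 : ℂ)⁻¹ *
          ((tsfp a b N p ε (κ / ε ^ (2 * p)) u₀ u₁ n).1 j +
          (tsfp a b N p ε (κ / ε ^ (2 * p)) u₀ u₁ n).2 j) := by
        funext j
        rw [tsfpNu, div_eq_inv_mul]
      rw [h3, dft_const_mul, dft_add]
      simp only [side, if_true, Bool.false_eq_true, if_false] at h1 h2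
      linear_combination -(1 / 2) * (h1 + h2)
    · rw [if_neg hl]
      simp [comb, hsupp _ l hl]
  have hμ : ∀ l, fourierCoef a b
      (fun x => μ (n * κ) x - interp a b N (tsfpMu a b N p ε κ u₀ u₁ n) x) l =
      ((ε ^ (2 * p) : ℝ) : ℂ)⁻¹ * (Complex.I / 2 * rot a b (ε ^ (2 * p)) true (n * κ) l *
      (delta a b l * (twist a b (ε ^ (2 * p)) ν μ (n * κ) true l -
      numTwist a b p N ε κ u₀ u₁ n true l)) -
      Complex.I / 2 * rot a b (ε ^ (2 * p)) false (n * κ) l *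
      (delta a b l * (twist a b (ε ^ (2 * p)) ν μ (n * κ) false l -
      numTwist a b p N ε κ u₀ u₁ n false l))) := by
    intro l
    have hδ : (delta a b l : ℂ) ≠ 0 := by exact_mod_cast (delta_pos a b l).ne'
    have t1 := rot_mul_twist (a := a) (b := b) (ε ^ (2 * p)) ν μ (n * κ) true l
    have t2 := rot_mul_twist (a := a) (b := b) (ε ^ (2 * p)) ν μ (n * κ) false l
    -- The velocity is the difference of the two untwisted components, multiplied by iδ/(2e). The
    -- error bound with weight δ thus controls e times the velocity in L².
    have t3 : fourierCoef a b (μ (n * κ)) l = ((ε ^ (2 * p) : ℝ) : ℂ)⁻¹ *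
        (Complex.I / 2 * delta a b l * (rot a b (ε ^ (2 * p)) true (n * κ) l *
        twist a b (ε ^ (2 * p)) ν μ (n * κ) true l - rot a b (ε ^ (2 * p)) false (n * κ) l *
        twist a b (ε ^ (2 * p)) ν μ (n * κ) false l)) := by
      rw [t1, t2]
      simp only [sg, if_true, Bool.false_eq_true, if_false]
      generalize ((ε ^ (2 * p) : ℝ) : ℂ) = E at *
      field_simp
      push_cast
      ring_nf
      rw [Complex.I_sq]
      ring
    rw [fourierCoef_sub (H.continuous_right _ hn) (continuous_interp _)]
    unfold interp
    rw [fourierCoef_finset_sum hab, t3]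
    by_cases hl : l ∈ modes N
    · rw [if_pos hl]
      have h1 := rot_mul_numTwist_self (a := a) (b := b) (p := p) (ε := ε) (κ := κ) (u₀ := u₀)
        (u₁ := u₁) n true hl
      have h2 := rot_mul_numTwist_self (a := a) (b := b) (p := p) (ε := ε) (κ := κ) (u₀ := u₀)
        (u₁ := u₁) n false hl
      unfold tsfpMu
      rw [dft_const_mul, dft_multiplier hab hN _ _ hl, dft_sub]
      simp only [side, if_true, Bool.false_eq_true, if_false] at h1 h2
      linear_combination ((ε ^ (2 * p) : ℝ) : ℂ)⁻¹ * (Complex.I / 2) * delta a b l * (h1 - h2)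
    · rw [if_neg hl, hsupp _ l hl, hsupp _ l hl]
      ring
  unfold tsfpError
  have h1 : sobolevNorm a b 1
      (fun x => ν (n * κ) x - interp a b N (tsfpNu a b N p ε κ u₀ u₁ n) x) ≤ ENNReal.ofReal B := by
    rw [sobolevNorm_le_iff]
    simp only [hν, pow_one]
    exact comb_bd (by norm_num) hB h
  have h2 : sobolevNorm a b 0 (fun x => μ (n * κ) x -
      interp a b N (tsfpMu a b N p ε κ u₀ u₁ n) x) ≤ ENNReal.ofReal ((ε ^ (2 * p))⁻¹ * B) := by
    rw [sobolevNorm_le_iff]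
    have h3 := ((h true).of_le_mul (y := fun l => Complex.I / 2 *
      rot a b (ε ^ (2 * p)) true (n * κ) l * (delta a b l *
      (twist a b (ε ^ (2 * p)) ν μ (n * κ) true l - numTwist a b p N ε κ u₀ u₁ n true l)))
      (by norm_num) (c := 1 / 2) (by norm_num) fun l => by
        rw [norm_mul, norm_mul (Complex.I / 2), norm_rot]; simp).sub (by norm_num)
      ((h false).of_le_mul (y := fun l => Complex.I / 2 *
      rot a b (ε ^ (2 * p)) false (n * κ) l * (delta a b l *
      (twist a b (ε ^ (2 * p)) ν μ (n * κ) false l - numTwist a b p N ε κ u₀ u₁ n false l)))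
      (by norm_num) (c := 1 / 2) (by norm_num) fun l => by
        rw [norm_mul, norm_mul (Complex.I / 2), norm_rot]; simp) (by positivity) (by positivity)
    refine (h3.mono_const (L := B) (by linarith)).of_le_mul (by norm_num) (by positivity)
      fun l => ?_
    rw [hμ, pow_zero, Complex.ofReal_one, one_mul, norm_mul, norm_inv, Complex.norm_real,
      Real.norm_of_nonneg he0.le]
  calc _ ≤ ENNReal.ofReal B + ENNReal.ofReal (ε ^ (2 * p)) *
        ENNReal.ofReal ((ε ^ (2 * p))⁻¹ * B) := by gcongr
    _ = _ := by
      rw [← ENNReal.ofReal_mul he0.le, mul_inv_cancel_left₀ he0.ne', ← ENNReal.ofReal_add hB hB,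
        two_mul]

lemma errConst_nonneg {A : ℝ} (hT : 0 ≤ T) (hA : 1 ≤ A) (m M : ℕ) : 0 ≤ errConst p T A m M := by
  have h1 := midConst_nonneg (p := p) hT hA m
  have h2 := aliasConst_nonneg (p := p) hA M
  unfold errConst
  positivity

end convergence

/-! ### Assembly of the convergence estimate. -/

section main

variable {d : ℕ} {a b : Fin d → ℝ} {p : ℕ} {N : Fin d → ℕ} {ε T κ : ℝ} {u₀ u₁ : Pt d → ℂ}
  {ν μ : ℝ → Pt d → ℂ}

/-- Sobolev bounds of a solution bound its twisted variables. -/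
lemma twistedBounds_twist (H : IsSolution a b p ε T u₀ u₁ ν μ) (hab : ∀ i, a i < b i) (hε : 0 < ε)
    {m : ℕ} {M c : ℝ} (hc : 1 ≤ c)
    (hemb : ∀ (x : (Fin d → ℤ) → ℂ) (K : ℝ),
      Bd 2 (fun l => ((delta a b l ^ m : ℝ) : ℂ) * x l) K → Bd 1 x (c * K))
    (hM : ∀ r ∈ Set.Icc 0 T, sobolevNorm a b (m + 1) (ν r) ≤ ENNReal.ofReal M ∧
      sobolevNorm a b m (μ r) ≤ ENNReal.ofReal (M / ε ^ (2 * p))) :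
    TwistedBounds a b p (ε ^ (2 * p)) T (max 1 (c * (2 * |M|))) 2 m
      (twist a b (ε ^ (2 * p)) ν μ) := by
  have he : 0 < ε ^ (2 * p) := pow_pos hε _
  have hpow : ∀ r ∈ Set.Icc 0 T, ∀ s, Bd 2 (fun l => ((delta a b l ^ (m + 1) : ℝ) : ℂ) *
      twist a b (ε ^ (2 * p)) ν μ r s l) (2 * |M|) := fun r hr s =>
    twist_bd he (hM r hr).1 (hM r hr).2 s
  refine ⟨H.isTwisted hab hε fun r hr => ?_, le_max_left _ _, he, by norm_num, fun r hr s => ?_,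
    fun r hr s => (hpow r hr s).mono_const (le_max_of_le_right ?_)⟩
  · refine (hemb _ M ?_).summable
    exact (sobolevNorm_le_iff.1 (hM r hr).1).weight_mono (by norm_num)
      (fun l => (pow_pos (delta_pos a b l) _).le)
      fun l => pow_le_pow_right₀ (one_le_delta a b l) (Nat.le_succ m)
  -- Of the m + 1 derivatives one is kept as the weight δ and the other m pay for the embedding into
  -- ℓ¹.
  · refine (hemb _ (2 * |M|) ?_).mono_const (le_max_right _ _)
    convert hpow r hr s using 2 with l
    push_cast
    ring
  · nlinarith [abs_nonneg M]

/-- Convergence for solutions of fixed regularity, in terms of the ratio `κ / ε^{2p}`. -/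
theorem exists_tsfpError_le (hd : 1 ≤ d) (hab : ∀ i, a i < b i) (p : ℕ) {T : ℝ} (hT : 0 ≤ T)
    {m : ℕ} (hm : d < 2 * m) (M : ℝ) :
    ∃ h₀ : ℝ, 0 < h₀ ∧ ∃ τ₀ : ℝ, 0 < τ₀ ∧ ∃ C : ℝ, 0 < C ∧ ∀ ε : ℝ, 0 < ε → ε ≤ 1 →
      ∀ (u₀ u₁ : Pt d → ℂ) (ν μ : ℝ → Pt d → ℂ), IsSolution a b p ε T u₀ u₁ ν μ →
      (∀ r ∈ Set.Icc 0 T, sobolevNorm a b (m + 1) (ν r) ≤ ENNReal.ofReal M ∧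
        sobolevNorm a b m (μ r) ≤ ENNReal.ofReal (M / ε ^ (2 * p))) →
      ∀ N : Fin d → ℕ, (∀ i, 0 < N i ∧ Even (N i)) → meshSize a b N ≤ h₀ →
      ∀ κ : ℝ, 0 < κ → κ / ε ^ (2 * p) ≤ τ₀ → ∀ n : ℕ, n * κ ≤ T →
        tsfpError a b N p ε κ u₀ u₁ ν μ n ≤ ENNReal.ofReal (C * (meshSize a b N ^ m +
          κ ^ 2 / ε ^ (2 * p) + (κ / ε ^ (2 * p)) ^ (m + 1))) := by
  obtain ⟨c, hc, hemb⟩ := exists_nrm_one_le hab m hm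
  set A := max 1 (c * (2 * |M|)) with hA
  have hA1 : 1 ≤ A := le_max_left _ _
  have hMA : |M| ≤ A := le_max_of_le_right (by nlinarith [abs_nonneg M])
  have hE0 := errConst_nonneg (p := p) hT hA1 0 m
  have hE := errConst_nonneg (p := p) hT hA1 m m
  set E0 := errConst p T A 0 m
  set E := errConst p T A m m
  -- One third of the allowed ℓ¹ error for each of aliasing, κ²/e and κ/e.
  set τ₀ := (3 * (E0 + 1))⁻¹ with hτ
  have hτ0 : 0 < τ₀ := by positivity
  have hτ1 : τ₀ ≤ 1 := inv_le_one_of_one_le₀ (by linarith)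
  obtain ⟨h₀, hh₀, hal1⟩ := exists_aliasBd_one hab m hm hτ0
  set Z := Real.sqrt (∑' k : Fin d → ℤ, (‖k‖ ^ (2 * m))⁻¹) with hZ
  have hZ0 : 0 ≤ Z := Real.sqrt_nonneg _
  refine ⟨h₀, hh₀, τ₀, hτ0, 2 * (E * (Z + 1) + A), by positivity, ?_⟩
  intro ε hε hε1 u₀ u₁ ν μ H hM N hN hmesh κ hκ hκτ n hn
  have he : 0 < ε ^ (2 * p) := pow_pos hε _
  have he1 : ε ^ (2 * p) ≤ 1 := pow_le_one₀ hε.le hε1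
  have hh := meshSize_pos hab hN hd
  have h0T : (0 : ℝ) ∈ Set.Icc 0 T := ⟨le_rfl, hT⟩
  have TB := twistedBounds_twist H hab hε hc hemb hM
  rw [← hA] at TB
  have hnum := isNumeric_numTwist (p := p) (κ := κ) hab hN hε u₀ u₁
  have hS : ∀ r ∈ Set.Icc 0 T, ∀ s, Bd 2 (fun l => ((delta a b l ^ m : ℝ) : ℂ) *
      twist a b (ε ^ (2 * p)) ν μ r s l) A := fun r hr s =>
    (TB.bd_pow r hr s).weight_mono (by norm_num) (fun l => (pow_pos (delta_pos a b l) _).le)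
      fun l => pow_le_pow_right₀ (one_le_delta a b l) (Nat.le_succ m)
  have hc0 : Bd 2 (fun l => ((delta a b l ^ (m + 1) : ℝ) : ℂ) * fourierCoef a b (ν 0) l) A :=
    (sobolevNorm_le_iff.1 (hM 0 h0T).1).mono_const ((le_abs_self M).trans hMA)
  have hv0 : Bd 2 (fun l => ((delta a b l ^ m : ℝ) : ℂ) *
      (((ε ^ (2 * p) : ℝ) : ℂ) * fourierCoef a b (μ 0) l)) A :=
    ((sobolevNorm_le_iff.1 (hM 0 h0T).2).of_le_mul (by norm_num) he.le fun l => by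
      rw [mul_left_comm, norm_mul, Complex.norm_real, Real.norm_of_nonneg he.le]).mono_const
      (by rw [mul_div_cancel₀ _ he.ne']; exact (le_abs_self M).trans hMA)
  have hs0 : Summable fun l => ‖fourierCoef a b (ν 0) l‖ :=
    (hemb _ A (hc0.weight_mono (by norm_num) (fun l => (pow_pos (delta_pos a b l) _).le)
      fun l => pow_le_pow_right₀ (one_le_delta a b l) (Nat.le_succ m))).summable
  have hs1 : Summable fun l => ‖fourierCoef a b (μ 0) l‖ :=
    (hemb _ _ (sobolevNorm_le_iff.1 (hM 0 h0T).2)).summable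
  have hsmall : E0 * (τ₀ + κ ^ 2 / ε ^ (2 * p) + κ / ε ^ (2 * p)) ≤ 1 := by
    have h1 : κ ^ 2 / ε ^ (2 * p) ≤ τ₀ := by
      have h2 : κ ≤ 1 := by
        rw [div_le_iff₀ he] at hκτ
        nlinarith
      calc κ ^ 2 / ε ^ (2 * p) = κ * (κ / ε ^ (2 * p)) := by ring
        _ ≤ 1 * τ₀ := by gcongr
        _ = τ₀ := one_mul _
    calc E0 * (τ₀ + κ ^ 2 / ε ^ (2 * p) + κ / ε ^ (2 * p)) ≤ E0 * (3 * τ₀) := by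
          gcongr
          linarith
      _ ≤ (E0 + 1) * (3 * τ₀) := by gcongr; linarith
      _ = 1 := by rw [hτ]; field_simp
  -- First pass, in ℓ¹ with the rate-free aliasing bound τ₀; its only outcome is boundedness of the
  -- numerical solution. The second pass, in ℓ², is `hfine`.
  have hcoarse : ∀ k : ℕ, k * κ ≤ T → ∀ s, Bd 1 (numTwist a b p N ε κ u₀ u₁ k s) (2 * A) :=
    fun k hk s => TB.numeric_bd hN hS hτ0.le (hal1 N hN hmesh) hκ.le hnum
      (init_bd H hab hT hε hN le_rfl hτ0.le TB.zero_le (hal1 N hN hmesh) hs0 hs1 hc0 hv0)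
      hsmall k hk s
  have hϱ : 0 ≤ Z * meshSize a b N ^ m := by positivity
  have hal2 : AliasBd a b N m 2 (Z * meshSize a b N ^ m) := aliasBd_two hab hN hd m hm
  have hn0 : (n : ℝ) * κ ∈ Set.Icc 0 T := ⟨by positivity, hn⟩
  have hfine := TB.err_bd hN hS hϱ hal2 hκ.le hnum
    (init_bd H hab hT hε hN (by norm_num) hϱ TB.zero_le hal2 hs0 hs1 hc0 hv0) n hn
    (fun k hk s => hcoarse k (le_trans (by gcongr) hn) s)
  -- The part of the solution that the grid cannot represent: outside the modes hδ ≥ 1, so m of the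
  -- m + 1 derivatives convert into h^m.
  have htail : ∀ s, Bd 2 (fun l => (delta a b l : ℂ) * (twist a b (ε ^ (2 * p)) ν μ (n * κ) s l -
      cut N (twist a b (ε ^ (2 * p)) ν μ (n * κ) s) l)) (meshSize a b N ^ m * A) := fun s =>
    (TB.bd_pow _ hn0 s).of_le_mul (by norm_num) (by positivity) fun l => by
      unfold cut
      split_ifs with hl
      · simp only [sub_self, mul_zero, norm_zero]
        positivity
      · have h1 := one_le_pow₀ (n := m) (one_le_mesh_mul_delta hab hN hl)
        have hδ := delta_pos a b l
        rw [sub_zero, norm_mul, norm_mul, Complex.norm_real, Complex.norm_real,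
          Real.norm_of_nonneg hδ.le, Real.norm_of_nonneg (by positivity), ← mul_assoc]
        refine mul_le_mul_of_nonneg_right ?_ (norm_nonneg _)
        rw [mul_pow] at h1
        calc delta a b l = 1 * delta a b l := (one_mul _).symm
          _ ≤ meshSize a b N ^ m * delta a b l ^ m * delta a b l := by gcongr
          _ = _ := by ring
  set X := κ ^ 2 / ε ^ (2 * p) with hX
  set Y := (κ / ε ^ (2 * p)) ^ (m + 1) with hY
  have hX0 : 0 ≤ X := by positivity
  have hY0 : 0 ≤ Y := by positivity
  have hB0 : 0 ≤ E * (Z * meshSize a b N ^ m + X + Y) := by positivity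
  refine (tsfpError_le H hab hε hN hn0 (B := E * (Z * meshSize a b N ^ m + X + Y) +
    meshSize a b N ^ m * A) (by positivity) fun s => ?_).trans (ENNReal.ofReal_le_ofReal ?_)
  · refine ((hfine s).add (by norm_num) (htail s) hB0 (by positivity)).mono (by norm_num)
      fun l => le_of_eq ?_
    congr 1
    by_cases hl : l ∈ modes N
    · simp [cut, hl]
    · simp [cut, hl, hnum.supp n s l hl]
  · rw [mul_assoc]
    refine mul_le_mul_of_nonneg_left ?_ zero_le_two
    have hm0 : 0 ≤ meshSize a b N ^ m := by positivity
    have t1 : 0 ≤ E * meshSize a b N ^ m := by positivity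
    have t2 : 0 ≤ E * Z * (X + Y) := by positivity
    have t3 : 0 ≤ A * (X + Y) := by have := hA1; positivity
    nlinarith

end main

end KleinGordon

end

/-- Both claims specialize `exists_tsfpError_le`; they differ only in how (κ/ε^{2p})^{m+1} is
absorbed. -/
theorem theorem4p2 (d : ℕ) (hd : 1 ≤ d) (hd3 : d ≤ 3) (a b : Fin d → ℝ) (hab : ∀ i, a i < b i)
    (p : ℕ) (hp : 1 ≤ p) (T : ℝ) (hT : 0 < T) :
    (∀ m : ℕ, d < 2 * m → ∀ α : ℝ, 0 < α → ∀ M : ℝ,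
      ∃ h₀ : ℝ, 0 < h₀ ∧ ∃ κbar : ℝ, 0 < κbar ∧ κbar < 1 ∧ ∃ C : ℝ, 0 < C ∧
        ∀ κ₀ : ℝ, 0 < κ₀ → κ₀ ≤ κbar →
        ∀ ε : ℝ, 0 < ε → ε ≤ 1 →
        ∀ (u₀ u₁ : KleinGordon.Pt d → ℂ) (ν μ : ℝ → KleinGordon.Pt d → ℂ),
          KleinGordon.IsSolution a b p ε T u₀ u₁ ν μ →
          (∀ r ∈ Set.Icc 0 T,
            KleinGordon.sobolevNorm a b (m + 1) (ν r) ≤ ENNReal.ofReal M ∧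
            KleinGordon.sobolevNorm a b m (μ r) ≤ ENNReal.ofReal (M / ε ^ (2 * p))) →
        ∀ N : Fin d → ℕ, (∀ i, 0 < N i ∧ Even (N i)) → KleinGordon.meshSize a b N ≤ h₀ →
        ∀ κ : ℝ, 0 < κ → κ ≤ α * κ₀ * ε ^ (2 * p) →
        ∀ n : ℕ, n * κ ≤ T →
          KleinGordon.tsfpError a b N p ε κ u₀ u₁ ν μ n ≤
            ENNReal.ofReal (C * (KleinGordon.meshSize a b N ^ m + κ ^ 2 / ε ^ (2 * p)
              + κ₀ ^ (m + 1)))) ∧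
    (∀ (m : ℕ) (M : ℕ → ℝ) (θ : ℝ), 0 < θ →
      ∃ h₀ : ℝ, 0 < h₀ ∧ ∃ κ₁ : ℝ, 0 < κ₁ ∧ ∃ C : ℝ, 0 < C ∧
        ∀ ε : ℝ, 0 < ε → ε ≤ 1 →
        ∀ (u₀ u₁ : KleinGordon.Pt d → ℂ) (ν μ : ℝ → KleinGordon.Pt d → ℂ),
          KleinGordon.IsSolution a b p ε T u₀ u₁ ν μ →
          (∀ s : ℕ, ∀ r ∈ Set.Icc 0 T,
            KleinGordon.sobolevNorm a b (s + 1) (ν r) ≤ ENNReal.ofReal (M s) ∧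
            KleinGordon.sobolevNorm a b s (μ r) ≤ ENNReal.ofReal (M s / ε ^ (2 * p))) →
        ∀ N : Fin d → ℕ, (∀ i, 0 < N i ∧ Even (N i)) → KleinGordon.meshSize a b N ≤ h₀ →
        ∀ κ : ℝ, 0 < κ → κ ≤ κ₁ * ε ^ ((2 * p : ℕ) + θ) →
        ∀ n : ℕ, n * κ ≤ T →
          KleinGordon.tsfpError a b N p ε κ u₀ u₁ ν μ n ≤
            ENNReal.ofReal (C * (KleinGordon.meshSize a b N ^ m + κ ^ 2 / ε ^ (2 * p)))) := by
  constructor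
  · intro m hm α hα M
    obtain ⟨h₀, hh₀, τ₀, hτ₀, C, hC, key⟩ :=
      KleinGordon.exists_tsfpError_le hd hab p hT.le hm M
    -- The bound τ₀/α ensures κ/ε^{2p} ≤ ακ₀ ≤ τ₀, and 1/2 keeps the threshold below 1.
    refine ⟨h₀, hh₀, min (1 / 2) (τ₀ / α), by positivity,
      (min_le_left _ _).trans_lt (by norm_num), C * (1 + α ^ (m + 1)), by positivity, ?_⟩
    intro κ₀ hκ₀ hκ₀' ε hε hε1 u₀ u₁ ν μ H hM N hN hmesh κ hκ hκ' n hn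
    have he : 0 < ε ^ (2 * p) := pow_pos hε _
    have hh := KleinGordon.meshSize_pos hab hN hd
    have h1 : κ / ε ^ (2 * p) ≤ α * κ₀ := by rwa [div_le_iff₀ he]
    have h2 : α * κ₀ ≤ τ₀ := by
      have := hκ₀'.trans (min_le_right _ _)
      rw [le_div_iff₀ hα] at this
      linarith
    refine (key ε hε hε1 u₀ u₁ ν μ H hM N hN hmesh κ hκ (h1.trans h2) n hn).trans
      (ENNReal.ofReal_le_ofReal ?_)
    rw [mul_assoc]
    refine mul_le_mul_of_nonneg_left ?_ hC.le
    have h3 : (κ / ε ^ (2 * p)) ^ (m + 1) ≤ α ^ (m + 1) * κ₀ ^ (m + 1) := by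
      rw [← mul_pow]
      gcongr
    have t1 : 0 ≤ α ^ (m + 1) * (KleinGordon.meshSize a b N ^ m + κ ^ 2 / ε ^ (2 * p)) := by
      positivity
    have t2 : 0 ≤ κ₀ ^ (m + 1) := by positivity
    linarith
  · intro m M θ hθ
    obtain ⟨K, hK⟩ := exists_nat_ge (2 * p / θ)
    rw [div_le_iff₀ hθ] at hK
    -- The summand 2 secures d < 2(m + 2 + K) for d ≤ 3. Since Kθ ≥ 2p, the summand `K` makes
    -- (ε^θ)^{m+1+K} ≤ ε^{2p}, which reduces (κ/ε^{2p})² to κ²/ε^{2p}.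
    obtain ⟨h₀, hh₀, τ₀, hτ₀, C, hC, key⟩ := KleinGordon.exists_tsfpError_le (m := m + 2 + K) hd hab
      p hT.le (by omega) (M (m + 2 + K))
    -- With h ≤ 1 the higher power of h is at most h^m. The two entries of `min 1 τ₀` give κ/ε^{2p}
    -- ≤ ε^θ and κ/ε^{2p} ≤ τ₀.
    refine ⟨min h₀ 1, by positivity, min 1 τ₀, by positivity, 2 * C, by positivity, ?_⟩
    intro ε hε hε1 u₀ u₁ ν μ H hM N hN hmesh κ hκ hκ' n hn
    have he : 0 < ε ^ (2 * p) := pow_pos hε _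
    have hh := KleinGordon.meshSize_pos hab hN hd
    have h1 : κ / ε ^ (2 * p) ≤ min 1 τ₀ * ε ^ θ := by
      rw [div_le_iff₀ he]
      refine hκ'.trans (le_of_eq ?_)
      rw [Real.rpow_add hε, Real.rpow_natCast]
      ring
    have hεθ : ε ^ θ ≤ 1 := Real.rpow_le_one hε.le hε1 hθ.le
    have hεθ0 : 0 < ε ^ θ := Real.rpow_pos_of_pos hε θ
    have h2 : κ / ε ^ (2 * p) ≤ τ₀ := by
      refine h1.trans ?_
      calc min 1 τ₀ * ε ^ θ ≤ τ₀ * 1 := by gcongr; exact min_le_right _ _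
        _ = τ₀ := mul_one _
    have h3 : κ / ε ^ (2 * p) ≤ ε ^ θ := by
      refine h1.trans ?_
      calc min 1 τ₀ * ε ^ θ ≤ 1 * ε ^ θ := by gcongr; exact min_le_left _ _
        _ = ε ^ θ := one_mul _
    refine (key ε hε hε1 u₀ u₁ ν μ H (hM _) N hN (hmesh.trans (min_le_left _ _)) κ hκ h2 n
      hn).trans (ENNReal.ofReal_le_ofReal ?_)
    have h4 : KleinGordon.meshSize a b N ^ (m + 2 + K) ≤ KleinGordon.meshSize a b N ^ m :=
      pow_le_pow_of_le_one hh.le (hmesh.trans (min_le_right _ _)) (by omega)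
    have h5 : (ε ^ θ) ^ (m + 1 + K) ≤ ε ^ (2 * p) := by
      rw [← Real.rpow_mul_natCast hε.le, ← Real.rpow_natCast ε (2 * p)]
      refine Real.rpow_le_rpow_of_exponent_ge hε hε1 ?_
      push_cast
      nlinarith [(Nat.cast_nonneg m : (0 : ℝ) ≤ m)]
    have h6 : (κ / ε ^ (2 * p)) ^ (m + 2 + K + 1) ≤ κ ^ 2 / ε ^ (2 * p) := by
      calc (κ / ε ^ (2 * p)) ^ (m + 2 + K + 1)
          = (κ / ε ^ (2 * p)) ^ 2 * (κ / ε ^ (2 * p)) ^ (m + 1 + K) := by ring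
        _ ≤ (κ / ε ^ (2 * p)) ^ 2 * (ε ^ θ) ^ (m + 1 + K) := by gcongr
        _ ≤ (κ / ε ^ (2 * p)) ^ 2 * ε ^ (2 * p) := by gcongr
        _ = κ ^ 2 / ε ^ (2 * p) := by field_simp
    have h7 : 0 ≤ KleinGordon.meshSize a b N ^ m := by positivity
    calc C * (KleinGordon.meshSize a b N ^ (m + 2 + K) + κ ^ 2 / ε ^ (2 * p) +
          (κ / ε ^ (2 * p)) ^ (m + 2 + K + 1))
        ≤ C * (2 * (KleinGordon.meshSize a b N ^ m + κ ^ 2 / ε ^ (2 * p))) := by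
          gcongr
          linarith
      _ = _ := by ring
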